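/- Let $d\ge 1$ and $\sigma\in(0,2)$, let $\chi_\sigma(y)=0$ if $\sigma<1$, $\chi_\sigma(y)=1_{\{|y|\le 1\}}$ if $\sigma=1$, and $\chi_\sigma(y)=1$ if $\sigma>1$. Let $\mathfrak A^\sigma$ be the class of nonnegative measures $\nu$ on $\mathbf R^d\setminus\{0\}$ with $\int(|y|^2\wedge 1)\,d\nu<\infty$, $\sigma=\inf\{\alpha<2:\int_{|y|\le1}|y|^\alpha d\nu<\infty\}$, $\int_{|y|>1}|y|\,d\nu<\infty$ if $\sigma\in(1,2)$, and $\int_{R<|y|\le R'}y\,d\nu=0$ for all $0<R<R'<\infty$ if $\sigma=1$. For $\nu\in\mathfrak A^\sigma$ put $$\psi^\nu(\xi)=\int\big[e^{i2\pi\xi\cdot y}-1-i2\pi\chi_\sigma(y)\,\xi\cdot y\big]\nu(dy),\qquad w(r)=w_\nu(r)=\nu(\{|y|>r\})^{-1},\quad r>0,$$ $\nu^*(dy)=\nu(-dy)$, $\nu_{sym}=\frac12(\nu+\nu^*)$, $\tilde\nu_R(dy)=w(R)\,\nu(R\,dy)$, and, with $\mathcal Ff(\xi)=\int e^{-i2\pi\xi\cdot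 x}f(x)\,dx$, let $L^{\nu;1/2}f=\mathcal F^{-1}\big[-(-\psi^{\nu_{sym}})^{1/2}\mathcal Ff\big]$. Let $\nu\in\mathfrak A^\sigma$ and assume that $w=w_\nu$ is a continuous O-RV function at zero and infinity, i.e. $w$ is positive, finite and continuous on $(0,\infty)$ and for all $x>0$ $$r_1(x)=\limsup_{\epsilon\to0}\frac{w(\epsilon x)}{w(\epsilon)}<\infty,\qquad r_2(x)=\limsup_{\epsilon\to\infty}\frac{w(\epsilon x)}{w(\epsilon)}<\infty .$$ Let $p_i=\lim_{x\to0}\frac{\log r_i(x)}{\log x}$ and $q_i=\lim_{x\to\infty}\frac{\log r_i(x)}{\log x}$, $i=1,2$ (these limits exist), and assume: **A.** For $i=1,2$: $0<p_i\le q_i<1$ if $\sigma\in(0,1)$; $0<p_i\le1\le q_i<2$ if $\sigma=1$; $1<p_i\le q_i<2$ if $\sigma\in(1,2)$. **B.** $\displaystyle\inf_{R\in(0,\infty),\,|\hat\xi|=1}\int_{|y|\le1}|\hat\xi\cdot y|^2\,\tilde\nu_R(dy)>0.$ Let $Z^{\nu^*}$ be a Lévy process associated to $\nu^*$, i.e.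 a càdlàg process with independent increments, $Z_0^{\nu^*}=0$ and $\mathbf E e^{i2\pi\xi\cdot Z_t^{\nu^*}}=\exp\{\psi^{\nu^*}(\xi)t\}$ for all $\xi\in\mathbf R^d$, $t\ge0$. Then for every $t>0$ the law of $Z_t^{\nu^*}$ has a density $p^{\nu^*}(t,\cdot)$ with respect to Lebesgue measure, and $(-\psi^{\nu_{sym}})^{1/2}\mathcal Fp^{\nu^*}(t,\cdot)$ is integrable, so that for $\lambda\ge0$ and $\epsilon>0$ the kernel $$K_\lambda^\epsilon(t,x)=e^{-\lambda t}\,\big(L^{\nu;1/2}p^{\nu^*}(t,\cdot)\big)(x)\,1_{[\epsilon,\infty)}(t),\qquad t\in\mathbf R,\ x\in\mathbf R^d$$ (equal to $0$ for $t<\epsilon$) is well defined. Moreover, there are constants $C_0>0$ and $N>0$, independent of $\epsilon>0$ and of $\lambda\ge0$, such that for all $\eta>0$, all $s\in\mathbf R$ with $|s|\le w(\eta)$ and all $y\in\mathbf R^d$ with $|y|\le\eta$, $$\int_{-\infty}^\infty\Big[\int_{\mathbf R^d}1_{Q_{C_0\eta}(0)^c}(t,x)\,\big|K_\lambda^\epsilon(t-s,x-y)-K_\lambda^\epsilon(t,x)\big|\,dx\Big]^2dt\le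 N,$$ where $Q_{C_0\eta}(0)=(-w(C_0\eta),w(C_0\eta))\times\{x:|x|<C_0\eta\}$. -/

import Mathlib

open MeasureTheory ProbabilityTheory Filter Topology Set
open scoped ENNReal NNReal FourierTransform RealInnerProductSpace

noncomputable section

namespace LevyKernel

/-- The class `𝔄^σ` of (nonnegative) Lévy measures of order `σ` on `ℝ^d ∖ {0}`; a measure on
`ℝ^d ∖ {0}` is a measure on `ℝ^d` that does not charge the origin. -/
structure LevyClass {d : ℕ} (σ : ℝ) (ν : Measure (EuclideanSpace ℝ (Fin d))) : Prop where
  zero : ν {0} = 0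
  lintegral_lt_top : ∫⁻ y, ENNReal.ofReal (min (‖y‖ ^ 2) 1) ∂ν < ∞
  order : IsGLB {α : ℝ | α < 2 ∧
    ∫⁻ y in Metric.closedBall 0 1, ENNReal.ofReal (‖y‖ ^ α) ∂ν < ∞} σ
  tail : 1 < σ → ∫⁻ y in {y | 1 < ‖y‖}, ENNReal.ofReal ‖y‖ ∂ν < ∞
  annulus : σ = 1 → ∀ R R' : ℝ, 0 < R → R < R' → ∫ y in {y | R < ‖y‖ ∧ ‖y‖ ≤ R'}, y ∂ν = 0

open scoped Classical in
/-- The truncation `χ_σ`: `0` if `σ < 1`, `1_{|y| ≤ 1}` if `σ = 1`, `1` if `σ > 1`. -/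
def truncation {d : ℕ} (σ : ℝ) (y : EuclideanSpace ℝ (Fin d)) : ℝ :=
  if σ < 1 then 0 else if σ = 1 then (if ‖y‖ ≤ 1 then 1 else 0) else 1

/-- The symbol
`ψ^ν(ξ) = ∫ [exp(i 2π ξ·y) - 1 - i 2π χ_σ(y) ξ·y] ν(dy)`. -/
def symbol {d : ℕ} (σ : ℝ) (ν : Measure (EuclideanSpace ℝ (Fin d)))
    (ξ : EuclideanSpace ℝ (Fin d)) : ℂ :=
  ∫ y, (Complex.exp (2 * Real.pi * Complex.I * (⟪ξ, y⟫ : ℝ)) - 1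
    - 2 * Real.pi * Complex.I * (truncation σ y : ℝ) * (⟪ξ, y⟫ : ℝ)) ∂ν

/-- The reflected measure `ν^*(dy) = ν(-dy)`. -/
def reflect {d : ℕ} (ν : Measure (EuclideanSpace ℝ (Fin d))) :
    Measure (EuclideanSpace ℝ (Fin d)) :=
  ν.map (fun y => -y)

/-- The symmetrization `ν_sym(dy) = (ν(dy) + ν(-dy)) / 2`. -/
def symmetrize {d : ℕ} (ν : Measure (EuclideanSpace ℝ (Fin d))) :
    Measure (EuclideanSpace ℝ (Fin d)) :=
  (2⁻¹ : ℝ≥0∞) • (ν + reflect ν)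

/-- `w_ν(r) = 1 / ν({|y| > r})`. -/
def w {d : ℕ} (ν : Measure (EuclideanSpace ℝ (Fin d))) (r : ℝ) : ℝ :=
  (ν.real {y | r < ‖y‖})⁻¹

/-- The rescaled measure `ν̃_R(dy) = w_ν(R) ν(R dy)`, that is `ν̃_R(Γ) = w_ν(R) ν(R Γ)`. -/
def rescale {d : ℕ} (ν : Measure (EuclideanSpace ℝ (Fin d))) (R : ℝ) :
    Measure (EuclideanSpace ℝ (Fin d)) :=
  ENNReal.ofReal (w ν R) • ν.map (fun y => R⁻¹ • y)

/-- `r₁(x) = limsup_{ε → 0+} f(ε x) / f(ε)`. -/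
def ratioZero (f : ℝ → ℝ) (x : ℝ) : ℝ≥0∞ :=
  limsup (fun ε : ℝ => ENNReal.ofReal (f (ε * x) / f ε)) (𝓝[>] 0)

/-- `r₂(x) = limsup_{ε → ∞} f(ε x) / f(ε)`. -/
def ratioInfty (f : ℝ → ℝ) (x : ℝ) : ℝ≥0∞ :=
  limsup (fun ε : ℝ => ENNReal.ofReal (f (ε * x) / f ε)) atTop

/-- `f` is O-RV on `(0, ∞)` both at zero and at infinity: a positive, finite, measurable function
with `r₁(x) < ∞` and `r₂(x) < ∞` for all `x > 0`. -/
structure IsORV (f : ℝ → ℝ) : Prop where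
  pos : ∀ r, 0 < r → 0 < f r
  measurable : Measurable ((Ioi (0 : ℝ)).domRestrict f)
  ratioZero_lt_top : ∀ x, 0 < x → ratioZero f x < ∞
  ratioInfty_lt_top : ∀ x, 0 < x → ratioInfty f x < ∞

/-- The lower index `lim_{x → 0+} log r(x) / log x` attached to `r = r₁` or `r = r₂`; for O-RV
functions the limit exists. -/
def lowerIndex (r : ℝ → ℝ≥0∞) : ℝ :=
  limUnder (𝓝[>] (0 : ℝ)) (fun x => Real.log (r x).toReal / Real.log x)

/-- The upper index `lim_{x → ∞} log r(x) / log x` attached to `r = r₁` or `r = r₂`; for O-RV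
functions the limit exists. -/
def upperIndex (r : ℝ → ℝ≥0∞) : ℝ :=
  limUnder atTop (fun x : ℝ => Real.log (r x).toReal / Real.log x)

/-- Admissibility of one pair `(p, q)` of lower and upper indices for the order `σ ∈ (0, 2)`. -/
def IndexCondition (σ p q : ℝ) : Prop :=
  (σ < 1 → 0 < p ∧ p ≤ q ∧ q < 1) ∧
  (σ = 1 → 0 < p ∧ p ≤ 1 ∧ 1 ≤ q ∧ q < 2) ∧
  (1 < σ → 1 < p ∧ p ≤ q ∧ q < 2)

/-- Assumption **A**, for the indices `p₁, q₁` at zero and `p₂, q₂` at infinity of `w_ν`. -/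
def AssumptionA {d : ℕ} (σ : ℝ) (ν : Measure (EuclideanSpace ℝ (Fin d))) : Prop :=
  IndexCondition σ (lowerIndex (ratioZero (w ν))) (upperIndex (ratioZero (w ν))) ∧
  IndexCondition σ (lowerIndex (ratioInfty (w ν))) (upperIndex (ratioInfty (w ν)))

/-- Assumption **B** (nondegeneracy): `inf ∫_{|y| ≤ 1} |ξ·y|² ν̃_R(dy) > 0`, the infimum being over
`R > 0` and `|ξ| = 1`. -/
def AssumptionB {d : ℕ} (ν : Measure (EuclideanSpace ℝ (Fin d))) : Prop :=
  0 < ⨅ R : Ioi (0 : ℝ), ⨅ ξ : Metric.sphere (0 : EuclideanSpace ℝ (Fin d)) 1,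
    ∫⁻ y in Metric.closedBall 0 1,
      ENNReal.ofReal (|⟪(ξ : EuclideanSpace ℝ (Fin d)), y⟫| ^ 2) ∂(rescale ν (R : ℝ))

/-- `Z` is a Lévy process associated to `L^ν`: a càdlàg process started at zero with independent
increments and `E exp(i 2π ξ·Z_t) = exp(ψ^ν(ξ) t)`. -/
structure IsLevyProcess {d : ℕ} {Ω : Type*} [MeasurableSpace Ω] (P : Measure Ω) (σ : ℝ)
    (ν : Measure (EuclideanSpace ℝ (Fin d))) (Z : ℝ≥0 → Ω → EuclideanSpace ℝ (Fin d)) : Prop where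
  measurable : ∀ t, Measurable (Z t)
  zero : ∀ᵐ ω ∂P, Z 0 ω = 0
  cadlag : ∀ᵐ ω ∂P, ∀ t : ℝ≥0, ContinuousWithinAt (fun s => Z s ω) (Ici t) t ∧
    ∃ l, Tendsto (fun s => Z s ω) (𝓝[<] t) (𝓝 l)
  indep : HasIndepIncrements Z P
  charFun : ∀ (t : ℝ≥0) (ξ : EuclideanSpace ℝ (Fin d)),
    ∫ ω, Complex.exp (2 * Real.pi * Complex.I * (⟪ξ, Z t ω⟫ : ℝ)) ∂P
      = Complex.exp (symbol σ ν ξ * (t : ℝ))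

/-- The density `p(t, x)` (with respect to Lebesgue measure) of the law of `Z_t`, `t > 0`. -/
def density {d : ℕ} {Ω : Type*} [MeasurableSpace Ω] (P : Measure Ω)
    (Z : ℝ≥0 → Ω → EuclideanSpace ℝ (Fin d)) (t : ℝ) (x : EuclideanSpace ℝ (Fin d)) : ℝ :=
  ((P.map (Z t.toNNReal)).rnDeriv volume x).toReal

/-- The Fourier multiplier `-(-ψ^{ν_sym})^κ` of `L^{ν;κ}`; note that `ψ^{ν_sym}` takes values in
`(-∞, 0]`. -/
def fracSymbol {d : ℕ} (σ : ℝ) (ν : Measure (EuclideanSpace ℝ (Fin d))) (κ : ℝ)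
    (ξ : EuclideanSpace ℝ (Fin d)) : ℂ :=
  -(((-(symbol σ (symmetrize ν) ξ).re) ^ κ : ℝ) : ℂ)

/-- The operator `L^{ν;κ} f = 𝓕⁻¹[-(-ψ^{ν_sym})^κ 𝓕 f]`, where
`𝓕 f(ξ) = ∫ exp(-i 2π ξ·x) f(x) dx`. -/
def fracOp {d : ℕ} (σ : ℝ) (ν : Measure (EuclideanSpace ℝ (Fin d))) (κ : ℝ)
    (f : EuclideanSpace ℝ (Fin d) → ℂ) : EuclideanSpace ℝ (Fin d) → ℂ :=
  𝓕⁻ (fun ξ => fracSymbol σ ν κ ξ * 𝓕 f ξ)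

open scoped Classical in
/-- The kernel `K_λ^ε(t, x) = exp(-λ t) (L^{ν;1/2} p(t, ·))(x) 1_{t ≥ ε}`. -/
def kernel {d : ℕ} (σ : ℝ) (ν : Measure (EuclideanSpace ℝ (Fin d)))
    (p : ℝ → EuclideanSpace ℝ (Fin d) → ℝ) (lam ε t : ℝ) (x : EuclideanSpace ℝ (Fin d)) : ℂ :=
  if ε ≤ t then
    ((Real.exp (-lam * t) : ℝ) : ℂ) * fracOp σ ν (1 / 2) (fun z => ((p t z : ℝ) : ℂ)) x
  else 0

/-- The parabolic cylinder `Q_r(0) = (-w_ν(r), w_ν(r)) × {|x| < r}`. -/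
def cylinder {d : ℕ} (ν : Measure (EuclideanSpace ℝ (Fin d))) (r : ℝ) :
    Set (ℝ × EuclideanSpace ℝ (Fin d)) :=
  Ioo (-(w ν r)) (w ν r) ×ˢ Metric.ball 0 r

end LevyKernel

end

set_option linter.unusedSectionVars false

noncomputable section

namespace LevyKernel

/-! ### The character `u ↦ exp(2πiu)` -/

/-! Write ψ for the symbol of ν. The law of the process attached to the reflected measure has
Fourier transform exp(tψ), because the reflection cancels the sign convention of 𝓕. Moreover the
symbol of the symmetrized measure is Re ψ. Up to sign, the kernel is therefore exp(-λt) 𝓕⁻[(-Re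
ψ)^(1/2) exp(tψ)], cut off at t ≥ ε. The guiding principle is that at time t = w(a) this kernel
lives at the spatial scale a and has L¹ norm of order t^(-1/2).

Scaling. The function w(a)ψ(ξ) is the Lévy exponent of the rescaled measure, evaluated at aξ, so it
suffices to bound normalized exponents uniformly. Regular variation and Assumption A give two-sided
power bounds for w with exponents p and q (`IsORV.exists_scaling`). Hence the rescaled measures have
bounded second moment on the unit ball, unit mass and a bounded β-moment outside it, and bounded
drift (`rescale_moments`, `rescale_drift`). Assumption B, used at the scale a/(2‖ζ‖), makes the real
part of the small-jump symbol at most -c‖ζ‖^p for ‖ζ‖ ≥ 1 (`smallSymbol_rescale_re_le`).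

Weighted L¹ bounds. For an even submultiplicative weight, the functions whose inverse Fourier
transform has finite weighted norm behave like a Banach algebra (`wnorm_mul_le`). The exponential of
a normalized exponent is a product of three factors. The small jumps give a smooth function whose
derivatives are integrable. The large jumps give a compound Poisson factor, expanded into
convolution powers. The drift gives a translation. Consequently exp(tψ), tψ(±ξ)exp(tψ) and a⟪v,
ξ⟫exp(tψ) have weighted norms bounded by multiples of 1, 1 and ‖v‖ for the weight (1+‖x‖/a)^β, t =
w(a). `IsScaledSymbol` records this, and everything about the kernel follows from it.

Square root. The subordination formula x^(1/2) = π^(-1/2) ∫ r^(-1/2) x exp(-rx) dr, split at r = t,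
gives a weighted norm of order t^(-1/2) (`wnorm_rootSymbol_le`). Writing exp(tψ) as a product of two
half-time factors then yields L¹ moduli of continuity in space and time, and the weight yields
tails.

Conclusion. Put δ = w(η). For |t| < w(C₀η) the complement of the cylinder forces ‖x‖ ≥ C₀η. The
tails are then bounded by t^(-1/2)(t/δ)^(β/q), whose square is integrable near 0 with integral
independent of η. For larger t, the moduli of continuity give t^(-1/2)(δ/t)^γ, whose square is
integrable at infinity. The cut-off at ε adds a term of size t^(-1/2), but only on |t-ε| ≤ δ, where
t ≥ δ, so its square also integrates to a constant. -/

/-- `phase u = exp(2πiu)`. -/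
def phase (u : ℝ) : ℂ := Complex.exp (2 * Real.pi * Complex.I * u)

lemma phase_eq (u : ℝ) : phase u = Complex.exp ((2 * Real.pi * u : ℝ) * Complex.I) := by
  rw [phase]; congr 1; push_cast; ring

@[simp] lemma norm_phase (u : ℝ) : ‖phase u‖ = 1 := by
  rw [phase_eq, Complex.norm_exp_ofReal_mul_I]

@[simp] lemma phase_zero : phase 0 = 1 := by simp [phase]

lemma phase_add (u v : ℝ) : phase (u + v) = phase u * phase v := by
  rw [phase, phase, phase, ← Complex.exp_add]; congr 1; push_cast; ring

@[fun_prop] lemma continuous_phase : Continuous phase := by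
  unfold phase; fun_prop

lemma phase_neg (u : ℝ) : phase (-u) = (starRingEnd ℂ) (phase u) := by
  rw [phase_eq, phase_eq, ← Complex.exp_conj]; congr 1
  rw [map_mul, Complex.conj_I, Complex.conj_ofReal]; push_cast; ring

lemma phase_re (u : ℝ) : (phase u).re = Real.cos (2 * Real.pi * u) := by
  rw [phase_eq, Complex.exp_ofReal_mul_I_re]

lemma hasDerivAt_phase (u : ℝ) : HasDerivAt phase (2 * Real.pi * Complex.I * phase u) u := by
  have h : HasDerivAt (fun u : ℝ => 2 * Real.pi * Complex.I * (u : ℂ))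
      (2 * Real.pi * Complex.I * 1) u :=
    (Complex.ofRealCLM.hasDerivAt (x := u)).const_mul _
  have h2 := h.cexp
  rw [mul_one, mul_comm (Complex.exp _)] at h2
  exact h2

lemma norm_phase_sub_one_le (u : ℝ) : ‖phase u - 1‖ ≤ 2 * Real.pi * |u| := by
  have := Real.norm_exp_I_mul_ofReal_sub_one_le (x := 2 * Real.pi * u)
  rw [phase_eq, mul_comm _ Complex.I]
  refine this.trans (le_of_eq ?_)
  rw [Real.norm_eq_abs, abs_mul, abs_of_pos Real.two_pi_pos]

lemma norm_phase_sub_one_le_two (u : ℝ) : ‖phase u - 1‖ ≤ 2 := by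
  refine (norm_sub_le _ _).trans ?_
  simp; norm_num

/-- The left side vanishes at 0 and its derivative on [0, v] is at most 4π²v, so the mean value
inequality applies. Negative arguments follow by conjugation. -/
lemma norm_phase_sub_one_sub_le (u : ℝ) :
    ‖phase u - 1 - 2 * Real.pi * Complex.I * u‖ ≤ 4 * Real.pi ^ 2 * u ^ 2 := by
  have key : ∀ v : ℝ, 0 ≤ v →
      ‖phase v - 1 - 2 * Real.pi * Complex.I * v‖ ≤ 4 * Real.pi ^ 2 * v ^ 2 := by
    intro v hv
    have hd : ∀ x ∈ Icc 0 v, HasDerivWithinAt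
        (fun x : ℝ => phase x - 1 - 2 * Real.pi * Complex.I * x)
        (2 * Real.pi * Complex.I * (phase x - 1)) (Icc 0 v) x := by
      intro x _
      have h1 : HasDerivAt (fun u : ℝ => 2 * Real.pi * Complex.I * (u : ℂ))
          (2 * Real.pi * Complex.I * 1) x :=
        (Complex.ofRealCLM.hasDerivAt (x := x)).const_mul _
      have := ((hasDerivAt_phase x).sub_const 1).sub h1
      rw [mul_sub]
      exact this.hasDerivWithinAt
    have hb : ∀ x ∈ Ico 0 v, ‖2 * Real.pi * Complex.I * (phase x - 1)‖ ≤ 4 * Real.pi ^ 2 * v := by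
      intro x hx
      have h2 := norm_phase_sub_one_le x
      rw [abs_of_nonneg hx.1] at h2
      rw [norm_mul]
      have h3 : ‖(2 * Real.pi * Complex.I : ℂ)‖ = 2 * Real.pi := by
        simp [abs_of_pos Real.pi_pos]
      rw [h3]
      have := Real.pi_pos
      calc 2 * Real.pi * ‖phase x - 1‖ ≤ 2 * Real.pi * (2 * Real.pi * v) := by
            gcongr; exact h2.trans (by gcongr; exact hx.2.le)
        _ = _ := by ring
    have := norm_image_sub_le_of_norm_deriv_le_segment' hd hb v ⟨hv, le_rfl⟩
    simp only [phase_zero, sub_self, Complex.ofReal_zero, mul_zero, sub_zero] at this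
    refine this.trans (le_of_eq (by ring))
  rcases le_total 0 u with h | h
  · exact key u h
  · have := key (-u) (by linarith)
    rw [phase_neg] at this
    rw [← Complex.norm_conj]
    simpa [Complex.conj_ofNat] using this

variable {V : Type*} [NormedAddCommGroup V] [InnerProductSpace ℝ V] [FiniteDimensional ℝ V]
  [MeasurableSpace V] [BorelSpace V]

lemma fourierInv_eq_phase (f : V → ℂ) (x : V) : 𝓕⁻ f x = ∫ ξ, phase ⟪ξ, x⟫ * f ξ := by
  rw [Real.fourierInv_eq']
  simp only [phase_eq, smul_eq_mul]

lemma fourier_eq_phase (f : V → ℂ) (x : V) : 𝓕 f x = ∫ ξ, phase (-⟪ξ, x⟫) * f ξ := by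
  rw [Real.fourier_eq']
  simp only [phase_eq, smul_eq_mul]
  congr! 5
  push_cast; ring

lemma fourierInv_phase_mul (m : V → ℂ) (x y : V) :
    𝓕⁻ (fun ξ => phase ⟪ξ, y⟫ * m ξ) x = 𝓕⁻ m (x + y) := by
  simp only [fourierInv_eq_phase, inner_add_right, phase_add, mul_assoc]

lemma integrable_phase_mul {m : V → ℂ} (hm : Integrable m) (x : V) :
    Integrable (fun ξ => phase ⟪ξ, x⟫ * m ξ) := by
  refine hm.bdd_mul (c := 1) ?_ (ae_of_all _ fun ξ => by simp)
  exact (by fun_prop : Continuous fun ξ : V => phase ⟪ξ, x⟫).aestronglyMeasurable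

lemma continuous_fourierInv {m : V → ℂ} (hm : Integrable m) : Continuous (𝓕⁻ m) := by
  have h : (𝓕⁻ m) = fun x => ∫ ξ, phase ⟪ξ, x⟫ * m ξ := by
    ext x; exact fourierInv_eq_phase m x
  rw [h]
  refine continuous_of_dominated (bound := fun ξ => ‖m ξ‖)
    (fun x => (integrable_phase_mul hm x).aestronglyMeasurable)
    (fun x => ae_of_all _ fun ξ => by simp) hm.norm (ae_of_all _ fun ξ => by fun_prop)

/-! ### Weighted `L¹` norms of inverse Fourier transforms -/

/-- A weight: a measurable, even, submultiplicative function with values in `[1, ∞]`. -/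
structure IsWeight (W : V → ℝ≥0∞) : Prop where
  measurable : Measurable W
  one_le : ∀ x, 1 ≤ W x
  neg : ∀ x, W (-x) = W x
  add_le : ∀ x y, W (x + y) ≤ W x * W y

/-- The weighted norm `∫ W(x) |𝓕⁻ m(x)| dx`. -/
def wnorm (W : V → ℝ≥0∞) (m : V → ℂ) : ℝ≥0∞ := ∫⁻ x, W x * ‖𝓕⁻ m x‖ₑ

variable {W : V → ℝ≥0∞}

lemma measurable_wnorm_integrand (hW : Measurable W) {m : V → ℂ} (hm : Integrable m) :
    Measurable fun x => W x * ‖𝓕⁻ m x‖ₑ :=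
  hW.mul (continuous_fourierInv hm).measurable.enorm

lemma wnorm_mono {W' : V → ℝ≥0∞} (h : ∀ x, W x ≤ W' x) (m : V → ℂ) :
    wnorm W m ≤ wnorm W' m :=
  lintegral_mono fun x => mul_le_mul_left (h x) _

lemma wnorm_const_mul_weight_le {W' : V → ℝ≥0∞} (hW' : Measurable W') {c : ℝ≥0∞}
    (h : ∀ x, W x ≤ c * W' x) {m : V → ℂ} (hm : Integrable m) :
    wnorm W m ≤ c * wnorm W' m := by
  rw [wnorm, wnorm, ← lintegral_const_mul]
  · exact lintegral_mono fun x => by rw [← mul_assoc]; exact mul_le_mul_left (h x) _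
  · exact measurable_wnorm_integrand hW' hm

lemma wnorm_const_mul (m : V → ℂ) (hm : Integrable m) (hW : Measurable W) (c : ℂ) :
    wnorm W (fun ξ => c * m ξ) = ‖c‖ₑ * wnorm W m := by
  rw [wnorm, wnorm, ← lintegral_const_mul _
    (measurable_wnorm_integrand hW hm)]
  refine lintegral_congr fun x => ?_
  have : 𝓕⁻ (fun ξ => c * m ξ) x = c * 𝓕⁻ m x := by
    rw [fourierInv_eq_phase, fourierInv_eq_phase, ← integral_const_mul]
    congr 1; ext ξ; ring
  rw [this, enorm_mul]; ring

lemma wnorm_add_le {m₁ m₂ : V → ℂ} (h₁ : Integrable m₁) (h₂ : Integrable m₂)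
    (hW : Measurable W) :
    wnorm W (fun ξ => m₁ ξ + m₂ ξ) ≤ wnorm W m₁ + wnorm W m₂ := by
  rw [wnorm, wnorm, wnorm, ← lintegral_add_left
    (measurable_wnorm_integrand hW h₁)]
  refine lintegral_mono fun x => ?_
  have : 𝓕⁻ (fun ξ => m₁ ξ + m₂ ξ) x = 𝓕⁻ m₁ x + 𝓕⁻ m₂ x := by
    simp only [fourierInv_eq_phase]
    rw [← integral_add (integrable_phase_mul h₁ x) (integrable_phase_mul h₂ x)]
    congr 1; ext ξ; ring
  rw [this, ← mul_add]
  gcongr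
  exact enorm_add_le _ _

lemma wnorm_comp_neg (hW : IsWeight W) (m : V → ℂ) :
    wnorm W (fun ξ => m (-ξ)) = wnorm W m := by
  rw [wnorm, wnorm, ← lintegral_neg_eq_self]
  refine lintegral_congr fun x => ?_
  rw [hW.neg]
  congr 2
  rw [fourierInv_eq_phase, fourierInv_eq_phase, ← integral_neg_eq_self]
  simp

/-- A character translates the inverse transform by y. Since x = -y + (x + y), evenness and
submultiplicativity of the weight pay W y for the shift. -/
lemma wnorm_phase_mul_le (hW : IsWeight W) {m : V → ℂ} (hm : Integrable m) (y : V) :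
    wnorm W (fun ξ => phase ⟪ξ, y⟫ * m ξ) ≤ W y * wnorm W m := by
  simp only [wnorm, fourierInv_phase_mul]
  rw [← lintegral_const_mul _ (measurable_wnorm_integrand hW.measurable hm),
    ← lintegral_add_right_eq_self (fun x => W y * (W x * ‖𝓕⁻ m x‖ₑ)) y]
  refine lintegral_mono fun x => ?_
  rw [← mul_assoc]
  refine mul_le_mul_left ?_ _
  calc W x = W (-y + (x + y)) := by congr 1; abel
    _ ≤ W y * W (x + y) := (hW.add_le _ _).trans_eq (by rw [hW.neg])

/-- The weighted norm of an average of multipliers. -/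
lemma wnorm_integral_le {α : Type*} [MeasurableSpace α] {ρ : Measure α} [SFinite ρ]
    (hW : Measurable W) {m : α → V → ℂ} (hmeas : StronglyMeasurable (Function.uncurry m))
    (hm : Integrable (Function.uncurry m) (ρ.prod volume)) :
    wnorm W (fun ξ => ∫ r, m r ξ ∂ρ) ≤ ∫⁻ r, wnorm W (m r) ∂ρ := by
  have hjoint : ∀ x : V, Integrable (Function.uncurry fun r ξ => phase ⟪ξ, x⟫ * m r ξ)
      (ρ.prod volume) := by
    intro x
    refine hm.bdd_mul (c := 1) ?_ (ae_of_all _ fun p => by simp)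
    exact (by fun_prop : Continuous fun ξ : V => phase ⟪ξ, x⟫).stronglyMeasurable.comp_measurable
      measurable_snd |>.aestronglyMeasurable
  have hF : ∀ x, 𝓕⁻ (fun ξ => ∫ r, m r ξ ∂ρ) x = ∫ r, 𝓕⁻ (m r) x ∂ρ := by
    intro x
    simp only [fourierInv_eq_phase]
    rw [integral_integral_swap (hjoint x)]
    congr 1; ext ξ
    rw [integral_const_mul]
  have hsm : StronglyMeasurable (fun p : V × α => 𝓕⁻ (m p.2) p.1) := by
    simp only [fourierInv_eq_phase]
    refine StronglyMeasurable.integral_prod_right (f := fun (p : V × α) (ξ : V) =>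
      phase ⟪ξ, p.1⟫ * m p.2 ξ) ?_
    refine StronglyMeasurable.mul ?_ ?_
    · have : Continuous (fun q : V × V => phase ⟪q.2, q.1⟫) := by fun_prop
      exact this.stronglyMeasurable.comp_measurable
        (measurable_fst.fst.prodMk measurable_snd : Measurable fun q : (V × α) × V => (q.1.1, q.2))
    · exact hmeas.comp_measurable
        (measurable_fst.snd.prodMk measurable_snd : Measurable fun q : (V × α) × V => (q.1.2, q.2))
  have hms : Measurable (Function.uncurry fun (x : V) (r : α) => W x * ‖𝓕⁻ (m r) x‖ₑ) :=
    (hW.comp measurable_fst).mul hsm.measurable.enorm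
  calc wnorm W (fun ξ => ∫ r, m r ξ ∂ρ)
      ≤ ∫⁻ x, ∫⁻ r, W x * ‖𝓕⁻ (m r) x‖ₑ ∂ρ := by
        refine lintegral_mono fun x => ?_
        rw [hF, lintegral_const_mul]
        · exact mul_le_mul_right (enorm_integral_le_lintegral_enorm _) _
        · exact (hsm.measurable.comp (measurable_const.prodMk measurable_id)).enorm
    _ = ∫⁻ r, wnorm W (m r) ∂ρ := lintegral_lintegral_swap hms.aemeasurable

/-- Multiplication by the characteristic function of a finite measure. -/
lemma wnorm_mul_charFun_le (hW : IsWeight W) {ρ : Measure V} [IsFiniteMeasure ρ] {m : V → ℂ}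
    (hc : Continuous m) (hm : Integrable m) :
    wnorm W (fun ξ => m ξ * ∫ y, phase ⟪ξ, y⟫ ∂ρ) ≤ (∫⁻ y, W y ∂ρ) * wnorm W m := by
  have h1 : StronglyMeasurable (Function.uncurry fun (y ξ : V) => phase ⟪ξ, y⟫ * m ξ) := by
    refine Continuous.stronglyMeasurable ?_
    unfold Function.uncurry
    fun_prop
  have h2 : Integrable (Function.uncurry fun (y ξ : V) => phase ⟪ξ, y⟫ * m ξ)
      (ρ.prod volume) := by
    refine Integrable.bdd_mul (c := 1) (hm.comp_snd ρ) ?_ (ae_of_all _ fun p => by simp)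
    exact (by fun_prop : Continuous fun p : V × V => phase ⟪p.2, p.1⟫).aestronglyMeasurable
  have h3 := wnorm_integral_le hW.measurable h1 h2
  calc _ = wnorm W (fun ξ => ∫ y, phase ⟪ξ, y⟫ * m ξ ∂ρ) := by
        congr 1; ext ξ; rw [integral_mul_const, mul_comm]
    _ ≤ _ := h3
    _ ≤ ∫⁻ y, W y * wnorm W m ∂ρ := lintegral_mono fun y => wnorm_phase_mul_le hW hm y
    _ = _ := lintegral_mul_const _ hW.measurable

/-- Submultiplicativity of the weighted norm. -/
lemma wnorm_mul_le (hW : IsWeight W) {m₁ m₂ : V → ℂ} (h₁ : Integrable m₁) (hc₁ : Continuous m₁)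
    (h₂ : Integrable m₂) (hc₂ : Continuous m₂) (hfin : wnorm W m₂ ≠ ∞) :
    wnorm W (fun ξ => m₁ ξ * m₂ ξ) ≤ wnorm W m₁ * wnorm W m₂ := by
  set f := 𝓕⁻ m₂ with hf
  have hfc : Continuous f := continuous_fourierInv h₂
  have hfi : Integrable f := by
    refine ⟨hfc.aestronglyMeasurable, ?_⟩
    refine lt_of_le_of_lt (lintegral_mono fun x => ?_) (lt_top_iff_ne_top.2 hfin)
    exact le_mul_of_one_le_left' (hW.one_le x)
  -- As W ≥ 1, the finite norm makes f integrable, and Fourier inversion presents m₂ as a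
  -- superposition of characters. The product is then an average of modulations of m₁, to which
  -- `wnorm_integral_le` applies.
  have hinv : ∀ ξ, m₂ ξ = ∫ y, phase (-⟪y, ξ⟫) * f y := by
    intro ξ
    rw [← fourier_eq_phase, hf, hc₂.fourier_fourierInv_eq h₂]
    have : 𝓕 m₂ = fun x => f (-x) := by
      ext x; rw [hf, Real.fourierInv_eq_fourier_neg, neg_neg]
    rw [this]; exact hfi.comp_neg
  have hcont : Continuous (Function.uncurry fun (y ξ : V) => phase ⟪ξ, -y⟫ * (f y * m₁ ξ)) := by
    unfold Function.uncurry
    fun_prop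
  have hint : Integrable (Function.uncurry fun (y ξ : V) => phase ⟪ξ, -y⟫ * (f y * m₁ ξ))
      ((volume : Measure V).prod volume) := by
    refine Integrable.bdd_mul (c := 1) (hfi.mul_prod h₁) ?_ (ae_of_all _ fun p => by simp)
    exact (by fun_prop : Continuous fun p : V × V => phase ⟪p.2, -p.1⟫).aestronglyMeasurable
  calc wnorm W (fun ξ => m₁ ξ * m₂ ξ)
      = wnorm W (fun ξ => ∫ y, phase ⟪ξ, -y⟫ * (f y * m₁ ξ)) := by
        congr 1; ext ξ
        rw [hinv, ← integral_const_mul]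
        congr 1; ext y
        rw [inner_neg_right, real_inner_comm]; ring
    _ ≤ ∫⁻ y, wnorm W (fun ξ => phase ⟪ξ, -y⟫ * (f y * m₁ ξ)) :=
        wnorm_integral_le hW.measurable hcont.stronglyMeasurable hint
    _ ≤ ∫⁻ y, (W y * ‖f y‖ₑ) * wnorm W m₁ := by
        refine lintegral_mono fun y => ?_
        refine (wnorm_phase_mul_le hW (h₁.const_mul _) (-y)).trans_eq ?_
        rw [wnorm_const_mul _ h₁ hW.measurable, hW.neg]; ring
    _ = _ := by
        rw [lintegral_mul_const _ (measurable_wnorm_integrand hW.measurable h₂), mul_comm, wnorm, wnorm]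

/-- Multiplication by the compound Poisson exponential `exp(ρ̂ - 1)`. -/
lemma wnorm_mul_exp_charFun_le (hW : IsWeight W) {ρ : Measure V} [IsProbabilityMeasure ρ]
    {m : V → ℂ} (hc : Continuous m) (hm : Integrable m) {B : ℝ} (hB0 : 0 ≤ B)
    (hB : ∫⁻ y, W y ∂ρ ≤ ENNReal.ofReal B) :
    wnorm W (fun ξ => m ξ * Complex.exp ((∫ y, phase ⟪ξ, y⟫ ∂ρ) - 1)) ≤
      ENNReal.ofReal (Real.exp B) * wnorm W m := by
  set g : V → ℂ := fun ξ => ∫ y, phase ⟪ξ, y⟫ ∂ρ with hg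
  have hgc : Continuous g :=
    continuous_of_dominated (bound := fun _ => 1)
      (fun x => (by fun_prop : Continuous fun y : V => phase ⟪x, y⟫).aestronglyMeasurable)
      (fun x => ae_of_all _ fun ξ => by simp) (integrable_const _)
      (ae_of_all _ fun ξ => by fun_prop)
  have hg1 : ∀ ξ, ‖g ξ‖ ≤ 1 := fun ξ => by
    refine (norm_integral_le_integral_norm _).trans ?_
    simp
  have hci : ∀ n : ℕ, Continuous (fun ξ => m ξ * g ξ ^ n) := fun n => by fun_prop
  have hint : ∀ n : ℕ, Integrable (fun ξ => m ξ * g ξ ^ n) := fun n => by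
    refine hm.mul_bdd (c := 1) (hgc.pow n).aestronglyMeasurable (ae_of_all _ fun ξ => ?_)
    rw [norm_pow]; exact pow_le_one₀ (norm_nonneg _) (hg1 ξ)
  have hpow : ∀ n : ℕ, wnorm W (fun ξ => m ξ * g ξ ^ n) ≤ ENNReal.ofReal (B ^ n) * wnorm W m := by
    intro n
    induction n with
    | zero => simp
    | succ n ih =>
      have := wnorm_mul_charFun_le (ρ := ρ) hW (hci n) (hint n)
      calc wnorm W (fun ξ => m ξ * g ξ ^ (n + 1)) = wnorm W (fun ξ => m ξ * g ξ ^ n * g ξ) := by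
            congr 1; ext ξ; ring
        _ ≤ _ := this
        _ ≤ ENNReal.ofReal B * (ENNReal.ofReal (B ^ n) * wnorm W m) := by gcongr
        _ = _ := by rw [← mul_assoc, ← ENNReal.ofReal_mul hB0, pow_succ, mul_comm B]
  -- The exponential series is treated as an integral for the counting measure on ℕ, so that the
  -- bound for averages of multipliers also serves for it. The factor exp(-1) is later estimated by
  -- 1.
  have hmeas : StronglyMeasurable (Function.uncurry fun (n : ℕ) (ξ : V) =>
      ((n.factorial : ℝ)⁻¹ : ℂ) * (m ξ * g ξ ^ n)) := by
    refine Measurable.stronglyMeasurable (measurable_from_prod_countable_right fun n => ?_)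
    exact (measurable_const (a := ((n.factorial : ℝ)⁻¹ : ℂ))).mul (hci n).measurable
  have hjoint : Integrable (Function.uncurry fun (n : ℕ) (ξ : V) =>
      ((n.factorial : ℝ)⁻¹ : ℂ) * (m ξ * g ξ ^ n)) (Measure.count.prod volume) := by
    have hi : Integrable (fun n : ℕ => (n.factorial : ℝ)⁻¹) Measure.count := by
      rw [integrable_count_iff]
      simpa using (Real.summable_pow_div_factorial 1).abs
    refine (hi.mul_prod hm.norm).mono' hmeas.aestronglyMeasurable (ae_of_all _ fun p => ?_)
    simp only [Function.uncurry, norm_mul, norm_pow, norm_inv]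
    simp only [Complex.ofReal_natCast, RCLike.norm_natCast]
    gcongr
    exact mul_le_of_le_one_right (norm_nonneg _) (pow_le_one₀ (norm_nonneg _) (hg1 _))
  have hexp : ∀ ξ, m ξ * Complex.exp (g ξ - 1) = Complex.exp (-1) *
      ∫ n, ((n.factorial : ℝ)⁻¹ : ℂ) * (m ξ * g ξ ^ n) ∂(Measure.count : Measure ℕ) := by
    intro ξ
    have hs : HasSum (fun n : ℕ => ((n.factorial : ℝ)⁻¹ : ℂ) * (m ξ * g ξ ^ n))
        (m ξ * Complex.exp (g ξ)) := by
      have := (NormedSpace.expSeries_div_hasSum_exp (g ξ)).mul_left (m ξ)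
      rw [← Complex.exp_eq_exp_ℂ] at this
      have he : (fun n : ℕ => ((n.factorial : ℝ)⁻¹ : ℂ) * (m ξ * g ξ ^ n)) =
          fun n => m ξ * (g ξ ^ n / n.factorial) := by
        ext n; rw [div_eq_mul_inv, Complex.ofReal_natCast]; ring
      rw [he]; exact this
    have hsum : Integrable (fun n : ℕ => ((n.factorial : ℝ)⁻¹ : ℂ) * (m ξ * g ξ ^ n))
        Measure.count := by
      rw [integrable_count_iff]; exact hs.summable.norm
    rw [integral_countable hsum]
    simp only [measureReal_def, Measure.count_singleton, ENNReal.toReal_one, one_smul]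
    rw [hs.tsum_eq, sub_eq_add_neg, Complex.exp_add]; ring
  have hI : Integrable (fun ξ => ∫ n, ((n.factorial : ℝ)⁻¹ : ℂ) * (m ξ * g ξ ^ n)
      ∂(Measure.count : Measure ℕ)) := hjoint.integral_prod_right
  calc wnorm W (fun ξ => m ξ * Complex.exp (g ξ - 1))
      = ‖Complex.exp (-1)‖ₑ * wnorm W (fun ξ => ∫ n, ((n.factorial : ℝ)⁻¹ : ℂ) * (m ξ * g ξ ^ n)
          ∂(Measure.count : Measure ℕ)) := by
        rw [← wnorm_const_mul _ hI hW.measurable]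
        congr 1; ext ξ; exact hexp ξ
    _ ≤ 1 * ∫⁻ n, wnorm W (fun ξ => ((n.factorial : ℝ)⁻¹ : ℂ) * (m ξ * g ξ ^ n))
          ∂(Measure.count : Measure ℕ) := by
        refine mul_le_mul' ?_ (wnorm_integral_le hW.measurable hmeas hjoint)
        rw [← ofReal_norm, Complex.norm_exp]
        simp
    _ ≤ ∫⁻ n, ENNReal.ofReal (B ^ n / n.factorial) * wnorm W m ∂(Measure.count : Measure ℕ) := by
        rw [one_mul]
        refine lintegral_mono fun n => ?_
        rw [wnorm_const_mul _ (hint n) hW.measurable]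
        refine (mul_le_mul_right (hpow n) _).trans_eq ?_
        rw [← mul_assoc, ← ofReal_norm, ← ENNReal.ofReal_mul (norm_nonneg _)]
        congr 2
        simp; ring
    _ = _ := by
        rw [lintegral_count, ENNReal.tsum_mul_right, ← ENNReal.ofReal_tsum_of_nonneg
          (fun n => by positivity) (Real.summable_pow_div_factorial B),
          Real.exp_eq_exp_ℝ, NormedSpace.exp_eq_tsum_div]

/-- The Jacobian from dilating the symbol and the Jacobian from the change of variables in x are the
same power of a, so they cancel: the dilation can be moved from the symbol to the weight. -/
lemma wnorm_comp_smul (m : V → ℂ) {a : ℝ} (ha : 0 < a) :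
    wnorm W (fun ξ => m (a • ξ)) = wnorm (fun x => W (a • x)) m := by
  have h1 : ∀ x, 𝓕⁻ (fun ξ => m (a • ξ)) (a • x) =
      ((a ^ Module.finrank ℝ V)⁻¹ : ℝ) * 𝓕⁻ m x := by
    intro x
    simp only [fourierInv_eq_phase]
    have := Measure.integral_comp_smul (volume : Measure V) (fun ξ => phase ⟪ξ, x⟫ * m ξ) a
    rw [abs_of_pos (by positivity)] at this
    rw [← Complex.real_smul, ← this]
    congr 1; ext ξ
    rw [real_inner_smul_left, real_inner_smul_right]
  have hd : (0 : ℝ) < a ^ Module.finrank ℝ V := by positivity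
  have h2 : ∫⁻ x, (W (a • x) * ‖𝓕⁻ (fun ξ => m (a • ξ)) (a • x)‖ₑ) =
      ENNReal.ofReal (a ^ Module.finrank ℝ V)⁻¹ * wnorm W (fun ξ => m (a • ξ)) := by
    have h3 := (Homeomorph.smulOfNeZero a ha.ne').measurableEmbedding.lintegral_map
      (μ := (volume : Measure V)) (fun x => W x * ‖𝓕⁻ (fun ξ => m (a • ξ)) x‖ₑ)
    simp only [Homeomorph.smulOfNeZero_apply] at h3
    rw [← h3, Measure.map_addHaar_smul _ ha.ne', lintegral_smul_measure, abs_of_pos (inv_pos.2 hd),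
      smul_eq_mul, wnorm]
  have h4 : ∫⁻ x, (W (a • x) * ‖𝓕⁻ (fun ξ => m (a • ξ)) (a • x)‖ₑ) =
      ENNReal.ofReal (a ^ Module.finrank ℝ V)⁻¹ * wnorm (fun x => W (a • x)) m := by
    rw [wnorm, ← lintegral_const_mul' _ _ ENNReal.ofReal_ne_top]
    refine lintegral_congr fun x => ?_
    rw [h1, enorm_mul, ← ofReal_norm, Complex.norm_real, Real.norm_eq_abs,
      abs_of_pos (inv_pos.2 hd)]
    ring
  rw [h2] at h4
  exact (ENNReal.mul_right_inj (by simpa using hd) ENNReal.ofReal_ne_top).1 h4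

end LevyKernel

end

noncomputable section

namespace LevyKernel

variable {V : Type*} [NormedAddCommGroup V] [InnerProductSpace ℝ V] [FiniteDimensional ℝ V]
  [MeasurableSpace V] [BorelSpace V]

/-! ### The symbol of the small jumps -/

/-- The compensated symbol `∫ (exp(2πiξ·y) - 1 - 2πiξ·y) μ(dy)`. -/
def smallSymbol (μ : Measure V) (ξ : V) : ℂ :=
  ∫ y, (phase ⟪ξ, y⟫ - 1 - 2 * Real.pi * Complex.I * (⟪ξ, y⟫ : ℝ)) ∂μ

/-- The linear form `ξ ↦ ⟪y, ξ⟫` with complex values. -/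
def innerC (y : V) : V →L[ℝ] ℂ := Complex.ofRealCLM ∘L innerSL ℝ y

lemma innerC_apply (y ξ : V) : innerC y ξ = (⟪y, ξ⟫ : ℝ) := rfl

lemma norm_innerC_le (y : V) : ‖innerC y‖ ≤ ‖y‖ := by
  refine ContinuousLinearMap.opNorm_le_bound _ (norm_nonneg _) fun ξ => ?_
  rw [innerC_apply, Complex.norm_real]
  exact norm_inner_le_norm y ξ

lemma continuous_innerC : Continuous (innerC : V → V →L[ℝ] ℂ) := by
  unfold innerC
  exact continuous_const.clm_comp (innerSL ℝ (E := V)).continuous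

lemma norm_two_pi_I : ‖(2 * Real.pi * Complex.I : ℂ)‖ = 2 * Real.pi := by
  simp [abs_of_pos Real.pi_pos]

lemma abs_inner_le (ξ y : V) : |(⟪ξ, y⟫ : ℝ)| ≤ ‖ξ‖ * ‖y‖ := abs_real_inner_le_norm ξ y

lemma norm_compensated_le (ξ y : V) :
    ‖phase ⟪ξ, y⟫ - 1 - 2 * Real.pi * Complex.I * (⟪ξ, y⟫ : ℝ)‖ ≤
      4 * Real.pi ^ 2 * ‖ξ‖ ^ 2 * ‖y‖ ^ 2 := by
  refine (norm_phase_sub_one_sub_le _).trans ?_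
  have h := pow_le_pow_left₀ (abs_nonneg _) (abs_inner_le ξ y) 2
  rw [sq_abs, mul_pow] at h
  nlinarith [sq_nonneg Real.pi]

lemma hasFDerivAt_phase_inner (y ξ : V) :
    HasFDerivAt (fun ξ : V => phase ⟪ξ, y⟫)
      ((2 * Real.pi * Complex.I * phase ⟪ξ, y⟫) • innerC y) ξ := by
  have h1 : HasFDerivAt (fun ξ : V => (⟪ξ, y⟫ : ℝ)) (innerSL ℝ y) ξ := by
    simp_rw [real_inner_comm y]
    exact (innerSL ℝ y).hasFDerivAt
  refine ((hasDerivAt_phase ⟪ξ, y⟫).hasFDerivAt.comp ξ h1).congr_fderiv ?_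
  ext z; simp [innerC_apply, mul_comm]

variable {μ : Measure V} {A : ℝ}

/-- Compensation makes the differentiated integrand of size ‖ξ‖‖y‖², so the second moment alone
dominates it and μ may be infinite. -/
lemma hasFDerivAt_smallSymbol (h2 : Integrable (fun y => ‖y‖ ^ 2) μ) (ξ : V) :
    HasFDerivAt (smallSymbol μ)
      (∫ y, (2 * Real.pi * Complex.I * (phase ⟪ξ, y⟫ - 1)) • innerC y ∂μ) ξ := by
  refine hasFDerivAt_integral_of_dominated_of_fderiv_le
    (F := fun ξ y => phase ⟪ξ, y⟫ - 1 - 2 * Real.pi * Complex.I * (⟪ξ, y⟫ : ℝ))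
    (F' := fun ξ y => (2 * Real.pi * Complex.I * (phase ⟪ξ, y⟫ - 1)) • innerC y)
    (bound := fun y => 4 * Real.pi ^ 2 * (‖ξ‖ + 1) * ‖y‖ ^ 2) (Metric.ball_mem_nhds ξ one_pos)
    ?_ ?_ ?_ ?_ ?_ ?_
  · refine Eventually.of_forall fun x => Continuous.aestronglyMeasurable ?_
    fun_prop
  · refine (h2.const_mul (4 * Real.pi ^ 2 * ‖ξ‖ ^ 2)).mono'
      (Continuous.aestronglyMeasurable (by fun_prop)) (ae_of_all _ fun y => ?_)
    exact norm_compensated_le ξ y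
  · refine Continuous.aestronglyMeasurable ?_
    have := continuous_innerC (V := V)
    fun_prop
  · refine ae_of_all _ fun y x hx => ?_
    rw [norm_smul, norm_mul, norm_two_pi_I]
    have h1 : ‖x‖ ≤ ‖ξ‖ + 1 := by
      have := norm_le_norm_add_norm_sub' x ξ
      rw [Metric.mem_ball, dist_eq_norm] at hx
      linarith
    have hpi := Real.pi_pos
    calc 2 * Real.pi * ‖phase ⟪x, y⟫ - 1‖ * ‖innerC y‖
        ≤ 2 * Real.pi * (2 * Real.pi * ((‖ξ‖ + 1) * ‖y‖)) * ‖y‖ := by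
          gcongr
          · refine (norm_phase_sub_one_le _).trans ?_
            gcongr
            exact (abs_inner_le _ _).trans (by gcongr)
          · exact norm_innerC_le y
      _ = _ := by ring
  · exact h2.const_mul _
  · refine ae_of_all _ fun y x _ => ?_
    have h1 : HasFDerivAt (fun ξ : V => 2 * Real.pi * Complex.I * ((⟪ξ, y⟫ : ℝ) : ℂ))
        ((2 * Real.pi * Complex.I) • innerC y) x := by
      simp_rw [real_inner_comm y]
      exact ((innerC y).hasFDerivAt (x := x)).const_smul (2 * Real.pi * Complex.I)
    refine (((hasFDerivAt_phase_inner y x).sub_const 1).sub h1).congr_fderiv ?_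
    rw [← sub_smul]; congr 1; ring

/-- The bilinear form `(ξ, η) ↦ -4π² ⟪y, ξ⟫ ⟪y, η⟫`. -/
def innerC₂ (y : V) : V →L[ℝ] V →L[ℝ] ℂ :=
  (innerSL ℝ y).smulRight ((-(4 * Real.pi ^ 2) : ℝ) • innerC y)

lemma norm_innerC₂_le (y : V) : ‖innerC₂ y‖ ≤ 4 * Real.pi ^ 2 * ‖y‖ ^ 2 := by
  rw [innerC₂, ContinuousLinearMap.norm_smulRight_apply, norm_smul, norm_neg,
    Real.norm_of_nonneg (by positivity), innerSL_apply_norm]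
  have := norm_innerC_le y
  calc _ ≤ ‖y‖ * (4 * Real.pi ^ 2 * ‖y‖) := by gcongr
    _ = _ := by ring

lemma continuous_innerC₂ : Continuous (innerC₂ : V → V →L[ℝ] V →L[ℝ] ℂ) := by
  have h : Continuous fun y : V => ContinuousLinearMap.smulRightL ℝ V (V →L[ℝ] ℂ)
      (innerSL ℝ y) ((-(4 * Real.pi ^ 2) : ℝ) • innerC y) :=
    ((ContinuousLinearMap.continuous _).comp (innerSL ℝ (E := V)).continuous).clm_apply
      (by have := continuous_innerC (V := V); fun_prop)
  exact h

lemma hasFDerivAt_fderiv_smallSymbol (h2 : Integrable (fun y => ‖y‖ ^ 2) μ) (ξ : V) :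
    HasFDerivAt (fun ξ => ∫ y, (2 * Real.pi * Complex.I * (phase ⟪ξ, y⟫ - 1)) • innerC y ∂μ)
      (∫ y, phase ⟪ξ, y⟫ • innerC₂ y ∂μ) ξ := by
  refine hasFDerivAt_integral_of_dominated_of_fderiv_le
    (F := fun ξ y => (2 * Real.pi * Complex.I * (phase ⟪ξ, y⟫ - 1)) • innerC y)
    (F' := fun ξ y => phase ⟪ξ, y⟫ • innerC₂ y)
    (bound := fun y => 4 * Real.pi ^ 2 * ‖y‖ ^ 2) univ_mem ?_ ?_ ?_ ?_ ?_ ?_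
  · have := continuous_innerC (V := V)
    exact Eventually.of_forall fun x => Continuous.aestronglyMeasurable (by fun_prop)
  · have := continuous_innerC (V := V)
    refine (h2.const_mul (4 * Real.pi ^ 2 * ‖ξ‖)).mono'
      (Continuous.aestronglyMeasurable (by fun_prop)) (ae_of_all _ fun y => ?_)
    rw [norm_smul, norm_mul, norm_two_pi_I]
    have hpi := Real.pi_pos
    calc 2 * Real.pi * ‖phase ⟪ξ, y⟫ - 1‖ * ‖innerC y‖
        ≤ 2 * Real.pi * (2 * Real.pi * (‖ξ‖ * ‖y‖)) * ‖y‖ := by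
          gcongr
          · refine (norm_phase_sub_one_le _).trans ?_
            gcongr
            exact abs_inner_le _ _
          · exact norm_innerC_le y
      _ = _ := by ring
  · have := continuous_innerC₂ (V := V)
    exact Continuous.aestronglyMeasurable (by fun_prop)
  · refine ae_of_all _ fun y x _ => ?_
    rw [norm_smul, norm_phase, one_mul]
    exact norm_innerC₂_le y
  · exact h2.const_mul _
  · refine ae_of_all _ fun y x _ => ?_
    refine ((((hasFDerivAt_phase_inner y x).sub_const 1).const_smul
      (2 * Real.pi * Complex.I)).smul_const (innerC y)).congr_fderiv ?_
    ext z z'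
    have hI : Complex.I ^ 2 = -1 := Complex.I_sq
    simp only [innerC₂, innerC_apply, smul_apply,
      ContinuousLinearMap.smulRight_apply, innerSL_apply_apply, smul_eq_mul, Complex.real_smul]
    push_cast
    linear_combination (4 * Real.pi ^ 2 * phase ⟪x, y⟫ * (⟪y, z⟫ : ℝ) * (⟪y, z'⟫ : ℝ) : ℂ) * hI

/-- After two derivatives the compensator is gone, and the Hessian is a genuine Fourier integral of
a function of size ‖y‖². All higher derivatives then come from the general theory. The bilinear form
carries a minus sign because `VectorFourier` integrates the inverse character. -/
lemma fourierIntegral_innerC₂ (ξ : V) :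
    ∫ y, phase ⟪ξ, y⟫ • innerC₂ y ∂μ =
      VectorFourier.fourierIntegral 𝐞 μ (-innerSL ℝ (E := V)).toLinearMap₁₂
        innerC₂ ξ := by
  rw [VectorFourier.fourierIntegral]
  congr 1; ext1 y
  rw [Circle.smul_def, Real.fourierChar_apply, phase_eq]
  congr 3
  simp [real_inner_comm]

/-- Each derivative brings down a factor 2πy, and ‖y‖ ≤ 1 on the support. The factor ‖y‖² contained
in f is never spent, so the second moment bounds every order. -/
lemma norm_iteratedFDeriv_fourierIntegral_le {F : Type*} [NormedAddCommGroup F]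
    [NormedSpace ℂ F] {f : V → F} (hf : AEStronglyMeasurable f μ) {K : ℝ} (hK : 0 ≤ K)
    (hfK : ∀ y, ‖f y‖ ≤ K * ‖y‖ ^ 2) (h2 : Integrable (fun y => ‖y‖ ^ 2) μ)
    (hA : ∫ y, ‖y‖ ^ 2 ∂μ ≤ A) (hs : ∀ᵐ y ∂μ, ‖y‖ ≤ 1) :
    ContDiff ℝ (⊤ : ℕ∞)
      (VectorFourier.fourierIntegral 𝐞 μ (-innerSL ℝ (E := V)).toLinearMap₁₂ f) ∧
    ∀ (n : ℕ) (ξ : V), ‖iteratedFDeriv ℝ n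
      (VectorFourier.fourierIntegral 𝐞 μ (-innerSL ℝ (E := V)).toLinearMap₁₂ f) ξ‖ ≤
        (2 * Real.pi) ^ n * K * A := by
  have hint : ∀ n : ℕ, Integrable (fun v : V ↦ ‖v‖ ^ n * ‖f v‖) μ := fun n => by
    refine (h2.const_mul K).mono' ?_ ?_
    · exact (continuous_norm.pow n).aestronglyMeasurable.mul hf.norm
    filter_upwards [hs] with y hy
    rw [Real.norm_eq_abs, abs_of_nonneg (by positivity)]
    calc _ ≤ 1 * ‖f y‖ := by gcongr; exact pow_le_one₀ (norm_nonneg _) hy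
      _ ≤ _ := by rw [one_mul]; exact hfK y
  refine ⟨VectorFourier.contDiff_fourierIntegral _ (fun n _ => hint n), fun n ξ => ?_⟩
  rw [VectorFourier.iteratedFDeriv_fourierIntegral (N := ⊤) _ (fun n _ => hint n) hf le_top]
  refine (VectorFourier.norm_fourierIntegral_le_integral_norm _ _ _ _ _).trans ?_
  have hL : ‖-innerSL ℝ (E := V)‖ ≤ 1 :=
    ContinuousLinearMap.opNorm_le_bound _ zero_le_one fun y => by
      rw [neg_apply, norm_neg, one_mul]
      exact (innerSL_apply_norm ℝ y).le
  have hpi := Real.pi_pos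
  calc ∫ v, ‖VectorFourier.fourierPowSMulRight (-innerSL ℝ (E := V)) f v n‖ ∂μ
      ≤ ∫ v, (2 * Real.pi) ^ n * (K * ‖v‖ ^ 2) ∂μ := by
        refine integral_mono_of_nonneg (ae_of_all _ fun _ => norm_nonneg _)
          ((h2.const_mul _).const_mul _) ?_
        filter_upwards [hs] with y hy
        refine (VectorFourier.norm_fourierPowSMulRight_le _ _ _ _).trans ?_
        calc (2 * Real.pi * ‖-innerSL ℝ (E := V)‖) ^ n * ‖y‖ ^ n * ‖f y‖
            ≤ (2 * Real.pi * 1) ^ n * 1 * ‖f y‖ := by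
              gcongr; exact pow_le_one₀ (norm_nonneg _) hy
          _ ≤ _ := by
              rw [mul_one, mul_one]
              gcongr
              exact hfK y
    _ = (2 * Real.pi) ^ n * K * ∫ v, ‖v‖ ^ 2 ∂μ := by
        rw [integral_const_mul, integral_const_mul]; ring
    _ ≤ (2 * Real.pi) ^ n * K * A := by gcongr

/-- Orders 0 and 1 grow quadratically and linearly by Taylor bounds on the integrand, while orders
at least 2 are bounded. The common factor (1 + ‖ξ‖)² covers all cases in one form. -/
lemma norm_iteratedFDeriv_smallSymbol_le (h2 : Integrable (fun y => ‖y‖ ^ 2) μ)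
    (hA : ∫ y, ‖y‖ ^ 2 ∂μ ≤ A) (hs : ∀ᵐ y ∂μ, ‖y‖ ≤ 1) :
    ContDiff ℝ (⊤ : ℕ∞) (smallSymbol μ) ∧ ∀ (n : ℕ) (ξ : V),
      ‖iteratedFDeriv ℝ n (smallSymbol μ) ξ‖ ≤ (2 * Real.pi) ^ (n + 2) * A * (1 + ‖ξ‖) ^ 2 := by
  set D₂ : V → V →L[ℝ] V →L[ℝ] ℂ :=
    VectorFourier.fourierIntegral 𝐞 μ (-innerSL ℝ (E := V)).toLinearMap₁₂ innerC₂ with hD₂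
  have hd1 : ∀ ξ, HasFDerivAt (smallSymbol μ) (fderiv ℝ (smallSymbol μ) ξ) ξ := fun ξ =>
    (hasFDerivAt_smallSymbol h2 ξ).differentiableAt.hasFDerivAt
  have hd1e : fderiv ℝ (smallSymbol μ) = fun ξ =>
      ∫ y, (2 * Real.pi * Complex.I * (phase ⟪ξ, y⟫ - 1)) • innerC y ∂μ :=
    funext fun ξ => (hasFDerivAt_smallSymbol h2 ξ).fderiv
  have hd2 : ∀ ξ, HasFDerivAt (fderiv ℝ (smallSymbol μ)) (D₂ ξ) ξ := fun ξ => by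
    rw [hd1e, hD₂, ← fourierIntegral_innerC₂]
    exact hasFDerivAt_fderiv_smallSymbol h2 ξ
  have hd2e : fderiv ℝ (fderiv ℝ (smallSymbol μ)) = D₂ := funext fun ξ => (hd2 ξ).fderiv
  obtain ⟨hD₂c, hD₂n⟩ := norm_iteratedFDeriv_fourierIntegral_le (A := A)
    (F := V →L[ℝ] V →L[ℝ] ℂ) (f := innerC₂ (V := V)) (μ := μ)
    (continuous_innerC₂ (V := V)).aestronglyMeasurable (K := 4 * Real.pi ^ 2) (by positivity)
    norm_innerC₂_le h2 hA hs
  refine ⟨?_, ?_⟩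
  · rw [contDiff_infty_iff_fderiv]
    refine ⟨fun ξ => (hd1 ξ).differentiableAt, ?_⟩
    rw [contDiff_infty_iff_fderiv]
    exact ⟨fun ξ => (hd2 ξ).differentiableAt, hd2e ▸ hD₂c⟩
  have hpi := Real.pi_pos
  have hA0 : 0 ≤ A := le_trans (integral_nonneg fun y => by positivity) hA
  intro n ξ
  match n with
  | 0 =>
    rw [norm_iteratedFDeriv_zero]
    calc ‖smallSymbol μ ξ‖ ≤ ∫ y, 4 * Real.pi ^ 2 * ‖ξ‖ ^ 2 * ‖y‖ ^ 2 ∂μ := by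
          refine norm_integral_le_of_norm_le (h2.const_mul _) (ae_of_all _ fun y => ?_)
          exact norm_compensated_le ξ y
      _ ≤ 4 * Real.pi ^ 2 * ‖ξ‖ ^ 2 * A := by
          rw [integral_const_mul]; gcongr
      _ ≤ 4 * Real.pi ^ 2 * (1 + ‖ξ‖) ^ 2 * A := by gcongr; linarith
      _ = _ := by ring
  | 1 =>
    rw [← norm_iteratedFDeriv_fderiv, norm_iteratedFDeriv_zero, hd1e]
    calc ‖∫ y, (2 * Real.pi * Complex.I * (phase ⟪ξ, y⟫ - 1)) • innerC y ∂μ‖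
        ≤ ∫ y, 4 * Real.pi ^ 2 * ‖ξ‖ * ‖y‖ ^ 2 ∂μ := by
          refine norm_integral_le_of_norm_le (h2.const_mul _) (ae_of_all _ fun y => ?_)
          rw [norm_smul, norm_mul, norm_two_pi_I]
          calc 2 * Real.pi * ‖phase ⟪ξ, y⟫ - 1‖ * ‖innerC y‖
              ≤ 2 * Real.pi * (2 * Real.pi * (‖ξ‖ * ‖y‖)) * ‖y‖ := by
                gcongr
                · refine (norm_phase_sub_one_le _).trans ?_
                  gcongr
                  exact abs_inner_le _ _
                · exact norm_innerC_le y
            _ = _ := by ring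
      _ ≤ 4 * Real.pi ^ 2 * ‖ξ‖ * A := by
          rw [integral_const_mul]; gcongr
      _ ≤ (2 * Real.pi) * (4 * Real.pi ^ 2 * (1 + ‖ξ‖) ^ 2 * A) := by
          have h1 : 1 ≤ 2 * Real.pi := by linarith [Real.pi_gt_three]
          refine le_trans ?_ (le_mul_of_one_le_left (by positivity) h1)
          gcongr
          nlinarith [norm_nonneg ξ]
      _ = _ := by ring
  | n + 2 =>
    rw [← norm_iteratedFDeriv_fderiv, ← norm_iteratedFDeriv_fderiv, hd2e]
    refine (hD₂n n ξ).trans ?_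
    have h1 : 1 ≤ (2 * Real.pi) ^ 2 := by nlinarith [Real.pi_gt_three]
    have h3 : 1 ≤ (1 + ‖ξ‖) ^ 2 := by nlinarith [norm_nonneg ξ]
    calc (2 * Real.pi) ^ n * (4 * Real.pi ^ 2) * A = (2 * Real.pi) ^ (n + 2) * A * 1 * 1 := by ring
      _ ≤ (2 * Real.pi) ^ (n + 2) * A * (2 * Real.pi) ^ 2 * (1 + ‖ξ‖) ^ 2 := by gcongr
      _ = _ := by ring

/-! ### Smooth multipliers times the exponential of the small-jump symbol -/

lemma norm_iteratedFDeriv_cexp_le (n : ℕ) (z : ℂ) :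
    ‖iteratedFDeriv ℝ n Complex.exp z‖ ≤ Real.exp z.re := by
  induction n with
  | zero => rw [norm_iteratedFDeriv_zero, Complex.norm_exp]
  | succ n ih =>
    have h : fderiv ℝ Complex.exp = (ContinuousLinearMap.mul ℝ ℂ) ∘ Complex.exp := by
      ext1 z
      have := ((Complex.hasDerivAt_exp z).hasFDerivAt.restrictScalars ℝ).fderiv
      rw [this]
      ext w; simp [mul_comm]
    rw [← norm_iteratedFDeriv_fderiv, h]
    have hc : ContDiffAt ℝ n Complex.exp z := (Complex.contDiff_exp (𝕜 := ℝ)).contDiffAt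
    refine ((ContinuousLinearMap.mul ℝ ℂ).norm_iteratedFDeriv_comp_left hc le_rfl).trans ?_
    calc _ ≤ 1 * Real.exp z.re := by
          gcongr; exact ContinuousLinearMap.opNorm_mul_le ℝ ℂ
      _ = _ := one_mul _

/-- Faà di Bruno for exp ∘ φ followed by Leibniz for the product. The condition `1 ≤ D` lets the
bound on a k-th derivative of φ be replaced by its k-th power, which is the form that the
composition estimate takes. -/
lemma contDiff_mul_cexp_bound {φ M : V → ℂ} (hφ : ContDiff ℝ (⊤ : ℕ∞) φ)
    (hM : ContDiff ℝ (⊤ : ℕ∞) M) {n : ℕ} {B D : ℝ} (hD : 1 ≤ D) (hB : 0 ≤ B)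
    (hφD : ∀ j ≤ n, ∀ ξ, ‖iteratedFDeriv ℝ j φ ξ‖ ≤ D * (1 + ‖ξ‖) ^ 2)
    (hMB : ∀ j ≤ n, ∀ ξ, ‖iteratedFDeriv ℝ j M ξ‖ ≤ B * (1 + ‖ξ‖) ^ 2) {j : ℕ} (hj : j ≤ n)
    (ξ : V) :
    ‖iteratedFDeriv ℝ j (fun ξ => M ξ * Complex.exp (φ ξ)) ξ‖ ≤
      B * (2 ^ n * n.factorial * D ^ n) * ((1 + ‖ξ‖) ^ (2 * n + 2) * Real.exp (φ ξ).re) := by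
  have h1 : (1 : ℝ) ≤ (1 + ‖ξ‖) ^ 2 := by nlinarith [norm_nonneg ξ]
  have hD1 : 1 ≤ D * (1 + ‖ξ‖) ^ 2 := one_le_mul_of_one_le_of_one_le hD h1
  have hexp : ∀ i ≤ n, ‖iteratedFDeriv ℝ i (fun ξ => Complex.exp (φ ξ)) ξ‖ ≤
      n.factorial * Real.exp (φ ξ).re * (D * (1 + ‖ξ‖) ^ 2) ^ n := by
    intro i hi
    have := norm_iteratedFDeriv_comp_le (𝕜 := ℝ) (g := Complex.exp) (f := φ) (n := i)
      (N := ((⊤ : ℕ∞) : WithTop ℕ∞)) Complex.contDiff_exp hφ (by exact_mod_cast le_top) ξ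
      (fun k _ => norm_iteratedFDeriv_cexp_le k (φ ξ))
      (fun k hk hki => (hφD k (hki.trans hi) ξ).trans (le_self_pow₀ hD1 (by omega)))
    refine this.trans ?_
    gcongr
  refine (norm_iteratedFDeriv_mul_le hM (Complex.contDiff_exp.comp hφ) ξ
    (by exact_mod_cast le_top)).trans ?_
  calc _ ≤ ∑ i ∈ Finset.range (j + 1), (j.choose i : ℝ) * (B * (1 + ‖ξ‖) ^ 2) *
        (n.factorial * Real.exp (φ ξ).re * (D * (1 + ‖ξ‖) ^ 2) ^ n) := by
        refine Finset.sum_le_sum fun i hi => ?_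
        have hi' : i ≤ j := Nat.lt_succ_iff.1 (Finset.mem_range.1 hi)
        gcongr
        · exact hMB i (hi'.trans hj) ξ
        · exact hexp (j - i) (by omega)
    _ = 2 ^ j * ((B * (1 + ‖ξ‖) ^ 2) *
        (n.factorial * Real.exp (φ ξ).re * (D * (1 + ‖ξ‖) ^ 2) ^ n)) := by
        have := Nat.sum_range_choose j
        simp_rw [mul_assoc]
        rw [← Finset.sum_mul]
        congr 1
        exact_mod_cast this
    _ ≤ 2 ^ n * ((B * (1 + ‖ξ‖) ^ 2) *
        (n.factorial * Real.exp (φ ξ).re * (D * (1 + ‖ξ‖) ^ 2) ^ n)) := by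
        gcongr; norm_num
    _ = _ := by rw [mul_pow, ← pow_mul]; ring

/-- The decay of `exp φ` needed for integrability. -/
def expDecay (n : ℕ) (c p : ℝ) (ξ : V) : ℝ :=
  (1 + ‖ξ‖) ^ n * (Real.exp c * Real.exp (-c * ‖ξ‖ ^ p))

lemma integrable_expDecay (n : ℕ) {c p : ℝ} (hc : 0 < c) (hp : 0 < p) :
    Integrable (expDecay n c p : V → ℝ) := by
  have hcont : Continuous (expDecay n c p : V → ℝ) := by
    unfold expDecay
    have : Continuous fun ξ : V => ‖ξ‖ ^ p := continuous_norm.rpow_const fun _ => Or.inr hp.le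
    fun_prop
  -- The dim + 1 additional powers leave the integrable majorant (1 + ‖ξ‖)^(-(dim + 1)).
  set k : ℕ := n + Module.finrank ℝ V + 1
  have hlim : Tendsto (fun r : ℝ => (1 + r) ^ k * Real.exp (-c * r ^ p)) atTop (𝓝 0) := by
    have h1 : Tendsto (fun r : ℝ => r ^ ((k : ℝ) / p) * Real.exp (-c * r)) atTop (𝓝 0) :=
      tendsto_rpow_mul_exp_neg_mul_atTop_nhds_zero _ _ hc
    have h2 := (h1.comp (tendsto_rpow_atTop hp)).const_mul (2 ^ k)
    rw [mul_zero] at h2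
    refine squeeze_zero' ?_ ?_ h2
    · filter_upwards [eventually_ge_atTop 0] with r hr
      positivity
    · filter_upwards [eventually_ge_atTop 1] with r hr
      simp only [Function.comp]
      rw [← Real.rpow_mul (by linarith), mul_div_cancel₀ _ hp.ne', Real.rpow_natCast, ← mul_assoc,
        ← mul_pow]
      gcongr; linarith
  have hbd : ∃ C, ∀ r : ℝ, 0 ≤ r → (1 + r) ^ k * Real.exp (-c * r ^ p) ≤ C := by
    obtain ⟨R, hR⟩ := eventually_atTop.1 (hlim.eventually_le_const one_pos)
    have hcr : ContinuousOn (fun r : ℝ => (1 + r) ^ k * Real.exp (-c * r ^ p)) (Icc 0 R) := by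
      have : Continuous fun r : ℝ => r ^ p := Real.continuous_rpow_const hp.le
      fun_prop
    obtain ⟨C, hC⟩ := isCompact_Icc.exists_bound_of_continuousOn hcr
    refine ⟨max C 1, fun r hr => ?_⟩
    rcases le_total r R with h | h
    · exact ((le_abs_self _).trans (hC r ⟨hr, h⟩)).trans (le_max_left _ _)
    · exact (hR r h).trans (le_max_right _ _)
  obtain ⟨C, hC⟩ := hbd
  refine ((integrable_one_add_norm (E := V) (r := Module.finrank ℝ V + 1)
    (by linarith)).const_mul (Real.exp c * C)).mono' hcont.aestronglyMeasurable
    (ae_of_all _ fun ξ => ?_)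
  have h0 : 0 < 1 + ‖ξ‖ := by positivity
  have := hC ‖ξ‖ (norm_nonneg _)
  rw [Real.norm_of_nonneg (by unfold expDecay; positivity), expDecay, Real.rpow_neg h0.le,
    ← div_eq_mul_inv, le_div_iff₀ (by positivity)]
  have e1 : (1 + ‖ξ‖) ^ ((Module.finrank ℝ V : ℝ) + 1) = (1 + ‖ξ‖) ^ (Module.finrank ℝ V + 1) := by
    rw [← Real.rpow_natCast]; push_cast; rfl
  rw [e1]
  calc _ = Real.exp c * ((1 + ‖ξ‖) ^ k * Real.exp (-c * ‖ξ‖ ^ p)) := by ring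
    _ ≤ _ := by gcongr

/-- Weighted `L¹` bound for a smooth multiplier with integrable derivatives. -/
lemma wnorm_le_of_iteratedFDeriv {f : V → ℂ} (hf : ContDiff ℝ (⊤ : ℕ∞) f) {H : V → ℝ}
    (hH : Integrable H) {C : ℝ}
    (hfH : ∀ j ≤ Module.finrank ℝ V + 2, ∀ ξ, ‖iteratedFDeriv ℝ j f ξ‖ ≤ C * H ξ)
    {W : V → ℝ≥0∞} (hW : ∀ x, W x ≤ ENNReal.ofReal (1 + ‖x‖)) :
    wnorm W f ≤ ENNReal.ofReal (C * ((2 ^ (Module.finrank ℝ V + 2) * (1 + 2 ^ (Module.finrank ℝ V + 2)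
      * (Module.finrank ℝ V + 3)) * ∫ ξ, H ξ) *
        ∫ x : V, (1 + ‖x‖) ^ (-((Module.finrank ℝ V : ℝ) + 1)))) := by
  -- Of these dim + 2 powers of decay of the inverse transform, one pays for the weight and dim + 1
  -- leave an integrable function.
  set n := Module.finrank ℝ V + 2 with hn
  have hint : ∀ j ≤ n, Integrable (fun v => ‖iteratedFDeriv ℝ j f v‖) := fun j hj =>
    (hH.const_mul C).mono' (hf.continuous_iteratedFDeriv (m := j)
      (by exact_mod_cast le_top)).norm.aestronglyMeasurable
      (ae_of_all _ fun ξ => by rw [norm_norm]; exact hfH j hj ξ)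
  have hle : ∀ j ≤ n, ∫ v, ‖iteratedFDeriv ℝ j f v‖ ≤ C * ∫ ξ, H ξ := fun j hj => by
    rw [← integral_const_mul]
    exact integral_mono (hint j hj) (hH.const_mul C) fun ξ => hfH j hj ξ
  have hI : 0 ≤ C * ∫ ξ, H ξ := (integral_nonneg fun _ => norm_nonneg _).trans (hle 0 (by omega))
  have hdec : ∀ k ≤ n, ∀ x, ‖x‖ ^ k * ‖𝓕 f x‖ ≤ 2 ^ k * ((k + 1) * (C * ∫ ξ, H ξ)) := by
    intro k hk x
    have := Real.pow_mul_norm_iteratedFDeriv_fourier_le (f := f) (K := 0) (N := n) (k := 0) (n := k)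
      (hf.of_le (by exact_mod_cast le_top))
      (fun k m hk hm => by
        have hk0 : k = 0 := by simpa using hk
        subst hk0
        simpa using hint m (by exact_mod_cast hm)) le_rfl (by exact_mod_cast hk) x
    rw [norm_iteratedFDeriv_zero] at this
    refine this.trans ?_
    simp only [pow_zero, one_mul, Nat.cast_zero, mul_zero, zero_add, Finset.range_one]
    rw [Finset.sum_product]
    simp only [Finset.sum_singleton, pow_zero, one_mul]
    gcongr
    calc _ ≤ ∑ _i ∈ Finset.range (k + 1), (C * ∫ ξ, H ξ) :=
          Finset.sum_le_sum fun i hi => hle i ((Nat.lt_succ_iff.1 (Finset.mem_range.1 hi)).trans hk)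
      _ = _ := by simp
  have hpt : ∀ x, (1 + ‖x‖) ^ n * ‖𝓕⁻ f x‖ ≤
      2 ^ n * (1 + 2 ^ n * (n + 1)) * (C * ∫ ξ, H ξ) := by
    intro x
    rw [Real.fourierInv_eq_fourier_neg]
    have h0 := hdec 0 (by omega) (-x)
    have h1 := hdec n le_rfl (-x)
    rw [norm_neg] at h0 h1
    simp only [pow_zero, one_mul, Nat.cast_zero, zero_add] at h0
    have h2 : (1 + ‖x‖) ^ n ≤ 2 ^ n * (1 + ‖x‖ ^ n) := by
      have h3 := add_pow_le (zero_le_one' ℝ) (norm_nonneg x) n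
      rw [one_pow] at h3
      refine h3.trans ?_
      gcongr
      · norm_num
      · omega
    calc _ ≤ 2 ^ n * (1 + ‖x‖ ^ n) * ‖𝓕 f (-x)‖ := by gcongr
      _ = 2 ^ n * (‖𝓕 f (-x)‖ + ‖x‖ ^ n * ‖𝓕 f (-x)‖) := by ring
      _ ≤ 2 ^ n * (C * (∫ ξ, H ξ) + 2 ^ n * ((n + 1) * (C * ∫ ξ, H ξ))) := by gcongr
      _ = _ := by ring
  have hJ := integrable_one_add_norm (E := V) (μ := volume) (r := Module.finrank ℝ V + 1)
    (by linarith)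
  set Q := 2 ^ n * (1 + 2 ^ n * (n + 1)) * (C * ∫ ξ, H ξ) with hQ
  calc wnorm W f ≤ ∫⁻ x, ENNReal.ofReal (Q * (1 + ‖x‖) ^ (-((Module.finrank ℝ V : ℝ) + 1))) := by
        refine lintegral_mono fun x => ?_
        refine (mul_le_mul_left (hW x) _).trans ?_
        rw [← ofReal_norm, ← ENNReal.ofReal_mul (by positivity)]
        refine ENNReal.ofReal_le_ofReal ?_
        have h0 : 0 < 1 + ‖x‖ := by positivity
        rw [Real.rpow_neg h0.le, ← div_eq_mul_inv, le_div_iff₀ (by positivity)]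
        have e1 : (1 + ‖x‖) ^ ((Module.finrank ℝ V : ℝ) + 1) =
            (1 + ‖x‖) ^ (Module.finrank ℝ V + 1) := by
          rw [← Real.rpow_natCast]; push_cast; rfl
        rw [e1]
        refine le_trans (le_of_eq ?_) (hpt x)
        rw [hn]; ring
    _ = ENNReal.ofReal (∫ x : V, Q * (1 + ‖x‖) ^ (-((Module.finrank ℝ V : ℝ) + 1))) := by
        rw [ofReal_integral_eq_lintegral_ofReal (hJ.const_mul Q)]
        refine ae_of_all _ fun x => ?_
        have : (0 : ℝ) ≤ 1 + ‖x‖ := by positivity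
        have hQ0 : 0 ≤ Q := by positivity
        positivity
    _ = _ := by
        rw [integral_const_mul, hQ]
        congr 1
        rw [hn]; push_cast; ring

/-- The multipliers `M exp(φ)`, with `φ` the symbol of the small jumps, are bounded uniformly over
all measures with controlled second moment and nondegeneracy. -/
lemma exists_wnorm_mul_exp_smallSymbol_le (V : Type*) [NormedAddCommGroup V]
    [InnerProductSpace ℝ V] [FiniteDimensional ℝ V] [MeasurableSpace V] [BorelSpace V]
    {A c p : ℝ} (hA0 : 0 ≤ A) (hc : 0 < c) (hp : 0 < p) :
    ∃ C : ℝ, 0 < C ∧ ∀ μ : Measure V, Integrable (fun y => ‖y‖ ^ 2) μ → ∫ y, ‖y‖ ^ 2 ∂μ ≤ A →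
      (∀ᵐ y ∂μ, ‖y‖ ≤ 1) → (∀ ξ, (smallSymbol μ ξ).re ≤ 0) →
      (∀ ξ, 1 ≤ ‖ξ‖ → (smallSymbol μ ξ).re ≤ -c * ‖ξ‖ ^ p) →
      ∀ (M : V → ℂ) (B : ℝ), 0 ≤ B → ContDiff ℝ (⊤ : ℕ∞) M →
      (∀ j ≤ Module.finrank ℝ V + 2, ∀ ξ, ‖iteratedFDeriv ℝ j M ξ‖ ≤ B * (1 + ‖ξ‖) ^ 2) →
      Continuous (fun ξ => M ξ * Complex.exp (smallSymbol μ ξ)) ∧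
      Integrable (fun ξ => M ξ * Complex.exp (smallSymbol μ ξ)) ∧
      ∀ W : V → ℝ≥0∞, (∀ x, W x ≤ ENNReal.ofReal (1 + ‖x‖)) →
        wnorm W (fun ξ => M ξ * Complex.exp (smallSymbol μ ξ)) ≤ ENNReal.ofReal (B * C) := by
  set n := Module.finrank ℝ V + 2 with hn
  set D : ℝ := max 1 ((2 * Real.pi) ^ (n + 2) * A) with hD
  set H : V → ℝ := expDecay (2 * n + 2) c p with hH
  have hHi : Integrable H := integrable_expDecay _ hc hp
  set C₁ : ℝ := 2 ^ n * n.factorial * D ^ n with hC₁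
  set C₂ : ℝ := (2 ^ n * (1 + 2 ^ n * (Module.finrank ℝ V + 3)) * ∫ ξ, H ξ) *
        ∫ x : V, (1 + ‖x‖) ^ (-((Module.finrank ℝ V : ℝ) + 1)) with hC₂
  have hD1 : 1 ≤ D := le_max_left _ _
  have hpi := Real.pi_pos
  refine ⟨max 1 (C₁ * C₂), by positivity, fun μ h2 hA hs hre hre1 M B hB hM hMB => ?_⟩
  obtain ⟨hφ, hφn⟩ := norm_iteratedFDeriv_smallSymbol_le h2 hA hs
  have hsm : ContDiff ℝ (⊤ : ℕ∞) (fun ξ => M ξ * Complex.exp (smallSymbol μ ξ)) :=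
    hM.mul (Complex.contDiff_exp.comp hφ)
  have hbd : ∀ j ≤ n, ∀ ξ, ‖iteratedFDeriv ℝ j (fun ξ => M ξ * Complex.exp (smallSymbol μ ξ)) ξ‖ ≤
      (B * C₁) * H ξ := by
    intro j hj ξ
    refine (contDiff_mul_cexp_bound hφ hM hD1 hB (fun i hi ξ => (hφn i ξ).trans ?_) hMB hj ξ).trans ?_
    · gcongr
      refine le_trans ?_ (le_max_right _ _)
      gcongr
      linarith [Real.pi_gt_three]
    · have : Real.exp (smallSymbol μ ξ).re ≤ Real.exp c * Real.exp (-c * ‖ξ‖ ^ p) := by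
        rw [← Real.exp_add]
        refine Real.exp_le_exp.2 ?_
        rcases le_total 1 ‖ξ‖ with h | h
        · linarith [hre1 ξ h]
        -- Inside the unit ball only nonpositivity of the real part is available. The factor exp c
        -- in `expDecay` is there to absorb this case.
        · have : ‖ξ‖ ^ p ≤ 1 := Real.rpow_le_one (norm_nonneg _) h hp.le
          nlinarith [hre ξ]
      rw [hH, expDecay]
      gcongr
  refine ⟨hsm.continuous, ?_, fun W hW => ?_⟩
  · refine (hHi.const_mul (B * C₁)).mono' hsm.continuous.aestronglyMeasurable (ae_of_all _ fun ξ => ?_)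
    have := hbd 0 (by omega) ξ
    rwa [norm_iteratedFDeriv_zero] at this
  · refine (wnorm_le_of_iteratedFDeriv hsm hHi hbd hW).trans ?_
    refine ENNReal.ofReal_le_ofReal ?_
    rw [mul_assoc]
    gcongr
    exact le_max_right _ _

end LevyKernel

end

/-! ### Uniform weighted bounds for normalized Lévy exponents -/

noncomputable section

namespace LevyKernel

variable {V : Type*} [NormedAddCommGroup V] [InnerProductSpace ℝ V] [FiniteDimensional ℝ V]
  [MeasurableSpace V] [BorelSpace V]

lemma norm_iteratedFDeriv_const_one_le (j : ℕ) (ξ : V) :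
    ‖iteratedFDeriv ℝ j (fun _ : V => (1 : ℂ)) ξ‖ ≤ 1 * (1 + ‖ξ‖) ^ 2 := by
  have h : (1 : ℝ) ≤ (1 + ‖ξ‖) ^ 2 := by nlinarith [norm_nonneg ξ]
  rcases Nat.eq_zero_or_pos j with rfl | hj
  · simpa using h
  · rw [iteratedFDeriv_const_of_ne hj.ne']
    simp; positivity

lemma norm_iteratedFDeriv_innerC_le (v : V) (j : ℕ) (ξ : V) :
    ‖iteratedFDeriv ℝ j (fun ξ => innerC v ξ) ξ‖ ≤ ‖v‖ * (1 + ‖ξ‖) ^ 2 := by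
  match j with
  | 0 =>
    rw [norm_iteratedFDeriv_zero]
    refine ((innerC v).le_opNorm ξ).trans ?_
    gcongr
    · exact norm_innerC_le v
    · nlinarith [norm_nonneg ξ]
  | j + 1 =>
    have h1 : fderiv ℝ (fun ξ => innerC v ξ) = fun _ => innerC v :=
      funext fun ξ => (innerC v).fderiv
    rw [← norm_iteratedFDeriv_fderiv, h1]
    have h : (1 : ℝ) ≤ (1 + ‖ξ‖) ^ 2 := by nlinarith [norm_nonneg ξ]
    rcases Nat.eq_zero_or_pos j with rfl | hj
    · rw [norm_iteratedFDeriv_zero]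
      exact (norm_innerC_le v).trans (le_mul_of_one_le_right (norm_nonneg _) h)
    · rw [iteratedFDeriv_const_of_ne hj.ne']
      simp; positivity

/-- The characteristic function `∫ exp(2πiξ·y) ρ(dy)`. -/
def charF (ρ : Measure V) (ξ : V) : ℂ := ∫ y, phase ⟪ξ, y⟫ ∂ρ

lemma continuous_charF (ρ : Measure V) [IsFiniteMeasure ρ] : Continuous (charF ρ) :=
  continuous_of_dominated (bound := fun _ => 1)
    (fun x => (by fun_prop : Continuous fun y : V => phase ⟪x, y⟫).aestronglyMeasurable)
    (fun x => ae_of_all _ fun ξ => by simp) (integrable_const _)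
    (ae_of_all _ fun ξ => by fun_prop)

lemma norm_charF_le (ρ : Measure V) [IsProbabilityMeasure ρ] (ξ : V) : ‖charF ρ ξ‖ ≤ 1 := by
  refine (norm_integral_le_integral_norm _).trans ?_
  simp

lemma charF_neg (ρ : Measure V) (ξ : V) : charF ρ (-ξ) = charF (ρ.map (fun y => -y)) ξ := by
  rw [charF, charF, integral_map (by fun_prop)]
  · simp
  · exact Continuous.aestronglyMeasurable (by fun_prop)

/-- The Lévy exponent with small jumps `μ`, large jumps `ρ` and drift `b`. -/
def levyExponent (μ ρ : Measure V) (b ζ : V) : ℂ :=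
  smallSymbol μ ζ + (charF ρ ζ - 1) + 2 * Real.pi * Complex.I * (⟪ζ, b⟫ : ℝ)

lemma exp_levyExponent (μ ρ : Measure V) (b ζ : V) :
    Complex.exp (levyExponent μ ρ b ζ) =
      Complex.exp (smallSymbol μ ζ) * Complex.exp (charF ρ ζ - 1) * phase ⟪ζ, b⟫ := by
  rw [levyExponent, Complex.exp_add, Complex.exp_add, phase]

/-- Only the small jumps have to provide decay in ξ. Given that, the compound Poisson factor costs
exp A, and the drift is a translation costing at most 1 + A. -/
lemma wnorm_mul_exp_levyExponent_le {W : V → ℝ≥0∞} (hW : IsWeight W) {μ ρ : Measure V}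
    [IsProbabilityMeasure ρ] {A C : ℝ} (hA : 0 ≤ A) {b : V} (hb : ‖b‖ ≤ A)
    (hWle : ∀ x, W x ≤ ENNReal.ofReal (1 + ‖x‖)) (hρ : ∫⁻ y, W y ∂ρ ≤ ENNReal.ofReal A)
    {M : V → ℂ} (hc : Continuous fun ξ => M ξ * Complex.exp (smallSymbol μ ξ))
    (hi : Integrable fun ξ => M ξ * Complex.exp (smallSymbol μ ξ))
    (hn : wnorm W (fun ξ => M ξ * Complex.exp (smallSymbol μ ξ)) ≤ ENNReal.ofReal C) :
    Integrable (fun ξ => M ξ * Complex.exp (levyExponent μ ρ b ξ)) ∧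
    wnorm W (fun ξ => M ξ * Complex.exp (levyExponent μ ρ b ξ)) ≤
      ENNReal.ofReal (C * ((1 + A) * Real.exp A)) := by
  have he : (fun ξ => M ξ * Complex.exp (levyExponent μ ρ b ξ)) = fun ξ => phase ⟪ξ, b⟫ *
      (M ξ * Complex.exp (smallSymbol μ ξ) * Complex.exp (charF ρ ξ - 1)) := by
    ext ξ; rw [exp_levyExponent]; ring
  have hcc := continuous_charF ρ
  have hi2 : Integrable fun ξ => M ξ * Complex.exp (smallSymbol μ ξ) *
      Complex.exp (charF ρ ξ - 1) := by
    refine hi.mul_bdd (c := 1) (by fun_prop) (ae_of_all _ fun ξ => ?_)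
    rw [Complex.norm_exp, Real.exp_le_one_iff]
    have := (Complex.re_le_norm _).trans (norm_charF_le ρ ξ)
    simpa using this
  rw [he]
  refine ⟨integrable_phase_mul hi2 b, ?_⟩
  calc _ ≤ W b * (ENNReal.ofReal (Real.exp A) * ENNReal.ofReal C) := by
        refine (wnorm_phase_mul_le hW hi2 b).trans ?_
        gcongr
        refine (wnorm_mul_exp_charFun_le hW hc hi hA hρ).trans ?_
        gcongr
    _ ≤ ENNReal.ofReal (1 + A) * (ENNReal.ofReal (Real.exp A) * ENNReal.ofReal C) := by
        gcongr
        exact (hWle b).trans (ENNReal.ofReal_le_ofReal (by linarith))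
    _ = _ := by
        rw [← ENNReal.ofReal_mul (by positivity), ← ENNReal.ofReal_mul (by positivity)]
        congr 1; ring

lemma contDiff_innerC (v : V) : ContDiff ℝ (⊤ : ℕ∞) (fun ξ => innerC v ξ) := (innerC v).contDiff

/-- Uniform bounds for the semigroup symbol `exp Λ` of a normalized Lévy exponent `Λ`. -/
lemma exists_wnorm_levyExponent_le (V : Type*) [NormedAddCommGroup V]
    [InnerProductSpace ℝ V] [FiniteDimensional ℝ V] [MeasurableSpace V] [BorelSpace V]
    {A c p : ℝ} (hA0 : 0 ≤ A) (hc : 0 < c) (hp : 0 < p) :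
    ∃ C : ℝ, 0 < C ∧ ∀ μ : Measure V, Integrable (fun y => ‖y‖ ^ 2) μ → ∫ y, ‖y‖ ^ 2 ∂μ ≤ A →
      (∀ᵐ y ∂μ, ‖y‖ ≤ 1) → (∀ ξ, (smallSymbol μ ξ).re ≤ 0) →
      (∀ ξ, 1 ≤ ‖ξ‖ → (smallSymbol μ ξ).re ≤ -c * ‖ξ‖ ^ p) →
      ∀ (ρ : Measure V) (b : V), IsProbabilityMeasure ρ → ‖b‖ ≤ A →
      ∀ W : V → ℝ≥0∞, IsWeight W → (∀ x, W x ≤ ENNReal.ofReal (1 + ‖x‖)) →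
      ∫⁻ y, W y ∂ρ ≤ ENNReal.ofReal A →
      Continuous (levyExponent μ ρ b) ∧
      Integrable (fun ξ => Complex.exp (levyExponent μ ρ b ξ)) ∧
      wnorm W (fun ξ => Complex.exp (levyExponent μ ρ b ξ)) ≤ ENNReal.ofReal C ∧
      wnorm W (fun ξ => levyExponent μ ρ b ξ * Complex.exp (levyExponent μ ρ b ξ)) ≤
        ENNReal.ofReal C ∧
      wnorm W (fun ξ => levyExponent μ ρ b (-ξ) * Complex.exp (levyExponent μ ρ b ξ)) ≤
        ENNReal.ofReal C ∧
      Integrable (fun ξ => levyExponent μ ρ b ξ * Complex.exp (levyExponent μ ρ b ξ)) ∧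
      Integrable (fun ξ => levyExponent μ ρ b (-ξ) * Complex.exp (levyExponent μ ρ b ξ)) ∧
      ∀ v : V, Integrable (fun ξ => innerC v ξ * Complex.exp (levyExponent μ ρ b ξ)) ∧
        wnorm W (fun ξ => innerC v ξ * Complex.exp (levyExponent μ ρ b ξ)) ≤
          ENNReal.ofReal (‖v‖ * C) := by
  obtain ⟨C₀, hC₀, hmain⟩ := exists_wnorm_mul_exp_smallSymbol_le V hA0 hc hp
  set n := Module.finrank ℝ V + 2 with hn
  have hpi := Real.pi_pos
  set K : ℝ := (2 * Real.pi) ^ (n + 2) * A with hK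
  have hK0 : 0 ≤ K := by positivity
  set F : ℝ := C₀ * ((1 + A) * Real.exp A) with hF
  have hF0 : 0 < F := by positivity
  -- One summand for each piece of the exponent: small jumps, characteristic function of the large
  -- jumps, the constant -1, and drift.
  set C : ℝ := K * F + A * F + F + 2 * Real.pi * (A * F) with hC
  have hCF : F ≤ C := by
    have h1 : 0 ≤ K * F := by positivity
    have h2 : 0 ≤ A * F := by positivity
    have h3 : 0 ≤ 2 * Real.pi * (A * F) := by positivity
    linarith
  refine ⟨C, by linarith, fun μ h2 hA hs hre hre1 ρ b hρ hb W hW hWle hWρ => ?_⟩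
  obtain ⟨hφ, hφn⟩ := norm_iteratedFDeriv_smallSymbol_le h2 hA hs
  have hφn' : ∀ j ≤ n, ∀ ξ, ‖iteratedFDeriv ℝ j (smallSymbol μ) ξ‖ ≤ K * (1 + ‖ξ‖) ^ 2 := by
    intro j hj ξ
    refine (hφn j ξ).trans ?_
    rw [hK]
    gcongr
    linarith [Real.pi_gt_three]
  have hφneg : ContDiff ℝ (⊤ : ℕ∞) (fun ξ => smallSymbol μ (-ξ)) := hφ.comp contDiff_neg
  have hφneg' : ∀ j ≤ n, ∀ ξ, ‖iteratedFDeriv ℝ j (fun ξ => smallSymbol μ (-ξ)) ξ‖ ≤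
      K * (1 + ‖ξ‖) ^ 2 := by
    intro j hj ξ
    have := (LinearIsometryEquiv.neg ℝ (E := V)).norm_iteratedFDeriv_comp_right (smallSymbol μ) ξ j
    have h3 : (smallSymbol μ ∘ (LinearIsometryEquiv.neg ℝ (E := V))) =
        fun ξ => smallSymbol μ (-ξ) := rfl
    rw [h3] at this
    rw [this]
    simpa using hφn' j hj (-ξ)
  have step : ∀ (M : V → ℂ) (B : ℝ), 0 ≤ B → ContDiff ℝ (⊤ : ℕ∞) M →
      (∀ j ≤ n, ∀ ξ, ‖iteratedFDeriv ℝ j M ξ‖ ≤ B * (1 + ‖ξ‖) ^ 2) →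
      Integrable (fun ξ => M ξ * Complex.exp (levyExponent μ ρ b ξ)) ∧
      wnorm W (fun ξ => M ξ * Complex.exp (levyExponent μ ρ b ξ)) ≤ ENNReal.ofReal (B * F) := by
    intro M B hB hM hMB
    obtain ⟨h1, h2, h3⟩ := hmain μ h2 hA hs hre hre1 M B hB hM hMB
    have := wnorm_mul_exp_levyExponent_le (ρ := ρ) hW hA0 hb hWle hWρ
      h1 h2 (h3 W hWle)
    rw [mul_assoc] at this
    exact this
  have s0 := step (fun _ => 1) 1 zero_le_one contDiff_const
    (fun j _ ξ => norm_iteratedFDeriv_const_one_le j ξ)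
  simp only [one_mul] at s0
  have s1 := step _ K hK0 hφ hφn'
  have s2 := step _ K hK0 hφneg hφneg'
  have s3 : ∀ v : V, _ := fun v => step _ ‖v‖ (norm_nonneg _) (contDiff_innerC v)
    (fun j _ ξ => norm_iteratedFDeriv_innerC_le v j ξ)
  have hΛc : Continuous (levyExponent μ ρ b) := by
    have h1 := continuous_charF ρ
    have h2 := hφ.continuous
    unfold levyExponent
    fun_prop
  have hec : Continuous fun ξ => Complex.exp (levyExponent μ ρ b ξ) := by fun_prop
  -- The prefactor has its own data M, ρ', b', independent of those in the exponential. The exponent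
  -- at -ξ is thus covered by the same estimate, with reflected large jumps and drift -b.
  have key : ∀ (ρ' : Measure V) (M : V → ℂ) (b' : V), IsProbabilityMeasure ρ' →
      ∫⁻ y, W y ∂ρ' ≤ ENNReal.ofReal A → ‖b'‖ ≤ A →
      Integrable (fun ξ => M ξ * Complex.exp (levyExponent μ ρ b ξ)) →
      wnorm W (fun ξ => M ξ * Complex.exp (levyExponent μ ρ b ξ)) ≤ ENNReal.ofReal (K * F) →
      Integrable (fun ξ => (M ξ + (charF ρ' ξ - 1) + 2 * Real.pi * Complex.I * (⟪ξ, b'⟫ : ℝ)) *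
        Complex.exp (levyExponent μ ρ b ξ)) ∧
      wnorm W (fun ξ => (M ξ + (charF ρ' ξ - 1) + 2 * Real.pi * Complex.I * (⟪ξ, b'⟫ : ℝ)) *
        Complex.exp (levyExponent μ ρ b ξ)) ≤ ENNReal.ofReal C := by
    intro ρ' M b' hρ' hWρ' hb' hMi hMn
    have hcc := continuous_charF ρ'
    have i2 : Integrable fun ξ => Complex.exp (levyExponent μ ρ b ξ) * charF ρ' ξ :=
      s0.1.mul_bdd (c := 1) hcc.aestronglyMeasurable (ae_of_all _ fun ξ => norm_charF_le ρ' ξ)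
    have i3 : Integrable fun ξ => (-1 : ℂ) * Complex.exp (levyExponent μ ρ b ξ) :=
      s0.1.const_mul _
    have i4 := (s3 b').1.const_mul (2 * Real.pi * Complex.I : ℂ)
    have n2 : wnorm W (fun ξ => Complex.exp (levyExponent μ ρ b ξ) * charF ρ' ξ) ≤
        ENNReal.ofReal (A * F) := by
      refine (wnorm_mul_charFun_le hW hec s0.1).trans ?_
      rw [ENNReal.ofReal_mul hA0]
      exact mul_le_mul' hWρ' s0.2
    have n3 : wnorm W (fun ξ => (-1 : ℂ) * Complex.exp (levyExponent μ ρ b ξ)) ≤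
        ENNReal.ofReal F := by
      rw [wnorm_const_mul _ s0.1 hW.measurable]
      simpa using s0.2
    have n4 : wnorm W (fun ξ => (2 * Real.pi * Complex.I : ℂ) *
        (innerC b' ξ * Complex.exp (levyExponent μ ρ b ξ))) ≤
        ENNReal.ofReal (2 * Real.pi * (A * F)) := by
      rw [wnorm_const_mul _ (s3 b').1 hW.measurable, ← ofReal_norm, norm_two_pi_I,
        ENNReal.ofReal_mul (p := 2 * Real.pi) (by positivity)]
      exact mul_le_mul' le_rfl ((s3 b').2.trans (ENNReal.ofReal_le_ofReal (by gcongr)))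
    have he : (fun ξ => (M ξ + (charF ρ' ξ - 1) + 2 * Real.pi * Complex.I * (⟪ξ, b'⟫ : ℝ)) *
        Complex.exp (levyExponent μ ρ b ξ)) = fun ξ =>
        ((M ξ * Complex.exp (levyExponent μ ρ b ξ) +
          Complex.exp (levyExponent μ ρ b ξ) * charF ρ' ξ) +
          (-1 : ℂ) * Complex.exp (levyExponent μ ρ b ξ)) + (2 * Real.pi * Complex.I : ℂ) *
          (innerC b' ξ * Complex.exp (levyExponent μ ρ b ξ)) := by
      ext ξ; rw [innerC_apply, real_inner_comm]; ring
    rw [he]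
    refine ⟨((hMi.add i2).add i3).add i4, ?_⟩
    refine (wnorm_add_le ((hMi.add i2).add i3) i4 hW.measurable).trans ?_
    have e1 := wnorm_add_le (hMi.add i2) i3 hW.measurable
    have e2 := wnorm_add_le hMi i2 hW.measurable
    rw [hC, ENNReal.ofReal_add (by positivity) (by positivity),
      ENNReal.ofReal_add (by positivity) (by positivity),
      ENNReal.ofReal_add (by positivity) (by positivity)]
    refine add_le_add (e1.trans (add_le_add (e2.trans (add_le_add hMn n2)) n3)) n4
  have k1 := key ρ (smallSymbol μ) b hρ hWρ hb s1.1 s1.2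
  have hρn : IsProbabilityMeasure (ρ.map (fun y => -y)) :=
    Measure.isProbabilityMeasure_map (by fun_prop)
  have k2 := key (ρ.map (fun y => -y)) (fun ξ => smallSymbol μ (-ξ)) (-b) hρn
    (by
      rw [lintegral_map hW.measurable (by fun_prop)]
      simpa only [hW.neg] using hWρ) (by rwa [norm_neg]) s2.1 s2.2
  have e2 : (fun ξ => levyExponent μ ρ b (-ξ) * Complex.exp (levyExponent μ ρ b ξ)) = fun ξ =>
      (smallSymbol μ (-ξ) + (charF (ρ.map (fun y => -y)) ξ - 1) + 2 * Real.pi * Complex.I *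
        (⟪ξ, -b⟫ : ℝ)) * Complex.exp (levyExponent μ ρ b ξ) := by
    ext ξ
    rw [levyExponent, charF_neg, inner_neg_left, inner_neg_right]
  refine ⟨hΛc, s0.1, s0.2.trans (ENNReal.ofReal_le_ofReal hCF), k1.2, by rw [e2]; exact k2.2,
    k1.1, by rw [e2]; exact k2.1, fun v => ⟨(s3 v).1, (s3 v).2.trans ?_⟩⟩
  exact ENNReal.ofReal_le_ofReal (by gcongr)

end LevyKernel

end

noncomputable section

namespace LevyKernel

/-! ### O-regular variation -/

/-- Fekete's lemma in continuous time. -/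
lemma exists_tendsto_div_of_subadditive {h : ℝ → ℝ}
    (hsub : ∀ u v, 0 ≤ u → 0 ≤ v → h (u + v) ≤ h u + h v)
    (hlow : ∃ C, 0 ≤ C ∧ ∀ u, 0 ≤ u → -(C * (u + 1)) ≤ h u)
    (hup : ∀ T, ∃ M, ∀ u, 0 ≤ u → u ≤ T → h u ≤ M) :
    ∃ L, Tendsto (fun u => h u / u) atTop (𝓝 L) := by
  obtain ⟨C, hC, hlow⟩ := hlow
  set S : Set ℝ := (fun u => h u / u) '' Ici 1 with hS
  have hbdd : BddBelow S := by
    refine ⟨-(2 * C), ?_⟩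
    rintro _ ⟨u, hu, rfl⟩
    have hu : 1 ≤ u := hu
    rw [le_div_iff₀ (by linarith)]
    have := hlow u (by linarith)
    nlinarith
  have hne : S.Nonempty := ⟨_, 1, by simp, rfl⟩
  refine ⟨sInf S, ?_⟩
  rw [Metric.tendsto_atTop]
  intro ε hε
  obtain ⟨_, ⟨v, hv, rfl⟩, hvlt⟩ := exists_lt_of_csInf_lt hne (lt_add_of_pos_right (sInf S) (half_pos hε))
  have hv : 1 ≤ v := hv
  have hv0 : 0 < v := by linarith
  set a := h v / v with ha
  have hav : h v = a * v := by rw [ha]; field_simp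
  obtain ⟨M, hM⟩ := hup v
  have hmul : ∀ n : ℕ, ∀ s, 0 ≤ s → h (n * v + s) ≤ n * h v + h s := by
    intro n
    induction n with
    | zero => intro s _; simp
    | succ n ih =>
      intro s hs
      have := hsub v (n * v + s) hv0.le (by positivity)
      have h2 := ih s hs
      have e : ((n + 1 : ℕ) : ℝ) * v + s = v + (n * v + s) := by push_cast; ring
      rw [e]; push_cast; linarith
  -- With u = n v + s and 0 ≤ s < v, subadditivity gives h u ≤ a u + Q. The constant Q collects what
  -- the remainder s contributes, and it disappears after division by u.
  set Q := |M| + |a| * v with hQ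
  have hQ0 : 0 ≤ Q := by positivity
  refine ⟨max 1 (2 * Q / ε + 1), fun u hu => ?_⟩
  have hu1 : 1 ≤ u := (le_max_left _ _).trans hu
  have hu0 : 0 < u := by linarith
  have hu2 : 2 * Q / ε + 1 ≤ u := (le_max_right _ _).trans hu
  have hge : sInf S ≤ h u / u := csInf_le hbdd ⟨u, hu1, rfl⟩
  have hle : h u / u < sInf S + ε := by
    set n := ⌊u / v⌋₊
    have hn1 : (n : ℝ) * v ≤ u := by
      have := Nat.floor_le (div_nonneg hu0.le hv0.le)
      rwa [le_div_iff₀ hv0] at this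
    have hn2 : u < (n + 1) * v := by
      have := Nat.lt_floor_add_one (u / v)
      rwa [div_lt_iff₀ hv0] at this
    have h1 := hmul n (u - n * v) (by linarith)
    rw [add_sub_cancel] at h1
    have h2 := hM (u - n * v) (by linarith) (by linarith)
    have h3 : h u ≤ a * u + Q := by
      have e1 : (n : ℝ) * h v = a * u - a * (u - n * v) := by rw [hav]; ring
      have e2 : -(a * (u - n * v)) ≤ |a| * v := by
        have hx : 0 ≤ u - n * v := by linarith
        calc -(a * (u - n * v)) ≤ |a * (u - n * v)| := neg_le_abs _
          _ = |a| * (u - n * v) := by rw [abs_mul, abs_of_nonneg hx]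
          _ ≤ |a| * v := by gcongr; linarith
      have := le_abs_self M
      linarith
    rw [div_lt_iff₀ hu0]
    have h4 : Q < ε / 2 * u := by
      have : 2 * Q / ε < u := by linarith
      rw [div_lt_iff₀ hε] at this
      linarith
    nlinarith
  rw [Real.dist_eq, abs_of_nonneg (by linarith)]
  linarith

/-- The asymptotic ratio `limsup f(εx)/f(ε)` along a filter. -/
def ratioAlong (l : Filter ℝ) (f : ℝ → ℝ) (x : ℝ) : ℝ≥0∞ :=
  limsup (fun ε : ℝ => ENNReal.ofReal (f (ε * x) / f ε)) l

section Ratio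

variable {l : Filter ℝ} {f : ℝ → ℝ}

lemma ratioAlong_mono (hl0 : ∀ᶠ ε in l, 0 < ε) (hpos : ∀ r, 0 < r → 0 < f r)
    (hmono : ∀ s r, 0 < s → s ≤ r → f s ≤ f r) {x y : ℝ} (hx : 0 < x) (hxy : x ≤ y) :
    ratioAlong l f x ≤ ratioAlong l f y := by
  refine limsup_le_limsup ?_
  filter_upwards [hl0] with ε hε
  refine ENNReal.ofReal_le_ofReal ?_
  have := hpos ε hε
  gcongr
  exact hmono _ _ (by positivity) (by gcongr)

lemma ratioAlong_one [l.NeBot] (hl0 : ∀ᶠ ε in l, 0 < ε) (hpos : ∀ r, 0 < r → 0 < f r) :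
    ratioAlong l f 1 = 1 := by
  have : (fun ε : ℝ => ENNReal.ofReal (f (ε * 1) / f ε)) =ᶠ[l] fun _ => 1 := by
    filter_upwards [hl0] with ε hε
    rw [mul_one, div_self (hpos ε hε).ne', ENNReal.ofReal_one]
  rw [ratioAlong, limsup_congr this, limsup_const]

/-- Factor f(εxy)/f(ε) through f(εx). The second factor is the ratio at y sampled along εx, and
dilations preserve the filter. Finiteness excludes the form 0·∞ in the limsup of a product. -/
lemma ratioAlong_mul_le (hl0 : ∀ᶠ ε in l, 0 < ε) (hpos : ∀ r, 0 < r → 0 < f r)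
    (hl : ∀ x, 0 < x → Tendsto (fun ε => ε * x) l l)
    (hfin : ∀ x, 0 < x → ratioAlong l f x < ∞) {x y : ℝ} (hx : 0 < x) (hy : 0 < y) :
    ratioAlong l f (x * y) ≤ ratioAlong l f x * ratioAlong l f y := by
  have h1 : (fun ε : ℝ => ENNReal.ofReal (f (ε * (x * y)) / f ε)) =ᶠ[l]
      (fun ε => ENNReal.ofReal (f (ε * x) / f ε)) *
        (fun ε => ENNReal.ofReal (f (ε * x * y) / f (ε * x))) := by
    filter_upwards [hl0] with ε hε
    have h1 := hpos ε hε
    have h2 := hpos (ε * x) (by positivity)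
    have h3 := hpos (ε * x * y) (by positivity)
    rw [Pi.mul_apply, ← ENNReal.ofReal_mul (by positivity)]
    congr 1
    field_simp
  have h2 : limsup (fun ε => ENNReal.ofReal (f (ε * x * y) / f (ε * x))) l ≤ ratioAlong l f y :=
    limsup_le_limsup_of_le (f := map (fun ε => ε * x) l) (g := l)
      (u := fun ε => ENNReal.ofReal (f (ε * y) / f ε)) (hl x hx) (by isBoundedDefault)
      (by isBoundedDefault)
  rw [ratioAlong, limsup_congr h1]
  refine (ENNReal.limsup_mul_le' ?_ ?_).trans (mul_le_mul' le_rfl h2)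
  · exact Or.inr (h2.trans_lt (hfin y hy)).ne
  · exact Or.inl (hfin x hx).ne

/-- The function u ↦ log r(exp u) is subadditive and monotone, so Fekete's lemma applies to it and
to its reflection. Monotonicity supplies the required local bounds. Positivity comes from 1 = r(1) ≤
r(x) r(1/x). Hence the `limUnder` values defining the indices are true limits, not default values.
-/
lemma log_ratioAlong [l.NeBot] (hl0 : ∀ᶠ ε in l, 0 < ε) (hpos : ∀ r, 0 < r → 0 < f r)
    (hmono : ∀ s r, 0 < s → s ≤ r → f s ≤ f r)
    (hl : ∀ x, 0 < x → Tendsto (fun ε => ε * x) l l)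
    (hfin : ∀ x, 0 < x → ratioAlong l f x < ∞) :
    (∀ x, 0 < x → 0 < (ratioAlong l f x).toReal) ∧
    (∃ L, Tendsto (fun x => Real.log (ratioAlong l f x).toReal / Real.log x) (𝓝[>] 0) (𝓝 L)) ∧
    (∃ L, Tendsto (fun x => Real.log (ratioAlong l f x).toReal / Real.log x) atTop (𝓝 L)) := by
  have hpos' : ∀ x, 0 < x → 0 < (ratioAlong l f x).toReal := by
    intro x hx
    refine ENNReal.toReal_pos (fun h0 => ?_) (hfin x hx).ne
    have := ratioAlong_mul_le hl0 hpos hl hfin hx (inv_pos.2 hx)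
    rw [mul_inv_cancel₀ hx.ne', ratioAlong_one hl0 hpos, h0, zero_mul] at this
    simp at this
  set h : ℝ → ℝ := fun u => Real.log (ratioAlong l f (Real.exp u)).toReal with hh
  have hsub : ∀ u v, h (u + v) ≤ h u + h v := by
    intro u v
    simp only [hh]
    rw [← Real.log_mul (hpos' _ (Real.exp_pos u)).ne' (hpos' _ (Real.exp_pos v)).ne',
      ← ENNReal.toReal_mul, Real.exp_add]
    refine Real.log_le_log (hpos' _ (by positivity)) (ENNReal.toReal_mono ?_ ?_)
    · exact ENNReal.mul_ne_top (hfin _ (Real.exp_pos u)).ne (hfin _ (Real.exp_pos v)).ne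
    · exact ratioAlong_mul_le hl0 hpos hl hfin (Real.exp_pos u) (Real.exp_pos v)
  have hmon : Monotone h := by
    intro u v huv
    refine Real.log_le_log (hpos' _ (Real.exp_pos u)) (ENNReal.toReal_mono (hfin _ (Real.exp_pos v)).ne ?_)
    exact ratioAlong_mono hl0 hpos hmono (Real.exp_pos u) (Real.exp_le_exp.2 huv)
  have h0 : h 0 = 0 := by simp [hh, ratioAlong_one hl0 hpos]
  have hn : ∀ n : ℕ, h n ≤ n * h 1 := by
    intro n
    induction n with
    | zero => simp [h0]
    | succ n ih => have := hsub n 1; push_cast; linarith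
  have h1 : 0 ≤ h 1 := h0 ▸ hmon zero_le_one
  have hlin : ∀ u, 0 ≤ u → h u ≤ h 1 * (u + 1) := by
    intro u hu
    have e1 := hmon (Nat.lt_floor_add_one u).le
    have e2 := hn (⌊u⌋₊ + 1)
    push_cast at e2
    have e3 := Nat.floor_le hu
    nlinarith
  obtain ⟨L₁, hL₁⟩ := exists_tendsto_div_of_subadditive (h := h) (fun u v _ _ => hsub u v)
    ⟨0, le_rfl, fun u hu => by rw [zero_mul, neg_zero, ← h0]; exact hmon hu⟩
    (fun T => ⟨h T, fun u _ hu => hmon hu⟩)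
  obtain ⟨L₂, hL₂⟩ := exists_tendsto_div_of_subadditive (h := fun u => h (-u))
    (fun u v _ _ => by rw [neg_add]; exact hsub _ _)
    ⟨h 1, h1, fun u hu => by
      have e1 := hsub u (-u)
      rw [add_neg_cancel, h0] at e1
      linarith [hlin u hu]⟩
    (fun T => ⟨0, fun u hu _ => h0 ▸ hmon (by linarith)⟩)
  refine ⟨hpos', ⟨-L₂, ?_⟩, ⟨L₁, ?_⟩⟩
  · have := (hL₂.comp (tendsto_neg_atBot_atTop.comp Real.tendsto_log_nhdsGT_zero)).neg
    refine this.congr' ?_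
    filter_upwards [self_mem_nhdsWithin] with x hx
    simp only [Function.comp, hh, neg_neg]
    rw [Real.exp_log hx, div_neg, neg_neg]
  · refine (hL₁.comp Real.tendsto_log_atTop).congr' ?_
    filter_upwards [eventually_gt_atTop 0] with x hx
    simp only [Function.comp, hh]
    rw [Real.exp_log hx]

lemma eventually_ratio_le_rpow [l.NeBot] (hl0 : ∀ᶠ ε in l, 0 < ε) (hpos : ∀ r, 0 < r → 0 < f r)
    (hmono : ∀ s r, 0 < s → s ≤ r → f s ≤ f r)
    (hl : ∀ x, 0 < x → Tendsto (fun ε => ε * x) l l)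
    (hfin : ∀ x, 0 < x → ratioAlong l f x < ∞) :
    (∀ p < lowerIndex (ratioAlong l f), ∀ᶠ x in 𝓝[>] (0 : ℝ), ∀ᶠ ε in l,
      f (ε * x) ≤ x ^ p * f ε) ∧
    (∀ q, upperIndex (ratioAlong l f) < q → ∀ᶠ x in atTop, ∀ᶠ ε in l,
      f (ε * x) ≤ x ^ q * f ε) := by
  obtain ⟨hpos', h1, h2⟩ := log_ratioAlong hl0 hpos hmono hl hfin
  have key : ∀ x z, 0 < x → Real.log (ratioAlong l f x).toReal < z * Real.log x →
      ∀ᶠ ε in l, f (ε * x) ≤ x ^ z * f ε := by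
    intro x z hx hz
    have e1 : (ratioAlong l f x).toReal < x ^ z := by
      rw [Real.rpow_def_of_pos hx, mul_comm]
      exact (Real.log_lt_iff_lt_exp (hpos' x hx)).1 hz
    have e2 : ratioAlong l f x < ENNReal.ofReal (x ^ z) :=
      (ENNReal.lt_ofReal_iff_toReal_lt (hfin x hx).ne).2 e1
    filter_upwards [eventually_lt_of_limsup_lt e2, hl0] with ε hε hε0
    have := (ENNReal.ofReal_lt_ofReal_iff (by positivity)).1 hε
    rw [div_lt_iff₀ (hpos ε hε0)] at this
    exact this.le
  refine ⟨fun p hp => ?_, fun q hq => ?_⟩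
  · have := (tendsto_nhds_limUnder h1).eventually_const_lt hp
    filter_upwards [this, Ioo_mem_nhdsGT (zero_lt_one' ℝ)] with x hx hx1
    refine key x p hx1.1 ?_
    -- Here log x < 0, so a lower bound on the quotient becomes an upper bound on log r(x).
    rwa [lt_div_iff_of_neg (Real.log_neg hx1.1 hx1.2)] at hx
  · have := (tendsto_nhds_limUnder h2).eventually_lt_const hq
    filter_upwards [this, eventually_gt_atTop 1] with x hx hx1
    refine key x q (by linarith) ?_
    rwa [div_lt_iff₀ (Real.log_pos hx1)] at hx

end Ratio

/-- Gluing of almost-monotonicity at zero, at infinity and on compact sets. -/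
lemma exists_le_mul_of_zones {g : ℝ → ℝ} (hg : ∀ r, 0 < r → 0 < g r) {y₀ K ε₁ ε₂ : ℝ}
    (hy₀ : 1 < y₀) (hε₁ : 0 < ε₁)
    (H1 : ∀ s, 0 < s → s < ε₁ ∨ ε₂ < s → g (s * y₀) ≤ g s)
    (H2 : ∀ s r, 0 < s → s ≤ r → r ≤ s * y₀ → s < ε₁ ∨ ε₂ < s → g r ≤ K * g s)
    (H3 : ∀ a b, 0 < a → ∃ C, ∀ s r, a ≤ s → s ≤ r → r ≤ b → g r ≤ C * g s) :
    ∃ C, 0 < C ∧ ∀ s r, 0 < s → s ≤ r → g r ≤ C * g s := by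
  -- Within a zone, `H1` descends along the progression s y₀ⁿ up to the last point below r, and `H2`
  -- covers the final incomplete step.
  have chain : ∀ s r, 0 < s → s ≤ r → (∀ z, s ≤ z → z ≤ r → z < ε₁ ∨ ε₂ < z) →
      g r ≤ K * g s := by
    intro s r hs hsr hz
    obtain ⟨n, hn1, hn2⟩ := exists_nat_pow_near (x := r / s) (y := y₀)
      ((one_le_div hs).2 hsr) hy₀
    have hn1' : s * y₀ ^ n ≤ r := by rw [mul_comm]; exact (le_div_iff₀ hs).1 hn1
    have hn2' : r ≤ s * y₀ ^ n * y₀ := by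
      rw [div_lt_iff₀ hs] at hn2
      rw [mul_assoc, ← pow_succ, mul_comm]; exact hn2.le
    have hk : ∀ k ≤ n, s ≤ s * y₀ ^ k ∧ s * y₀ ^ k ≤ r ∧ g (s * y₀ ^ k) ≤ g s := by
      intro k
      induction k with
      | zero => intro _; simp [hsr]
      | succ k ih =>
        intro hk
        obtain ⟨i1, i2, i3⟩ := ih (by omega)
        refine ⟨le_mul_of_one_le_right hs.le (one_le_pow₀ hy₀.le), ?_, ?_⟩
        · exact le_trans (by gcongr; exact hy₀.le) hn1'
        · have := H1 (s * y₀ ^ k) (by positivity) (hz _ i1 i2)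
          rw [mul_assoc, ← pow_succ] at this
          exact this.trans i3
    obtain ⟨i1, i2, i3⟩ := hk n le_rfl
    have hK : 0 < K := by
      have := H2 s s hs le_rfl (by nlinarith) (hz s le_rfl hsr)
      have h0 := hg s hs
      by_contra hK
      nlinarith
    exact (H2 _ r (by positivity) hn1' hn2' (hz _ i1 i2)).trans (by gcongr)
  set a := ε₁ / 2 with ha
  set b := max ε₂ ε₁ + 1 with hb
  have ha0 : 0 < a := by positivity
  have hb1 : ε₂ < b := by have := le_max_left ε₂ ε₁; linarith
  have hb2 : ε₁ < b := by have := le_max_right ε₂ ε₁; linarith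
  have hab : a < b := by linarith
  obtain ⟨C₂, hC₂⟩ := H3 a b ha0
  have z1 : ∀ s r, 0 < s → s ≤ r → r ≤ a → g r ≤ K * g s := fun s r hs hsr hr =>
    chain s r hs hsr fun z _ hz => Or.inl (by linarith)
  have z3 : ∀ s r, b ≤ s → s ≤ r → g r ≤ K * g s := fun s r hs hsr =>
    chain s r (by linarith) hsr fun z hz _ => Or.inr (by linarith)
  set Q := max 1 (max |K| |C₂|) with hQ
  have hQ1 : 1 ≤ Q := le_max_left _ _
  have hQK : K ≤ Q := (le_abs_self K).trans ((le_max_left _ _).trans (le_max_right _ _))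
  have hQC : C₂ ≤ Q := (le_abs_self C₂).trans ((le_max_right _ _).trans (le_max_right _ _))
  have Z1 : ∀ s r, 0 < s → s ≤ r → r ≤ a → g r ≤ Q * g s := fun s r hs hsr hr =>
    (z1 s r hs hsr hr).trans (mul_le_mul_of_nonneg_right hQK (hg s hs).le)
  have Z2 : ∀ s r, a ≤ s → s ≤ r → r ≤ b → g r ≤ Q * g s := fun s r hs hsr hr =>
    (hC₂ s r hs hsr hr).trans (mul_le_mul_of_nonneg_right hQC (hg s (by linarith)).le)
  have Z3 : ∀ s r, b ≤ s → s ≤ r → g r ≤ Q * g s := fun s r hs hsr =>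
    (z3 s r hs hsr).trans (mul_le_mul_of_nonneg_right hQK (hg s (by linarith)).le)
  have hp : Q ≤ Q ^ 3 ∧ Q ^ 2 ≤ Q ^ 3 := ⟨le_self_pow₀ hQ1 (by norm_num), pow_le_pow_right₀ hQ1 (by norm_num)⟩
  -- The interval from s to r meets at most three zones (near zero, compact, near infinity), each
  -- costing one factor Q.
  refine ⟨Q ^ 3, by positivity, fun s r hs hsr => ?_⟩
  have hgs := hg s hs
  have up1 : ∀ {x}, x ≤ Q * g s → x ≤ Q ^ 3 * g s := fun h =>
    h.trans (mul_le_mul_of_nonneg_right hp.1 hgs.le)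
  have up2 : ∀ {x y}, x ≤ Q * y → y ≤ Q * g s → x ≤ Q ^ 2 * g s := fun h h' => by
    have : Q * _ ≤ Q * (Q * g s) := mul_le_mul_of_nonneg_left h' (by linarith)
    rw [sq, mul_assoc]; exact h.trans this
  have up2' : ∀ {x}, x ≤ Q ^ 2 * g s → x ≤ Q ^ 3 * g s := fun h =>
    h.trans (mul_le_mul_of_nonneg_right hp.2 hgs.le)
  have up3 : ∀ {x y}, x ≤ Q * y → y ≤ Q ^ 2 * g s → x ≤ Q ^ 3 * g s := fun h h' => by
    have : Q * _ ≤ Q * (Q ^ 2 * g s) := mul_le_mul_of_nonneg_left h' (by linarith)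
    calc _ ≤ _ := h
      _ ≤ _ := this
      _ = _ := by ring
  rcases le_or_gt r a with hra | hra
  · exact up1 (Z1 s r hs hsr hra)
  rcases le_or_gt b s with hbs | hbs
  · exact up1 (Z3 s r hbs hsr)
  rcases le_or_gt a s with has | has <;> rcases le_or_gt r b with hrb | hrb
  · exact up1 (Z2 s r has hsr hrb)
  · exact up2' (up2 (Z3 b r le_rfl hrb.le) (Z2 s b has hbs.le le_rfl))
  · exact up2' (up2 (Z2 a r le_rfl hra.le hrb) (Z1 s a hs has.le le_rfl))
  · exact up3 (Z3 b r le_rfl hrb.le) (up2 (Z2 a b le_rfl hab.le le_rfl) (Z1 s a hs has.le le_rfl))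

/-- Global scaling bounds for a monotone O-RV function. -/
lemma IsORV.exists_scaling {f : ℝ → ℝ} (hf : IsORV f)
    (hmono : ∀ s r, 0 < s → s ≤ r → f s ≤ f r) {p q : ℝ} (hp : 0 < p) (hq : 0 < q)
    (hp1 : p < lowerIndex (ratioZero f)) (hp2 : p < lowerIndex (ratioInfty f))
    (hq1 : upperIndex (ratioZero f) < q) (hq2 : upperIndex (ratioInfty f) < q) :
    ∃ C : ℝ, 0 < C ∧ ∀ s r, 0 < s → s ≤ r →
      f r ≤ C * (r / s) ^ q * f s ∧ (r / s) ^ p * f s ≤ C * f r := by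
  have hl1 : ∀ x : ℝ, 0 < x → Tendsto (fun ε => ε * x) (𝓝[>] 0) (𝓝[>] 0) := by
    intro x hx
    refine tendsto_nhdsWithin_iff.2 ⟨?_, ?_⟩
    · have : Tendsto (fun ε : ℝ => ε * x) (𝓝 0) (𝓝 (0 * x)) := tendsto_id.mul_const x
      rw [zero_mul] at this
      exact this.mono_left nhdsWithin_le_nhds
    · filter_upwards [self_mem_nhdsWithin] with ε hε
      exact mul_pos hε hx
  have hl2 : ∀ x : ℝ, 0 < x → Tendsto (fun ε => ε * x) atTop atTop := fun x hx =>
    tendsto_id.atTop_mul_const hx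
  obtain ⟨a1, b1⟩ := eventually_ratio_le_rpow (l := 𝓝[>] 0) self_mem_nhdsWithin hf.pos hmono hl1
    hf.ratioZero_lt_top
  obtain ⟨a2, b2⟩ := eventually_ratio_le_rpow (l := atTop) (eventually_gt_atTop 0) hf.pos hmono hl2
    hf.ratioInfty_lt_top
  have hpos := hf.pos
  -- The upper power bound says that f(r) r^(-q) is almost decreasing. A single ratio y₀ is chosen
  -- that works both near zero and near infinity.
  obtain ⟨C₁, hC₁, h₁⟩ : ∃ C, 0 < C ∧ ∀ s r, 0 < s → s ≤ r →
      f r * r ^ (-q) ≤ C * (f s * s ^ (-q)) := by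
    obtain ⟨y₀, ⟨hy1, hy2⟩, hy₀⟩ :=
      ((b1 q hq1).and (b2 q hq2)).and (eventually_gt_atTop 1) |>.exists
    obtain ⟨ε₁, hε₁, hz⟩ := mem_nhdsGT_iff_exists_Ioo_subset.1 hy1
    obtain ⟨ε₂, hz'⟩ := eventually_atTop.1 hy2
    have hy0 : 0 < y₀ := by linarith
    have hstep : ∀ s, 0 < s → s < ε₁ ∨ ε₂ < s → f (s * y₀) ≤ y₀ ^ q * f s := by
      rintro s hs (h | h)
      · exact hz ⟨hs, h⟩
      · exact hz' s h.le
    refine exists_le_mul_of_zones (g := fun r => f r * r ^ (-q)) (y₀ := y₀) (K := y₀ ^ q)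
      (ε₁ := ε₁) (ε₂ := ε₂) (fun r hr => mul_pos (hpos r hr) (Real.rpow_pos_of_pos hr _)) hy₀ hε₁
      ?_ ?_ ?_
    · intro s hs hsz
      rw [Real.mul_rpow hs.le hy0.le]
      have h3 : y₀ ^ q * y₀ ^ (-q) = 1 := by
        rw [← Real.rpow_add hy0, add_neg_cancel, Real.rpow_zero]
      have h4 : 0 < s ^ (-q) * y₀ ^ (-q) := by positivity
      calc _ ≤ (y₀ ^ q * f s) * (s ^ (-q) * y₀ ^ (-q)) := by gcongr; exact hstep s hs hsz
        _ = f s * s ^ (-q) * (y₀ ^ q * y₀ ^ (-q)) := by ring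
        _ = _ := by rw [h3, mul_one]
    · intro s r hs hsr hr hsz
      have h3 : r ^ (-q) ≤ s ^ (-q) := Real.rpow_le_rpow_of_nonpos hs hsr (by linarith)
      have h4 := hpos s hs
      have hr0 : 0 < r := by linarith
      calc _ ≤ (y₀ ^ q * f s) * s ^ (-q) := by
            have := (hmono r (s * y₀) (by linarith) hr).trans (hstep s hs hsz)
            gcongr
        _ = _ := by ring
    · intro a b ha
      refine ⟨(f b * a ^ (-q)) / (f a * b ^ (-q)), fun s r has hsr hrb => ?_⟩
      have hs0 : 0 < s := by linarith
      have hb0 : 0 < b := by linarith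
      have e1 := hpos a ha
      have e2 := hpos b hb0
      have e3 := hpos s hs0
      rw [div_mul_eq_mul_div, le_div_iff₀ (by positivity)]
      have i1 : f r ≤ f b := hmono r b (by linarith) hrb
      have i2 : r ^ (-q) ≤ a ^ (-q) := Real.rpow_le_rpow_of_nonpos ha (by linarith) (by linarith)
      have i3 : f a ≤ f s := hmono a s ha has
      have i4 : b ^ (-q) ≤ s ^ (-q) := Real.rpow_le_rpow_of_nonpos hs0 (by linarith) (by linarith)
      have hr0 : 0 < r := by linarith
      gcongr
  -- Dually, the lower power bound says that r^p / f(r) is almost decreasing. The index concerns x →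
  -- 0, so the ratio here is y₀ = 1/x₀.
  obtain ⟨C₂, hC₂, h₂⟩ : ∃ C, 0 < C ∧ ∀ s r, 0 < s → s ≤ r →
      r ^ p / f r ≤ C * (s ^ p / f s) := by
    obtain ⟨x₀, ⟨hy1, hy2⟩, hx0, hx1⟩ :=
      ((a1 p hp1).and (a2 p hp2)).and (Ioo_mem_nhdsGT (zero_lt_one' ℝ)) |>.exists
    obtain ⟨ε₁, hε₁, hz⟩ := mem_nhdsGT_iff_exists_Ioo_subset.1 hy1
    obtain ⟨ε₂, hz'⟩ := eventually_atTop.1 hy2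
    set y₀ := x₀⁻¹ with hy
    have hy₀ : 1 < y₀ := (one_lt_inv₀ hx0).2 hx1
    have hy0 : 0 < y₀ := by linarith
    -- The ratio bound is applied at the point s y₀, which must itself stay below ε₁. This is why
    -- the zone shrinks to ε₁ / y₀.
    have hstep : ∀ s, 0 < s → s < ε₁ / y₀ ∨ ε₂ < s → y₀ ^ p * f s ≤ f (s * y₀) := by
      intro s hs h
      have h3 : f (s * y₀ * x₀) ≤ x₀ ^ p * f (s * y₀) := by
        rcases h with h | h
        · exact hz ⟨by positivity, (lt_div_iff₀ hy0).1 h⟩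
        · exact hz' _ (by nlinarith)
      have h4 : s * y₀ * x₀ = s := by rw [hy]; field_simp
      rw [h4] at h3
      rw [hy, Real.inv_rpow hx0.le, inv_mul_le_iff₀ (by positivity)]
      exact h3
    refine exists_le_mul_of_zones (g := fun r => r ^ p / f r) (y₀ := y₀) (K := y₀ ^ p)
      (ε₁ := ε₁ / y₀) (ε₂ := ε₂) (fun r hr => div_pos (Real.rpow_pos_of_pos hr _) (hpos r hr)) hy₀
      (div_pos hε₁ hy0) ?_ ?_ ?_
    · intro s hs hsz
      have e1 := hpos s hs
      have e2 := hpos (s * y₀) (by positivity)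
      rw [Real.mul_rpow hs.le hy0.le, div_le_div_iff₀ e2 e1]
      calc _ = s ^ p * (y₀ ^ p * f s) := by ring
        _ ≤ _ := by gcongr; exact hstep s hs hsz
    · intro s r hs hsr hr _
      have e1 := hpos s hs
      rw [← mul_div_assoc, ← Real.mul_rpow hy0.le hs.le, mul_comm y₀]
      have hr0 : 0 < r := by linarith
      have := hmono s r hs hsr
      gcongr
    · intro a b ha
      refine ⟨(b ^ p / f a) / (a ^ p / f b), fun s r has hsr hrb => ?_⟩
      have hs0 : 0 < s := by linarith
      have hb0 : 0 < b := by linarith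
      have hr0 : 0 < r := by linarith
      have e1 := hpos a ha
      have e2 := hpos b hb0
      have e3 := hpos s hs0
      rw [div_mul_eq_mul_div, le_div_iff₀ (by positivity)]
      have i1 : f a ≤ f r := hmono a r ha (by linarith)
      have i2 : f s ≤ f b := hmono s b hs0 (by linarith)
      gcongr
  refine ⟨max C₁ C₂, by positivity, fun s r hs hsr => ⟨?_, ?_⟩⟩
  · have hr : 0 < r := by linarith
    have e3 := hpos s hs
    have := h₁ s r hs hsr
    rw [Real.rpow_neg hr.le, Real.rpow_neg hs.le, ← div_eq_mul_inv, div_le_iff₀ (by positivity)] at this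
    refine this.trans ?_
    rw [Real.div_rpow hr.le hs.le]
    calc _ = C₁ * (r ^ q / s ^ q) * f s := by field_simp
      _ ≤ _ := by gcongr; exact le_max_left _ _
  · have hr : 0 < r := by linarith
    have e3 := hpos s hs
    have e4 := hpos r hr
    have := h₂ s r hs hsr
    rw [div_le_iff₀ e4] at this
    rw [Real.div_rpow hr.le hs.le, div_mul_eq_mul_div, div_le_iff₀ (by positivity)]
    calc _ ≤ (C₂ * (s ^ p / f s) * f r) * f s := by gcongr
      _ = C₂ * f r * s ^ p := by field_simp
      _ ≤ _ := by gcongr; exact le_max_right _ _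

end LevyKernel

end

noncomputable section

namespace LevyKernel

/-! ### Moments from tail bounds -/

section Moments

variable {E : Type*} [NormedAddCommGroup E] [MeasurableSpace E] [BorelSpace E]
  {μ : Measure E} {C p q α : ℝ}

lemma lintegral_Ioc_rpow {s : ℝ} (hs : -1 < s) :
    ∫⁻ t in Ioc (0 : ℝ) 1, ENNReal.ofReal (t ^ s) = ENNReal.ofReal (1 / (s + 1)) := by
  have hi : IntegrableOn (fun t : ℝ => t ^ s) (Ioc 0 1) :=
    (intervalIntegrable_iff_integrableOn_Ioc_of_le zero_le_one).1
      (intervalIntegral.intervalIntegrable_rpow' hs)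
  rw [← ofReal_integral_eq_lintegral_ofReal hi, ← intervalIntegral.integral_of_le zero_le_one,
    integral_rpow (Or.inl hs), Real.one_rpow, Real.zero_rpow (by linarith), sub_zero]
  filter_upwards [ae_restrict_mem measurableSet_Ioc] with t ht
  exact Real.rpow_nonneg ht.1.le _

lemma lintegral_Ioi_one_rpow {s : ℝ} (hs : s < -1) :
    ∫⁻ t in Ioi (1 : ℝ), ENNReal.ofReal (t ^ s) = ENNReal.ofReal (-1 / (s + 1)) := by
  rw [← ofReal_integral_eq_lintegral_ofReal (integrableOn_Ioi_rpow_of_lt hs one_pos),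
    integral_Ioi_rpow_of_lt hs one_pos, Real.one_rpow]
  filter_upwards [ae_restrict_mem measurableSet_Ioi] with t ht
  exact Real.rpow_nonneg (zero_le_one.trans (le_of_lt ht)) _

/-- Layer-cake formula: levels above 1 are empty on the ball, and below 1 the integrand is at most a
multiple of t^(α - 1 - q). -/
lemma lintegral_closedBall_rpow_le (hC : 0 ≤ C) (hα : 0 < α) (hqα : q < α)
    (hT : ∀ s, 0 < s → s ≤ 1 → μ {y | s < ‖y‖} ≤ ENNReal.ofReal (C * s ^ (-q))) :
    ∫⁻ y in Metric.closedBall 0 1, ENNReal.ofReal (‖y‖ ^ α) ∂μ ≤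
      ENNReal.ofReal (α * (C / (α - q))) := by
  rw [lintegral_rpow_eq_lintegral_meas_lt_mul _ (ae_of_all _ fun y => norm_nonneg y)
    (by fun_prop) hα, ENNReal.ofReal_mul hα.le]
  gcongr
  have hsplit : Ioi (0 : ℝ) = Ioc 0 1 ∪ Ioi 1 := (Ioc_union_Ioi_eq_Ioi zero_le_one).symm
  rw [hsplit]
  refine (lintegral_union_le _ _ _).trans ?_
  have h2 : ∫⁻ t in Ioi (1 : ℝ), (μ.restrict (Metric.closedBall 0 1)) {a | t < ‖a‖} *
      ENNReal.ofReal (t ^ (α - 1)) = 0 := by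
    rw [setLIntegral_congr_fun (g := fun _ => 0) measurableSet_Ioi]
    · simp
    intro t ht
    have : (μ.restrict (Metric.closedBall 0 1)) {a : E | t < ‖a‖} = 0 := by
      rw [Measure.restrict_apply (measurableSet_lt measurable_const measurable_norm)]
      convert measure_empty (μ := μ)
      ext y
      simp only [mem_inter_iff, mem_ofPred_eq, Metric.mem_closedBall, dist_zero_right,
        mem_empty_iff_false, iff_false, not_and, not_le]
      intro h; exact lt_trans ht h
    simp [this]
  rw [h2, add_zero]
  calc _ ≤ ∫⁻ t in Ioc (0 : ℝ) 1, ENNReal.ofReal C * ENNReal.ofReal (t ^ (α - 1 - q)) := by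
        refine setLIntegral_mono' measurableSet_Ioc fun t ht => ?_
        refine (mul_le_mul_left ((Measure.restrict_apply_le _ _).trans (hT t ht.1 ht.2)) _).trans ?_
        have ht0 := ht.1
        rw [← ENNReal.ofReal_mul (by positivity), ← ENNReal.ofReal_mul hC, mul_assoc,
          ← Real.rpow_add ht.1]
        apply le_of_eq; congr 3; ring
    _ = _ := by
        rw [lintegral_const_mul' _ _ ENNReal.ofReal_ne_top, lintegral_Ioc_rpow (by linarith),
          ← ENNReal.ofReal_mul hC]
        congr 1; rw [show α - 1 - q + 1 = α - q by ring]; ring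

/-- Layer-cake formula again. Levels below 1 see a mass at most 1 and contribute at most 1. Levels
above 1 use the tail bound, which is integrable because α < p. -/
lemma lintegral_one_lt_rpow_le (hC : 0 ≤ C) (hα : 0 < α) (hαp : α < p)
    (h1 : μ {y | 1 < ‖y‖} ≤ 1)
    (hT : ∀ s, 1 ≤ s → μ {y | s < ‖y‖} ≤ ENNReal.ofReal (C * s ^ (-p))) :
    ∫⁻ y in {y | 1 < ‖y‖}, ENNReal.ofReal (‖y‖ ^ α) ∂μ ≤
      ENNReal.ofReal (1 + α * (C / (p - α))) := by
  have hms : MeasurableSet {y : E | 1 < ‖y‖} := measurableSet_lt measurable_const measurable_norm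
  rw [lintegral_rpow_eq_lintegral_meas_lt_mul _ (ae_of_all _ fun y => norm_nonneg y)
    (by fun_prop) hα]
  have hsplit : Ioi (0 : ℝ) = Ioc 0 1 ∪ Ioi 1 := (Ioc_union_Ioi_eq_Ioi zero_le_one).symm
  have hpα : 0 < p - α := by linarith
  rw [hsplit, ENNReal.ofReal_add zero_le_one (by positivity)]
  refine (mul_le_mul_right (lintegral_union_le _ _ _) _).trans ?_
  rw [mul_add]
  refine add_le_add ?_ ?_
  · calc _ ≤ ENNReal.ofReal α * ∫⁻ t in Ioc (0 : ℝ) 1, ENNReal.ofReal (t ^ (α - 1)) := by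
          gcongr with t
          refine mul_le_of_le_one_left' ?_
          refine le_trans (measure_mono (subset_univ _)) ?_
          rwa [Measure.restrict_apply_univ]
      _ = _ := by
          rw [lintegral_Ioc_rpow (by linarith), ← ENNReal.ofReal_mul hα.le]
          congr 1; rw [sub_add_cancel, mul_one_div_cancel hα.ne']
  · calc _ ≤ ENNReal.ofReal α * ∫⁻ t in Ioi (1 : ℝ),
            ENNReal.ofReal C * ENNReal.ofReal (t ^ (α - 1 - p)) := by
          refine mul_le_mul_right (setLIntegral_mono' measurableSet_Ioi fun t ht => ?_) _
          have ht0 : 0 < t := lt_trans one_pos ht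
          refine (mul_le_mul_left ((Measure.restrict_apply_le _ _).trans
            (hT t (le_of_lt ht))) _).trans ?_
          rw [← ENNReal.ofReal_mul (by positivity), ← ENNReal.ofReal_mul hC, mul_assoc,
            ← Real.rpow_add ht0]
          apply le_of_eq; congr 3; ring
      _ = _ := by
          rw [lintegral_const_mul' _ _ ENNReal.ofReal_ne_top, lintegral_Ioi_one_rpow (by linarith),
            ← ENNReal.ofReal_mul hC, ← ENNReal.ofReal_mul hα.le]
          congr 1
          rw [show α - 1 - p + 1 = -(p - α) by ring, neg_div_neg_eq]; ring

end Moments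

/-! ### Rescaled measures -/

variable {d : ℕ} {ν : Measure (EuclideanSpace ℝ (Fin d))} {σ : ℝ}

lemma measurableSet_lt_norm (s : ℝ) : MeasurableSet {y : EuclideanSpace ℝ (Fin d) | s < ‖y‖} :=
  measurableSet_lt measurable_const measurable_norm

/-- Positivity of w excludes both zero and infinite tails: `Measure.real` sends infinite mass to 0,
and the inverse of 0 is 0. -/
lemma measure_lt_norm (hpos : ∀ r, 0 < r → 0 < w ν r) {r : ℝ} (hr : 0 < r) :
    ν {y | r < ‖y‖} = ENNReal.ofReal (w ν r)⁻¹ := by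
  have h : 0 < ν.real {y | r < ‖y‖} := by have := hpos r hr; rwa [w, inv_pos] at this
  have hfin : ν {y | r < ‖y‖} ≠ ∞ := by
    intro h'
    simp [measureReal_def, h'] at h
  rw [w, inv_inv, measureReal_def, ENNReal.ofReal_toReal hfin]

lemma w_mono (hpos : ∀ r, 0 < r → 0 < w ν r) (s r : ℝ) (hs : 0 < s) (hsr : s ≤ r) :
    w ν s ≤ w ν r := by
  have hr : 0 < r := by linarith
  have h : ν {y | r < ‖y‖} ≤ ν {y | s < ‖y‖} := measure_mono fun y hy => lt_of_le_of_lt hsr hy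
  rw [measure_lt_norm hpos hs, measure_lt_norm hpos hr] at h
  have := (ENNReal.ofReal_le_ofReal_iff (by have := hpos s hs; positivity)).1 h
  exact (inv_le_inv₀ (hpos r hr) (hpos s hs)).1 this

lemma lintegral_rescale {a : ℝ} (f : EuclideanSpace ℝ (Fin d) → ℝ≥0∞) (hf : Measurable f) :
    ∫⁻ y, f y ∂(rescale ν a) = ENNReal.ofReal (w ν a) * ∫⁻ y, f (a⁻¹ • y) ∂ν := by
  rw [rescale, lintegral_smul_measure, lintegral_map hf (by fun_prop), smul_eq_mul]

lemma rescale_lt_norm (hpos : ∀ r, 0 < r → 0 < w ν r) {a s : ℝ} (ha : 0 < a) (hs : 0 < s) :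
    rescale ν a {y | s < ‖y‖} = ENNReal.ofReal (w ν a / w ν (a * s)) := by
  rw [rescale, Measure.smul_apply, Measure.map_apply (by fun_prop) (measurableSet_lt_norm s)]
  have : (fun y : EuclideanSpace ℝ (Fin d) => a⁻¹ • y) ⁻¹' {y | s < ‖y‖} =
      {y | a * s < ‖y‖} := by
    ext y
    simp only [mem_preimage, mem_ofPred_eq, norm_smul, norm_inv, Real.norm_of_nonneg ha.le]
    rw [lt_inv_mul_iff₀ ha]
  rw [this, measure_lt_norm hpos (by positivity), smul_eq_mul,
    ← ENNReal.ofReal_mul (hpos a ha).le, div_eq_mul_inv]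

lemma measurable_truncation (σ : ℝ) :
    Measurable (truncation σ : EuclideanSpace ℝ (Fin d) → ℝ) := by
  unfold truncation
  refine Measurable.ite (MeasurableSet.const _) measurable_const
    (Measurable.ite (MeasurableSet.const _) ?_ measurable_const)
  exact Measurable.ite (measurableSet_le measurable_norm measurable_const) measurable_const
    measurable_const

lemma truncation_neg (σ : ℝ) (y : EuclideanSpace ℝ (Fin d)) :
    truncation σ (-y) = truncation σ y := by
  simp [truncation]

/-- The integrand of the Lévy symbol. -/
def symbolIntegrand {d : ℕ} (σ : ℝ) (ξ y : EuclideanSpace ℝ (Fin d)) : ℂ :=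
  phase ⟪ξ, y⟫ - 1 - 2 * Real.pi * Complex.I * (truncation σ y : ℝ) * (⟪ξ, y⟫ : ℝ)

lemma symbol_eq (ξ : EuclideanSpace ℝ (Fin d)) : symbol σ ν ξ = ∫ y, symbolIntegrand σ ξ y ∂ν := rfl

lemma measurable_symbolIntegrand (ξ : EuclideanSpace ℝ (Fin d)) :
    Measurable (symbolIntegrand σ ξ) := by
  unfold symbolIntegrand
  have h1 := measurable_truncation (d := d) σ
  have h2 : Measurable fun y : EuclideanSpace ℝ (Fin d) => phase ⟪ξ, y⟫ :=
    (by fun_prop : Continuous _).measurable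
  have h3 : Measurable fun y : EuclideanSpace ℝ (Fin d) => (⟪ξ, y⟫ : ℝ) :=
    (by fun_prop : Continuous _).measurable
  exact (h2.sub_const 1).sub (((Complex.measurable_ofReal.comp h1).const_mul _).mul
    (Complex.measurable_ofReal.comp h3))

lemma integral_rescale {F : Type*} [NormedAddCommGroup F] [NormedSpace ℝ F] {a : ℝ}
    (hw : 0 ≤ w ν a) {f : EuclideanSpace ℝ (Fin d) → F}
    (hf : StronglyMeasurable f) :
    ∫ y, f y ∂(rescale ν a) = w ν a • ∫ y, f (a⁻¹ • y) ∂ν := by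
  rw [rescale, integral_smul_measure, integral_map (by fun_prop) hf.aestronglyMeasurable,
    ENNReal.toReal_ofReal hw]

lemma integrable_rescale_iff {F : Type*} [NormedAddCommGroup F] {a : ℝ}
    (hw : 0 < w ν a) {f : EuclideanSpace ℝ (Fin d) → F} (hf : StronglyMeasurable f) :
    Integrable f (rescale ν a) ↔ Integrable (fun y => f (a⁻¹ • y)) ν := by
  rw [rescale, integrable_smul_measure (by simpa using hw) ENNReal.ofReal_ne_top,
    integrable_map_measure hf.aestronglyMeasurable (by fun_prop)]
  rfl

end LevyKernel

end

/-! ### Small jumps, large jumps and drift of rescaled measures -/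

noncomputable section

namespace LevyKernel

section Decomposition

variable {d : ℕ} {ν : Measure (EuclideanSpace ℝ (Fin d))} {σ : ℝ}

/-- The closed unit ball. -/
local notation "𝔹" => (Metric.closedBall (0 : EuclideanSpace ℝ (Fin d)) 1)

lemma compl_closedBall_one : 𝔹ᶜ = {y | 1 < ‖y‖} := by
  ext y; simp

/-- On the ball the truncation χ is completed to full compensation, and outside it the compensation
is removed. Both corrections are linear in ζ and combine into a drift. The constant -1 in the
exponent is minus the unit mass of the large jumps. -/
lemma integral_levy_decomposition {μ : Measure (EuclideanSpace ℝ (Fin d))}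
    {χ : EuclideanSpace ℝ (Fin d) → ℝ}
    (h2 : Integrable (fun y => ‖y‖ ^ 2) (μ.restrict 𝔹))
    (hρ : IsProbabilityMeasure (μ.restrict {y | 1 < ‖y‖}))
    (hs : Integrable (fun z => (1 - χ z) • z) (μ.restrict 𝔹))
    (hl : Integrable (fun z => χ z • z) (μ.restrict {y | 1 < ‖y‖}))
    (ζ : EuclideanSpace ℝ (Fin d)) :
    Integrable (fun z => phase ⟪ζ, z⟫ - 1 - 2 * Real.pi * Complex.I * (χ z : ℝ) * (⟪ζ, z⟫ : ℝ)) μ ∧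
    ∫ z, (phase ⟪ζ, z⟫ - 1 - 2 * Real.pi * Complex.I * (χ z : ℝ) * (⟪ζ, z⟫ : ℝ)) ∂μ =
      levyExponent (μ.restrict 𝔹) (μ.restrict {y | 1 < ‖y‖})
        ((∫ z, (1 - χ z) • z ∂(μ.restrict 𝔹)) - ∫ z, χ z • z ∂(μ.restrict {y | 1 < ‖y‖})) ζ := by
  set G : EuclideanSpace ℝ (Fin d) → ℂ := fun z =>
    phase ⟪ζ, z⟫ - 1 - 2 * Real.pi * Complex.I * (χ z : ℝ) * (⟪ζ, z⟫ : ℝ) with hG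
  have hphase : Continuous fun z : EuclideanSpace ℝ (Fin d) => phase ⟪ζ, z⟫ := by fun_prop
  have i1 : Integrable (fun z => phase ⟪ζ, z⟫ - 1 - 2 * Real.pi * Complex.I * (⟪ζ, z⟫ : ℝ))
      (μ.restrict 𝔹) :=
    (h2.const_mul (4 * Real.pi ^ 2 * ‖ζ‖ ^ 2)).mono'
      (Continuous.aestronglyMeasurable (by fun_prop)) (ae_of_all _ fun z => norm_compensated_le ζ z)
  have i2 : Integrable (fun z => 2 * Real.pi * Complex.I * ((⟪ζ, (1 - χ z) • z⟫ : ℝ) : ℂ))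
      (μ.restrict 𝔹) := ((hs.const_inner ζ).ofReal).const_mul _
  have i3 : Integrable (fun z => phase ⟪ζ, z⟫ - 1) (μ.restrict {y | 1 < ‖y‖}) :=
    (integrable_const (2 : ℝ)).mono' (hphase.sub continuous_const).aestronglyMeasurable
      (ae_of_all _ fun z => norm_phase_sub_one_le_two _)
  have i4 : Integrable (fun z => 2 * Real.pi * Complex.I * ((⟪ζ, χ z • z⟫ : ℝ) : ℂ))
      (μ.restrict {y | 1 < ‖y‖}) := ((hl.const_inner ζ).ofReal).const_mul _
  have e1 : G = fun z => (phase ⟪ζ, z⟫ - 1 - 2 * Real.pi * Complex.I * (⟪ζ, z⟫ : ℝ)) +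
      2 * Real.pi * Complex.I * ((⟪ζ, (1 - χ z) • z⟫ : ℝ) : ℂ) := by
    ext z; simp only [hG, real_inner_smul_right]; push_cast; ring
  have e2 : G = fun z => (phase ⟪ζ, z⟫ - 1) -
      2 * Real.pi * Complex.I * ((⟪ζ, χ z • z⟫ : ℝ) : ℂ) := by
    ext z; simp only [hG, real_inner_smul_right]; push_cast; ring
  have g1 : IntegrableOn G 𝔹 μ := by rw [IntegrableOn, e1]; exact i1.add i2
  have g2 : IntegrableOn G 𝔹ᶜ μ := by
    rw [compl_closedBall_one, IntegrableOn, e2]; exact i3.sub i4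
  have hGi : Integrable G μ := by
    rw [← integrableOn_univ, ← union_compl_self 𝔹]; exact g1.union g2
  refine ⟨hGi, ?_⟩
  rw [← integral_add_compl (Metric.isClosed_closedBall.measurableSet : MeasurableSet 𝔹) hGi,
    compl_closedBall_one]
  have r1 : ∫ z in 𝔹, G z ∂μ = smallSymbol (μ.restrict 𝔹) ζ + 2 * Real.pi * Complex.I *
      ((⟪ζ, ∫ z, (1 - χ z) • z ∂(μ.restrict 𝔹)⟫ : ℝ) : ℂ) := by
    rw [e1, integral_add i1 i2, smallSymbol, integral_const_mul, integral_complex_ofReal,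
      integral_inner hs]
  have r2 : ∫ z in {y | 1 < ‖y‖}, G z ∂μ = charF (μ.restrict {y | 1 < ‖y‖}) ζ - 1 -
      2 * Real.pi * Complex.I * ((⟪ζ, ∫ z, χ z • z ∂(μ.restrict {y | 1 < ‖y‖})⟫ : ℝ) : ℂ) := by
    have i5 : Integrable (fun z => phase ⟪ζ, z⟫) (μ.restrict {y | 1 < ‖y‖}) :=
      (integrable_const (1 : ℝ)).mono' hphase.aestronglyMeasurable (ae_of_all _ fun z => by simp)
    rw [e2, integral_sub i3 i4, integral_sub i5 (integrable_const _), charF, integral_const_mul,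
      integral_complex_ofReal, integral_inner hl, integral_const]
    simp
  rw [r1, r2, levyExponent, inner_sub_right]
  push_cast; ring

lemma symbolIntegrand_smul (a : ℝ) (ξ z : EuclideanSpace ℝ (Fin d)) :
    symbolIntegrand σ ξ (a • z) = phase ⟪a • ξ, z⟫ - 1 -
      2 * Real.pi * Complex.I * (truncation σ (a • z) : ℝ) * (⟪a • ξ, z⟫ : ℝ) := by
  rw [symbolIntegrand, real_inner_smul_left, real_inner_smul_right]

/-- Bounds for the jumps of a rescaled measure, uniform in the scale. -/
lemma rescale_moments (hpos : ∀ r, 0 < r → 0 < w ν r) {p q C : ℝ} (hC : 0 < C)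
    (hS : ∀ s r, 0 < s → s ≤ r → w ν r ≤ C * (r / s) ^ q * w ν s ∧
      (r / s) ^ p * w ν s ≤ C * w ν r) {a : ℝ} (ha : 0 < a) :
    IsProbabilityMeasure ((rescale ν a).restrict {y | 1 < ‖y‖}) ∧
    (∀ α, 0 < α → q < α → ∫⁻ y in 𝔹, ENNReal.ofReal (‖y‖ ^ α) ∂(rescale ν a) ≤
      ENNReal.ofReal (α * (C / (α - q)))) ∧
    (∀ α, 0 < α → α < p → ∫⁻ y in {y | 1 < ‖y‖}, ENNReal.ofReal (‖y‖ ^ α) ∂(rescale ν a) ≤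
      ENNReal.ofReal (1 + α * (C / (p - α)))) := by
  have hwa := hpos a ha
  have hone : rescale ν a {y | 1 < ‖y‖} = 1 := by
    rw [rescale_lt_norm hpos ha one_pos, mul_one, div_self hwa.ne', ENNReal.ofReal_one]
  refine ⟨⟨by rw [Measure.restrict_apply_univ, hone]⟩, fun α hα hqα => ?_, fun α hα hαp => ?_⟩
  · refine lintegral_closedBall_rpow_le hC.le hα hqα fun s hs hs1 => ?_
    rw [rescale_lt_norm hpos ha hs]
    refine ENNReal.ofReal_le_ofReal ?_
    have h3 := hpos (a * s) (by positivity)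
    rw [div_le_iff₀ h3]
    have := (hS (a * s) a (by positivity) (by nlinarith)).1
    rwa [show a / (a * s) = s⁻¹ by field_simp, Real.inv_rpow hs.le, ← Real.rpow_neg hs.le] at this
  · refine lintegral_one_lt_rpow_le hC.le hα hαp hone.le fun s hs => ?_
    have hs0 : 0 < s := by linarith
    rw [rescale_lt_norm hpos ha hs0]
    refine ENNReal.ofReal_le_ofReal ?_
    have h3 := hpos (a * s) (by positivity)
    rw [div_le_iff₀ h3, Real.rpow_neg hs0.le]
    have := (hS a (a * s) ha (by nlinarith)).2
    rw [show a * s / a = s by field_simp] at this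
    rw [mul_assoc, mul_left_comm, le_inv_mul_iff₀ (by positivity)]
    exact this

lemma norm_integral_le_of_lintegral {μ : Measure (EuclideanSpace ℝ (Fin d))} {B : ℝ} (hB : 0 ≤ B)
    (h : ∫⁻ y, ENNReal.ofReal (‖y‖ ^ (1 : ℝ)) ∂μ ≤ ENNReal.ofReal B) :
    Integrable (fun y => y) μ ∧ ‖∫ y, y ∂μ‖ ≤ B := by
  simp only [Real.rpow_one, ofReal_norm] at h
  refine ⟨⟨by fun_prop, h.trans_lt ENNReal.ofReal_lt_top⟩, ?_⟩
  have := (enorm_integral_le_lintegral_enorm (fun y : EuclideanSpace ℝ (Fin d) => y)).trans h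
  rw [← ofReal_norm] at this
  exact (ENNReal.ofReal_le_ofReal_iff hB).1 this

/-- The drift of a rescaled measure is bounded uniformly in the scale. -/
lemma rescale_drift (hpos : ∀ r, 0 < r → 0 < w ν r)
    (hann : σ = 1 → ∀ R R' : ℝ, 0 < R → R < R' →
      ∫ y in {y | R < ‖y‖ ∧ ‖y‖ ≤ R'}, y ∂ν = 0) {p q C : ℝ} (hC : 0 < C)
    (hS : ∀ s r, 0 < s → s ≤ r → w ν r ≤ C * (r / s) ^ q * w ν s ∧
      (r / s) ^ p * w ν s ≤ C * w ν r) (hq : q < 2) (hσq : σ < 1 → q < 1) (hσp : 1 < σ → 1 < p)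
    {a B : ℝ} (ha : 0 < a) (hB0 : 0 ≤ B) (hB1 : σ < 1 → C / (1 - q) ≤ B)
    (hB2 : 1 < σ → 1 + C / (p - 1) ≤ B) :
    Integrable (fun z => (1 - truncation σ (a • z)) • z) ((rescale ν a).restrict 𝔹) ∧
    Integrable (fun z => truncation σ (a • z) • z) ((rescale ν a).restrict {y | 1 < ‖y‖}) ∧
    ‖(∫ z, (1 - truncation σ (a • z)) • z ∂((rescale ν a).restrict 𝔹)) -
      ∫ z, truncation σ (a • z) • z ∂((rescale ν a).restrict {y | 1 < ‖y‖})‖ ≤ B := by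
  obtain ⟨hρ, hsm, hlg⟩ := rescale_moments hpos hC hS ha
  have hwa := hpos a ha
  have hmt : Measurable fun z : EuclideanSpace ℝ (Fin d) => truncation σ (a • z) :=
    (measurable_truncation σ).comp (by fun_prop)
  rcases lt_trichotomy σ 1 with hσ | hσ | hσ
  -- Without compensation the drift is the first moment of the small jumps, finite because q < 1.
  · have ht : ∀ z : EuclideanSpace ℝ (Fin d), truncation σ z = 0 := fun z => by simp [truncation, hσ]
    simp only [ht, sub_zero, one_smul, zero_smul, integral_zero]
    have h1 := hsm 1 one_pos (hσq hσ)
    rw [one_mul] at h1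
    obtain ⟨i1, i2⟩ := norm_integral_le_of_lintegral hB0 (h1.trans (ENNReal.ofReal_le_ofReal (hB1 hσ)))
    exact ⟨i1, integrable_zero _ _ _, i2⟩
  · have ht : ∀ z : EuclideanSpace ℝ (Fin d), truncation σ z = if ‖z‖ ≤ 1 then 1 else 0 := fun z => by
      simp [truncation, hσ]
    have hna : ∀ z : EuclideanSpace ℝ (Fin d), ‖a • z‖ = a * ‖z‖ := fun z => by
      rw [norm_smul, Real.norm_of_nonneg ha.le]
    have h2 : Integrable (fun z => ‖z‖ ^ 2) ((rescale ν a).restrict 𝔹) := by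
      refine ⟨by fun_prop, ?_⟩
      have := hsm 2 two_pos hq
      simp only [Real.rpow_two] at this
      refine lt_of_le_of_lt (le_of_eq ?_) (this.trans_lt ENNReal.ofReal_lt_top)
      refine lintegral_congr fun z => ?_
      rw [Real.enorm_of_nonneg (by positivity)]
    have i1 : Integrable (fun z => (1 - truncation σ (a • z)) • z) ((rescale ν a).restrict 𝔹) := by
      refine (h2.const_mul a).mono' ((hmt.const_sub 1).smul measurable_id).aestronglyMeasurable
        (ae_of_all _ fun z => ?_)
      rw [ht, hna]
      split_ifs with h
      · simp; positivity
      · simp only [sub_zero, one_smul]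
        push Not at h
        nlinarith [norm_nonneg z]
    have i2 : Integrable (fun z => truncation σ (a • z) • z)
        ((rescale ν a).restrict {y | 1 < ‖y‖}) := by
      refine (integrable_const a⁻¹).mono' (hmt.smul measurable_id).aestronglyMeasurable
        (ae_of_all _ fun z => ?_)
      rw [ht, hna]
      split_ifs with h
      · rw [one_smul, ← one_div, le_div_iff₀' ha]
        exact h
      · simp; positivity
    refine ⟨i1, i2, ?_⟩
    -- The annulus condition is invariant under dilation, so the rescaled measure inherits it.
    have hannμ : ∀ R R' : ℝ, 0 < R → R < R' →
        ∫ z in {y | R < ‖y‖ ∧ ‖y‖ ≤ R'}, z ∂(rescale ν a) = 0 := by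
      intro R R' hR hR'
      have hms : MeasurableSet {y : EuclideanSpace ℝ (Fin d) | R < ‖y‖ ∧ ‖y‖ ≤ R'} :=
        (measurableSet_lt measurable_const measurable_norm).inter
          (measurableSet_le measurable_norm measurable_const)
      have hms' : MeasurableSet {y : EuclideanSpace ℝ (Fin d) | a * R < ‖y‖ ∧ ‖y‖ ≤ a * R'} :=
        (measurableSet_lt measurable_const measurable_norm).inter
          (measurableSet_le measurable_norm measurable_const)
      have hsi : StronglyMeasurable
          ({y : EuclideanSpace ℝ (Fin d) | R < ‖y‖ ∧ ‖y‖ ≤ R'}.indicator fun z => z) :=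
        (measurable_id'.indicator hms).stronglyMeasurable
      rw [← integral_indicator hms, integral_rescale hwa.le hsi]
      have : (fun y : EuclideanSpace ℝ (Fin d) =>
          {y | R < ‖y‖ ∧ ‖y‖ ≤ R'}.indicator (fun z => z) (a⁻¹ • y)) =
          fun y => a⁻¹ • {y | a * R < ‖y‖ ∧ ‖y‖ ≤ a * R'}.indicator (fun z => z) y := by
        ext1 y
        have hn : ‖a⁻¹ • y‖ = a⁻¹ * ‖y‖ := by
          rw [norm_smul, norm_inv, Real.norm_of_nonneg ha.le]
        have hiff : (a⁻¹ • y ∈ {y : EuclideanSpace ℝ (Fin d) | R < ‖y‖ ∧ ‖y‖ ≤ R'}) ↔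
            y ∈ {y : EuclideanSpace ℝ (Fin d) | a * R < ‖y‖ ∧ ‖y‖ ≤ a * R'} := by
          simp only [mem_ofPred_eq, hn, lt_inv_mul_iff₀ ha, inv_mul_le_iff₀ ha]
        by_cases hy : y ∈ {y : EuclideanSpace ℝ (Fin d) | a * R < ‖y‖ ∧ ‖y‖ ≤ a * R'}
        · rw [indicator_of_mem (hiff.2 hy), indicator_of_mem hy]
        · rw [indicator_of_notMem (fun h => hy (hiff.1 h)), indicator_of_notMem hy, smul_zero]
      rw [this, integral_smul, integral_indicator hms',
        hann hσ _ _ (by positivity) (by gcongr), smul_zero, smul_zero]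
    -- For σ = 1 the truncation radius becomes 1/a after rescaling. Each correction is then an
    -- integral of z over an annulus with radii 1/a and 1, possibly empty. Both vanish and no drift
    -- is left.
    have z1 : ∫ z, (1 - truncation σ (a • z)) • z ∂((rescale ν a).restrict 𝔹) = 0 := by
      have e : (fun z : EuclideanSpace ℝ (Fin d) => (1 - truncation σ (a • z)) • z) =
          {y | a⁻¹ < ‖y‖}.indicator fun z => z := by
        ext1 z
        rw [ht, hna]
        by_cases h : a * ‖z‖ ≤ 1
        · rw [if_pos h, sub_self, zero_smul, indicator_of_notMem]
          simp only [mem_ofPred_eq, not_lt]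
          rwa [← one_div, le_div_iff₀' ha]
        · rw [if_neg h, sub_zero, one_smul, indicator_of_mem]
          simp only [mem_ofPred_eq]
          rw [← one_div, div_lt_iff₀' ha]
          exact not_le.1 h
      rw [e, integral_indicator (measurableSet_lt_norm _),
        Measure.restrict_restrict (measurableSet_lt_norm _)]
      have e2 : {y : EuclideanSpace ℝ (Fin d) | a⁻¹ < ‖y‖} ∩ 𝔹 = {y | a⁻¹ < ‖y‖ ∧ ‖y‖ ≤ 1} := by
        ext y; simp
      rw [e2]
      rcases lt_or_ge a⁻¹ 1 with h | h
      · exact hannμ _ _ (by positivity) h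
      · have : {y : EuclideanSpace ℝ (Fin d) | a⁻¹ < ‖y‖ ∧ ‖y‖ ≤ 1} = ∅ := by
          ext y; simp only [mem_ofPred_eq, mem_empty_iff_false, iff_false, not_and, not_le]
          intro h'; linarith
        rw [this]; simp
    have z2 : ∫ z, truncation σ (a • z) • z ∂((rescale ν a).restrict {y | 1 < ‖y‖}) = 0 := by
      have hms : MeasurableSet {y : EuclideanSpace ℝ (Fin d) | ‖y‖ ≤ a⁻¹} :=
        measurableSet_le measurable_norm measurable_const
      have e : (fun z : EuclideanSpace ℝ (Fin d) => truncation σ (a • z) • z) =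
          {y | ‖y‖ ≤ a⁻¹}.indicator fun z => z := by
        ext1 z
        rw [ht, hna]
        by_cases h : a * ‖z‖ ≤ 1
        · rw [if_pos h, one_smul, indicator_of_mem]
          simp only [mem_ofPred_eq]
          rwa [← one_div, le_div_iff₀' ha]
        · rw [if_neg h, zero_smul, indicator_of_notMem]
          simp only [mem_ofPred_eq, not_le]
          rw [← one_div, div_lt_iff₀' ha]
          exact not_le.1 h
      rw [e, integral_indicator hms, Measure.restrict_restrict hms]
      have e2 : {y : EuclideanSpace ℝ (Fin d) | ‖y‖ ≤ a⁻¹} ∩ {y | 1 < ‖y‖} =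
          {y | 1 < ‖y‖ ∧ ‖y‖ ≤ a⁻¹} := by
        ext y; simp [and_comm]
      rw [e2]
      rcases lt_or_ge 1 a⁻¹ with h | h
      · exact hannμ _ _ one_pos h
      · have : {y : EuclideanSpace ℝ (Fin d) | 1 < ‖y‖ ∧ ‖y‖ ≤ a⁻¹} = ∅ := by
          ext y; simp only [mem_ofPred_eq, mem_empty_iff_false, iff_false, not_and, not_le]
          intro h'; linarith
        rw [this]; simp
    rw [z1, z2]; simpa using hB0
  -- With full compensation the drift is minus the first moment of the large jumps, finite because p
  -- > 1.
  · have ht : ∀ z : EuclideanSpace ℝ (Fin d), truncation σ z = 1 := fun z => by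
      simp [truncation, hσ.ne', hσ.le.not_gt]
    simp only [ht, sub_self, one_smul, zero_smul, integral_zero, zero_sub, norm_neg]
    have h1 := hlg 1 one_pos (hσp hσ)
    rw [one_mul] at h1
    obtain ⟨i1, i2⟩ := norm_integral_le_of_lintegral hB0 (h1.trans (ENNReal.ofReal_le_ofReal (hB2 hσ)))
    exact ⟨integrable_zero _ _ _, i1, i2⟩

end Decomposition

end LevyKernel

end

noncomputable section

namespace LevyKernel

/-! ### Weights adapted to a scale -/

section ScaleWeight

variable {V : Type*} [NormedAddCommGroup V] [MeasurableSpace V] [BorelSpace V]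

/-- The weight `(1 + ‖x‖ / a) ^ β`. -/
def scaleWeight (β a : ℝ) (x : V) : ℝ≥0∞ := ENNReal.ofReal ((1 + ‖x‖ / a) ^ β)

lemma isWeight_scaleWeight {β a : ℝ} (hβ : 0 ≤ β) (ha : 0 < a) :
    IsWeight (scaleWeight β a : V → ℝ≥0∞) where
  measurable := by unfold scaleWeight; fun_prop
  one_le x := by
    rw [scaleWeight, ENNReal.one_le_ofReal]
    exact Real.one_le_rpow (by have : 0 ≤ ‖x‖ / a := by positivity
                               linarith) hβ
  neg x := by simp [scaleWeight]
  add_le x y := by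
    have hx : 0 ≤ ‖x‖ / a := by positivity
    have hy : 0 ≤ ‖y‖ / a := by positivity
    rw [scaleWeight, scaleWeight, scaleWeight, ← ENNReal.ofReal_mul (by positivity),
      ← Real.mul_rpow (by positivity) (by positivity)]
    refine ENNReal.ofReal_le_ofReal (Real.rpow_le_rpow (by positivity) ?_ hβ)
    have : ‖x + y‖ / a ≤ ‖x‖ / a + ‖y‖ / a := by
      rw [← add_div]; gcongr; exact norm_add_le x y
    nlinarith

end ScaleWeight

/-! ### Coercivity of the small-jump symbol -/

section Nondegenerate

variable {d : ℕ} {ν : Measure (EuclideanSpace ℝ (Fin d))} {σ : ℝ}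

/-- The closed unit ball. -/
local notation "𝔹" => (Metric.closedBall (0 : EuclideanSpace ℝ (Fin d)) 1)

/-- The infimum is an extended real and may be infinite (an infimum over an empty sphere is ∞), so a
finite κ strictly between 0 and it is selected. -/
lemma AssumptionB.exists_le (hB : AssumptionB ν) :
    ∃ κ : ℝ, 0 < κ ∧ ∀ R, 0 < R → ∀ ξ : EuclideanSpace ℝ (Fin d), ‖ξ‖ = 1 →
      ENNReal.ofReal κ ≤ ∫⁻ y in 𝔹, ENNReal.ofReal (⟪ξ, y⟫ ^ 2) ∂(rescale ν R) := by
  obtain ⟨κ, h0, h1⟩ := ENNReal.lt_iff_exists_nnreal_btwn.1 hB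
  refine ⟨κ, by simpa using h0, fun R hR ξ hξ => ?_⟩
  rw [ENNReal.ofReal_coe_nnreal]
  have h2 := h1.le.trans ((iInf_le _ (⟨R, hR⟩ : Ioi (0 : ℝ))).trans
    (iInf_le _ (⟨ξ, by simpa using hξ⟩ : Metric.sphere (0 : EuclideanSpace ℝ (Fin d)) 1)))
  simpa only [sq_abs] using h2

lemma smallSymbol_re {μ : Measure (EuclideanSpace ℝ (Fin d))}
    (h2 : Integrable (fun y => ‖y‖ ^ 2) μ) (ζ : EuclideanSpace ℝ (Fin d)) :
    Integrable (fun y => 1 - Real.cos (2 * Real.pi * ⟪ζ, y⟫)) μ ∧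
    (smallSymbol μ ζ).re = -∫ y, (1 - Real.cos (2 * Real.pi * ⟪ζ, y⟫)) ∂μ := by
  have hi : Integrable
      (fun y => phase ⟪ζ, y⟫ - 1 - 2 * Real.pi * Complex.I * (⟪ζ, y⟫ : ℝ)) μ :=
    (h2.const_mul (4 * Real.pi ^ 2 * ‖ζ‖ ^ 2)).mono'
      (Continuous.aestronglyMeasurable (by fun_prop)) (ae_of_all _ fun z => norm_compensated_le ζ z)
  have hre : ∀ y, (phase ⟪ζ, y⟫ - 1 - 2 * Real.pi * Complex.I * (⟪ζ, y⟫ : ℝ)).re =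
      -(1 - Real.cos (2 * Real.pi * ⟪ζ, y⟫)) := fun y => by
    simp [phase_re]
  have hi2 := hi.re
  simp only [RCLike.re_eq_complex_re, hre] at hi2
  refine ⟨hi2.neg.congr (ae_of_all _ fun y => neg_neg _), ?_⟩
  rw [smallSymbol, ← integral_neg]
  simp only [← hre]
  exact (integral_re hi).symm

lemma smallSymbol_re_nonpos {μ : Measure (EuclideanSpace ℝ (Fin d))}
    (h2 : Integrable (fun y => ‖y‖ ^ 2) μ) (ζ : EuclideanSpace ℝ (Fin d)) :
    (smallSymbol μ ζ).re ≤ 0 := by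
  rw [(smallSymbol_re h2 ζ).2, neg_nonpos]
  exact integral_nonneg fun y => sub_nonneg.2 (Real.cos_le_one _)

lemma eight_mul_sq_le_one_sub_cos {u : ℝ} (hu : |u| ≤ 1 / 2) :
    8 * u ^ 2 ≤ 1 - Real.cos (2 * Real.pi * u) := by
  have h := Real.cos_le_one_sub_mul_cos_sq (x := 2 * Real.pi * u) (by
    rw [abs_mul, abs_of_pos (by positivity : (0 : ℝ) < 2 * Real.pi)]
    nlinarith [Real.pi_pos])
  have : 2 / Real.pi ^ 2 * (2 * Real.pi * u) ^ 2 = 8 * u ^ 2 := by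
    field_simp; ring
  linarith

/-- Nondegeneracy gives a power lower bound for the symbol of the small jumps. -/
lemma smallSymbol_rescale_re_le (hpos : ∀ r, 0 < r → 0 < w ν r) {p C κ : ℝ} (hC : 0 < C)
    (hp : 0 < p) (hS : ∀ s r, 0 < s → s ≤ r → (r / s) ^ p * w ν s ≤ C * w ν r) (hκ : 0 < κ)
    (hB : ∀ R, 0 < R → ∀ ξ : EuclideanSpace ℝ (Fin d), ‖ξ‖ = 1 →
      ENNReal.ofReal κ ≤ ∫⁻ y in 𝔹, ENNReal.ofReal (⟪ξ, y⟫ ^ 2) ∂(rescale ν R))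
    {a : ℝ} (ha : 0 < a)
    (h2 : Integrable (fun y => ‖y‖ ^ 2) ((rescale ν a).restrict 𝔹))
    {ζ : EuclideanSpace ℝ (Fin d)} (hζ : 1 ≤ ‖ζ‖) :
    (smallSymbol ((rescale ν a).restrict 𝔹) ζ).re ≤ -(2 * κ / C) * ‖ζ‖ ^ p := by
  obtain ⟨hi, hre⟩ := smallSymbol_re h2 ζ
  rw [hre, neg_mul, neg_le_neg_iff]
  have hζ0 : 0 < ‖ζ‖ := by linarith
  -- For ‖y‖ ≤ θ one has |⟪ζ, y⟫| ≤ 1/2, the range in which 1 - cos dominates a square.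
  set θ : ℝ := (2 * ‖ζ‖)⁻¹ with hθ
  have hθ0 : 0 < θ := by positivity
  have hθ1 : θ ≤ 1 := inv_le_one_of_one_le₀ (by linarith)
  have hb : 0 < a * θ := by positivity
  have hwa := hpos a ha
  have hwb := hpos _ hb
  have hms : MeasurableSet 𝔹 := Metric.isClosed_closedBall.measurableSet
  have hms' : MeasurableSet (Metric.closedBall (0 : EuclideanSpace ℝ (Fin d)) θ) :=
    Metric.isClosed_closedBall.measurableSet
  have key : ENNReal.ofReal (2 * κ / C * ‖ζ‖ ^ p) ≤
      ENNReal.ofReal (∫ y, (1 - Real.cos (2 * Real.pi * ⟪ζ, y⟫)) ∂((rescale ν a).restrict 𝔹)) := by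
    rw [ofReal_integral_eq_lintegral_ofReal hi
      (ae_of_all _ fun y => sub_nonneg.2 (Real.cos_le_one _))]
    have step : ∫⁻ y in Metric.closedBall 0 θ, ENNReal.ofReal (8 * ⟪ζ, y⟫ ^ 2) ∂(rescale ν a) ≤
        ∫⁻ y in 𝔹, ENNReal.ofReal (1 - Real.cos (2 * Real.pi * ⟪ζ, y⟫)) ∂(rescale ν a) := by
      refine (setLIntegral_mono' hms' fun y hy => ENNReal.ofReal_le_ofReal
        (eight_mul_sq_le_one_sub_cos ?_)).trans
        (lintegral_mono_set (Metric.closedBall_subset_closedBall hθ1))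
      refine (abs_inner_le ζ y).trans ?_
      rw [Metric.mem_closedBall, dist_zero_right] at hy
      calc ‖ζ‖ * ‖y‖ ≤ ‖ζ‖ * θ := by gcongr
        _ = 1 / 2 := by rw [hθ]; field_simp
    refine le_trans ?_ step
    have hξ : ‖‖ζ‖⁻¹ • ζ‖ = 1 := by rw [norm_smul, norm_inv, norm_norm, inv_mul_cancel₀ hζ0.ne']
    have hBb := hB (a * θ) hb _ hξ
    rw [← lintegral_indicator hms, lintegral_rescale _ (Measurable.indicator (by fun_prop) hms)]
      at hBb
    rw [← lintegral_indicator hms', lintegral_rescale _ (Measurable.indicator (by fun_prop) hms')]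
    -- The ball of radius θ at scale a is the unit ball at scale aθ, where Assumption B applies in
    -- the direction ζ/‖ζ‖. The constant 8 becomes 8‖ζ‖²θ² = 2.
    have e : (fun y : EuclideanSpace ℝ (Fin d) => (Metric.closedBall 0 θ).indicator
          (fun y => ENNReal.ofReal (8 * ⟪ζ, y⟫ ^ 2)) (a⁻¹ • y)) =
        fun y => ENNReal.ofReal 2 * Set.indicator 𝔹
          (fun y => ENNReal.ofReal (⟪‖ζ‖⁻¹ • ζ, y⟫ ^ 2)) ((a * θ)⁻¹ • y) := by
      ext1 y
      have hn : ∀ b : ℝ, 0 < b → ‖b⁻¹ • y‖ = b⁻¹ * ‖y‖ := fun b hb => by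
        rw [norm_smul, norm_inv, Real.norm_of_nonneg hb.le]
      have hiff : a⁻¹ • y ∈ Metric.closedBall (0 : EuclideanSpace ℝ (Fin d)) θ ↔
          (a * θ)⁻¹ • y ∈ 𝔹 := by
        rw [Metric.mem_closedBall, Metric.mem_closedBall, dist_zero_right, dist_zero_right, hn a ha,
          hn _ hb, inv_mul_le_iff₀ ha, inv_mul_le_iff₀ hb, mul_one]
      by_cases h : (a * θ)⁻¹ • y ∈ 𝔹
      · rw [indicator_of_mem h, indicator_of_mem (hiff.2 h), ← ENNReal.ofReal_mul two_pos.le]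
        congr 1
        simp only [real_inner_smul_left, real_inner_smul_right, hθ]
        field_simp; ring
      · rw [indicator_of_notMem h, indicator_of_notMem (fun h' => h (hiff.1 h')), mul_zero]
    rw [e, lintegral_const_mul' _ _ ENNReal.ofReal_ne_top]
    -- The power of ‖ζ‖ comes from the change of normalization between the scales aθ and a, through
    -- the lower power bound for w.
    have hratio : ‖ζ‖ ^ p ≤ C * (w ν a / w ν (a * θ)) := by
      rw [← mul_div_assoc, le_div_iff₀ hwb]
      refine le_trans ?_ (hS (a * θ) a hb (by nlinarith))
      have : a / (a * θ) = 2 * ‖ζ‖ := by rw [hθ]; field_simp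
      rw [this]
      gcongr
      linarith
    have hsplit : ENNReal.ofReal (w ν a) =
        ENNReal.ofReal (w ν a / w ν (a * θ)) * ENNReal.ofReal (w ν (a * θ)) := by
      rw [← ENNReal.ofReal_mul (by positivity), div_mul_cancel₀ _ hwb.ne']
    calc ENNReal.ofReal (2 * κ / C * ‖ζ‖ ^ p)
        ≤ ENNReal.ofReal (2 * (w ν a / w ν (a * θ)) * κ) := by
          refine ENNReal.ofReal_le_ofReal ?_
          rw [div_mul_eq_mul_div, div_le_iff₀ hC]
          nlinarith [mul_le_mul_of_nonneg_left hratio hκ.le]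
      _ = ENNReal.ofReal 2 * ENNReal.ofReal (w ν a / w ν (a * θ)) * ENNReal.ofReal κ := by
          rw [ENNReal.ofReal_mul (by positivity), ENNReal.ofReal_mul two_pos.le]
      _ ≤ _ := by
          refine (mul_le_mul_right hBb _).trans (le_of_eq ?_)
          rw [hsplit]; ring
  exact (ENNReal.ofReal_le_ofReal_iff
    (integral_nonneg fun y => sub_nonneg.2 (Real.cos_le_one _))).1 key

end Nondegenerate

end LevyKernel

end

/-! ### From Lévy measures to scaled symbols -/

noncomputable section

namespace LevyKernel

/-- A symbol `ψ` whose semigroup `exp (t ψ)` at time `t = w a` lives at the spatial scale `a`,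
where `w` has lower and upper power bounds of orders `p` and `q`. -/
structure IsScaledSymbol {V : Type*} [NormedAddCommGroup V] [InnerProductSpace ℝ V]
    [FiniteDimensional ℝ V] [MeasurableSpace V] [BorelSpace V]
    (ψ : V → ℂ) (w : ℝ → ℝ) (p q β C : ℝ) : Prop where
  pos_C : 0 < C
  pos_p : 0 < p
  pos_q : 0 < q
  pos_β : 0 < β
  four_mul_β_le : 4 * β ≤ p
  continuousOn_w : ContinuousOn w (Ioi 0)
  pos : ∀ r, 0 < r → 0 < w r
  mono : ∀ s r, 0 < s → s ≤ r → w s ≤ w r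
  upper : ∀ s r, 0 < s → s ≤ r → w r ≤ C * (r / s) ^ q * w s
  lower : ∀ s r, 0 < s → s ≤ r → (r / s) ^ p * w s ≤ C * w r
  continuous : Continuous ψ
  neg : ∀ ξ, ψ (-ξ) = (starRingEnd ℂ) (ψ ξ)
  re_nonpos : ∀ ξ, (ψ ξ).re ≤ 0
  integrable_exp : ∀ a, 0 < a → Integrable fun ξ => Complex.exp (w a * ψ ξ)
  wnorm_exp_le : ∀ a, 0 < a →
    wnorm (scaleWeight β a) (fun ξ => Complex.exp (w a * ψ ξ)) ≤ ENNReal.ofReal C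
  integrable_mul_exp : ∀ a, 0 < a → Integrable fun ξ => ψ ξ * Complex.exp (w a * ψ ξ)
  wnorm_mul_exp_le : ∀ a, 0 < a →
    wnorm (scaleWeight β a) (fun ξ => ψ ξ * Complex.exp (w a * ψ ξ)) ≤ ENNReal.ofReal (C / w a)
  integrable_neg_mul_exp : ∀ a, 0 < a → Integrable fun ξ => ψ (-ξ) * Complex.exp (w a * ψ ξ)
  wnorm_neg_mul_exp_le : ∀ a, 0 < a →
    wnorm (scaleWeight β a) (fun ξ => ψ (-ξ) * Complex.exp (w a * ψ ξ)) ≤ ENNReal.ofReal (C / w a)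
  integrable_inner_mul_exp : ∀ a, 0 < a → ∀ v,
    Integrable fun ξ => innerC v ξ * Complex.exp (w a * ψ ξ)
  wnorm_inner_mul_exp_le : ∀ a, 0 < a → ∀ v,
    wnorm (scaleWeight β a) (fun ξ => innerC v ξ * Complex.exp (w a * ψ ξ)) ≤
      ENNReal.ofReal (C * ‖v‖ / a)

variable {d : ℕ} {ν : Measure (EuclideanSpace ℝ (Fin d))} {σ : ℝ}

/-- The closed unit ball. -/
local notation "𝔹" => (Metric.closedBall (0 : EuclideanSpace ℝ (Fin d)) 1)

/-- The strict inequalities in the index conditions leave room for exponents p below both lower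
indices and q above both upper ones. For σ = 1 neither q < 1 nor p > 1 is asked, since the drift
vanishes by symmetry there. -/
lemma AssumptionA.exists_exponents (hA : AssumptionA σ ν) :
    ∃ p q : ℝ, 0 < p ∧ 0 < q ∧ q < 2 ∧ (σ < 1 → q < 1) ∧ (1 < σ → 1 < p) ∧
      p < lowerIndex (ratioZero (w ν)) ∧ p < lowerIndex (ratioInfty (w ν)) ∧
      upperIndex (ratioZero (w ν)) < q ∧ upperIndex (ratioInfty (w ν)) < q := by
  obtain ⟨⟨h1, h2, h3⟩, ⟨h1', h2', h3'⟩⟩ := hA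
  rcases lt_trichotomy σ 1 with hσ | hσ | hσ
  · obtain ⟨a1, a2, a3⟩ := h1 hσ
    obtain ⟨b1, b2, b3⟩ := h1' hσ
    obtain ⟨p, hp0, hp⟩ := exists_between (lt_min a1 b1)
    obtain ⟨q, hq0, hq⟩ := exists_between (max_lt a3 b3)
    rw [lt_min_iff] at hp
    rw [max_lt_iff] at hq0
    exact ⟨p, q, hp0, by linarith, by linarith, fun _ => hq, fun h => by linarith, hp.1, hp.2,
      hq0.1, hq0.2⟩
  · obtain ⟨a1, a2, a3, a4⟩ := h2 hσ
    obtain ⟨b1, b2, b3, b4⟩ := h2' hσ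
    obtain ⟨p, hp0, hp⟩ := exists_between (lt_min a1 b1)
    obtain ⟨q, hq0, hq⟩ := exists_between (max_lt a4 b4)
    rw [lt_min_iff] at hp
    rw [max_lt_iff] at hq0
    exact ⟨p, q, hp0, by linarith, hq, fun h => by linarith, fun h => by linarith, hp.1, hp.2,
      hq0.1, hq0.2⟩
  · obtain ⟨a1, a2, a3⟩ := h3 hσ
    obtain ⟨b1, b2, b3⟩ := h3' hσ
    obtain ⟨p, hp0, hp⟩ := exists_between (lt_min a1 b1)
    obtain ⟨q, hq0, hq⟩ := exists_between (max_lt a3 b3)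
    rw [lt_min_iff] at hp
    rw [max_lt_iff] at hq0
    exact ⟨p, q, by linarith, by linarith, hq, fun h => by linarith, fun _ => hp0, hp.1, hp.2,
      hq0.1, hq0.2⟩

/-- The symbol of a Lévy measure is the exponent of its rescaled jumps. -/
lemma w_mul_symbol (hpos : ∀ r, 0 < r → 0 < w ν r) {a : ℝ} (ha : 0 < a)
    (ξ : EuclideanSpace ℝ (Fin d))
    (h2 : Integrable (fun y => ‖y‖ ^ 2) ((rescale ν a).restrict 𝔹))
    (hρ : IsProbabilityMeasure ((rescale ν a).restrict {y | 1 < ‖y‖}))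
    (hs : Integrable (fun z => (1 - truncation σ (a • z)) • z) ((rescale ν a).restrict 𝔹))
    (hl : Integrable (fun z => truncation σ (a • z) • z) ((rescale ν a).restrict {y | 1 < ‖y‖})) :
    Integrable (symbolIntegrand σ ξ) ν ∧
    w ν a * symbol σ ν ξ = levyExponent ((rescale ν a).restrict 𝔹)
      ((rescale ν a).restrict {y | 1 < ‖y‖})
      ((∫ z, (1 - truncation σ (a • z)) • z ∂((rescale ν a).restrict 𝔹)) -
        ∫ z, truncation σ (a • z) • z ∂((rescale ν a).restrict {y | 1 < ‖y‖})) (a • ξ) := by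
  obtain ⟨hi, he⟩ := integral_levy_decomposition (χ := fun z => truncation σ (a • z)) h2 hρ hs hl
    (a • ξ)
  have hms : StronglyMeasurable fun z : EuclideanSpace ℝ (Fin d) => symbolIntegrand σ ξ (a • z) :=
    ((measurable_symbolIntegrand ξ).comp (measurable_const_smul a)).stronglyMeasurable
  have hinv : ∀ y : EuclideanSpace ℝ (Fin d), a • a⁻¹ • y = y := fun y => smul_inv_smul₀ ha.ne' y
  simp only [← symbolIntegrand_smul] at hi he
  rw [integrable_rescale_iff (hpos a ha) hms] at hi
  rw [integral_rescale (hpos a ha).le hms] at he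
  simp only [hinv] at hi he
  refine ⟨hi, ?_⟩
  rw [← he, symbol_eq, Complex.real_smul]

lemma symbolIntegrand_neg_left (ξ y : EuclideanSpace ℝ (Fin d)) :
    symbolIntegrand σ (-ξ) y = (starRingEnd ℂ) (symbolIntegrand σ ξ y) := by
  simp [symbolIntegrand, inner_neg_left, phase_neg, Complex.conj_ofNat]

lemma symbol_neg (ξ : EuclideanSpace ℝ (Fin d)) :
    symbol σ ν (-ξ) = (starRingEnd ℂ) (symbol σ ν ξ) := by
  simp only [symbol_eq, symbolIntegrand_neg_left, integral_conj]

lemma symbolIntegrand_neg_right (ξ y : EuclideanSpace ℝ (Fin d)) :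
    symbolIntegrand σ ξ (-y) = symbolIntegrand σ (-ξ) y := by
  simp only [symbolIntegrand, inner_neg_left, inner_neg_right, truncation_neg]

lemma symbol_reflect (ξ : EuclideanSpace ℝ (Fin d)) :
    symbol σ (reflect ν) ξ = symbol σ ν (-ξ) := by
  rw [symbol_eq, reflect, integral_map (by fun_prop)
    (measurable_symbolIntegrand ξ).aestronglyMeasurable, symbol_eq]
  simp only [symbolIntegrand_neg_right]

/-- Reflecting the measure conjugates the symbol, so averaging leaves the real part unchanged. -/
lemma symbol_symmetrize_re (h : ∀ ξ, Integrable (symbolIntegrand σ ξ) ν)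
    (ξ : EuclideanSpace ℝ (Fin d)) :
    (symbol σ (symmetrize ν) ξ).re = (symbol σ ν ξ).re := by
  have h2 : Integrable (symbolIntegrand σ ξ) (reflect ν) := by
    rw [reflect, integrable_map_measure (measurable_symbolIntegrand ξ).aestronglyMeasurable
      (by fun_prop)]
    refine (h (-ξ)).congr (ae_of_all _ fun y => ?_)
    simp [symbolIntegrand_neg_right]
  rw [symbol_eq, symmetrize, integral_smul_measure, integral_add_measure (h ξ) h2, ← symbol_eq,
    ← symbol_eq, symbol_reflect, symbol_neg]
  simp
  ring

lemma symbol_re_nonpos (h : ∀ ξ, Integrable (symbolIntegrand σ ξ) ν)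
    (ξ : EuclideanSpace ℝ (Fin d)) : (symbol σ ν ξ).re ≤ 0 := by
  have h1 : (symbol σ ν ξ).re = ∫ y, (symbolIntegrand σ ξ y).re ∂ν := (integral_re (h ξ)).symm
  rw [h1]
  refine integral_nonpos fun y => ?_
  simp only [symbolIntegrand, Complex.sub_re, phase_re]
  have := Real.cos_le_one (2 * Real.pi * ⟪ξ, y⟫)
  simp
  linarith

lemma lintegral_one_lt_scaleWeight_le {ρ : Measure (EuclideanSpace ℝ (Fin d))} {β B : ℝ}
    (hβ0 : 0 < β) (hβ1 : β ≤ 1)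
    (h : ∫⁻ y in {y | 1 < ‖y‖}, ENNReal.ofReal (‖y‖ ^ β) ∂ρ ≤ ENNReal.ofReal B) :
    ∫⁻ y in {y | 1 < ‖y‖}, scaleWeight β 1 y ∂ρ ≤ ENNReal.ofReal (2 * B) := by
  rw [ENNReal.ofReal_mul two_pos.le]
  refine le_trans ?_ (mul_le_mul_right h _)
  rw [← lintegral_const_mul' _ _ ENNReal.ofReal_ne_top]
  refine setLIntegral_mono' (measurableSet_lt_norm 1) fun y hy => ?_
  rw [mem_ofPred_eq] at hy
  rw [scaleWeight, ← ENNReal.ofReal_mul two_pos.le, div_one]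
  refine ENNReal.ofReal_le_ofReal ?_
  calc (1 + ‖y‖) ^ β ≤ (2 * ‖y‖) ^ β := Real.rpow_le_rpow (by positivity) (by linarith) hβ0.le
    _ = 2 ^ β * ‖y‖ ^ β := Real.mul_rpow two_pos.le (norm_nonneg y)
    _ ≤ 2 * ‖y‖ ^ β := by
        gcongr
        calc (2 : ℝ) ^ β ≤ 2 ^ (1 : ℝ) := Real.rpow_le_rpow_of_exponent_le one_le_two hβ1
          _ = 2 := Real.rpow_one 2

lemma scaleWeight_smul {β a : ℝ} (ha : 0 < a) (x : EuclideanSpace ℝ (Fin d)) :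
    scaleWeight β a (a • x) = scaleWeight β 1 x := by
  rw [scaleWeight, scaleWeight, norm_smul, Real.norm_of_nonneg ha.le, mul_div_cancel_left₀ _ ha.ne',
    div_one]

/-- Lévy symbols satisfying the nondegeneracy assumption and the index conditions are scaled. -/
theorem exists_isScaledSymbol (hν : LevyClass σ ν)
    (hcont : ContinuousOn (w ν) (Ioi 0)) (hORV : IsORV (w ν)) (hA : AssumptionA σ ν)
    (hB : AssumptionB ν) :
    (∀ ξ, Integrable (symbolIntegrand σ ξ) ν) ∧
    ∃ p q β C : ℝ, IsScaledSymbol (symbol σ ν) (w ν) p q β C := by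
  obtain ⟨p, q, hp0, hq0, hq2, hσq, hσp, hp1, hp2, hq1, hq2'⟩ := hA.exists_exponents
  have hpos := hORV.pos
  obtain ⟨C₁, hC₁, hS⟩ := hORV.exists_scaling (w_mono hpos) hp0 hq0 hp1 hp2 hq1 hq2'
  obtain ⟨κ, hκ, hBκ⟩ := hB.exists_le
  -- The bound p/4 gives the large jumps a finite β-moment and limits the later change-of-scale loss
  -- to a power 1/4. The bound 1 keeps the weight below 1 + ‖x‖.
  set β : ℝ := min (p / 4) 1 with hβ
  have hβ0 : 0 < β := lt_min (by positivity) one_pos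
  have hβ1 : β ≤ 1 := min_le_right _ _
  have hβp : 4 * β ≤ p := by have := min_le_left (p / 4) 1; linarith
  set A₁ : ℝ := 2 * (C₁ / (2 - q)) with hA₁
  -- Of A₁, A₂, A₃ the first bounds the second moment of the small jumps, the second the drift, the
  -- third the weighted mass of the large jumps. Absolute values are taken because each quotient is
  -- meaningful only in its own range of σ.
  set A₂ : ℝ := |C₁ / (1 - q)| + |1 + C₁ / (p - 1)| with hA₂
  set A₃ : ℝ := 2 * (1 + β * (C₁ / (p - β))) with hA₃
  have hA₁0 : 0 ≤ A₁ := by have : 0 < 2 - q := by linarith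
                           positivity
  have hA₂0 : 0 ≤ A₂ := by positivity
  have hA₃0 : 0 ≤ A₃ := by have : 0 < p - β := by linarith
                           positivity
  set A : ℝ := A₁ + A₂ + A₃ with hAdef
  obtain ⟨C₂, hC₂, hmain⟩ := exists_wnorm_levyExponent_le (EuclideanSpace ℝ (Fin d))
    (A := A) (c := 2 * κ / C₁) (p := p) (by positivity) (by positivity) hp0
  have hall : ∀ a, 0 < a →
      Integrable (fun y => ‖y‖ ^ 2) ((rescale ν a).restrict 𝔹) ∧
      ∫ y, ‖y‖ ^ 2 ∂((rescale ν a).restrict 𝔹) ≤ A := by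
    intro a ha
    have h := (rescale_moments hpos hC₁ hS ha).2.1 2 two_pos hq2
    have e : ∀ y : EuclideanSpace ℝ (Fin d), ENNReal.ofReal (‖y‖ ^ (2 : ℝ)) = ‖‖y‖ ^ 2‖ₑ := by
      intro y; rw [Real.rpow_two, Real.enorm_of_nonneg (by positivity)]
    simp only [e] at h
    have hi : Integrable (fun y : EuclideanSpace ℝ (Fin d) => ‖y‖ ^ 2)
        ((rescale ν a).restrict 𝔹) := ⟨by fun_prop, h.trans_lt ENNReal.ofReal_lt_top⟩
    refine ⟨hi, ?_⟩
    have h3 := (enorm_integral_le_lintegral_enorm _).trans h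
    rw [Real.enorm_of_nonneg (integral_nonneg fun y => by positivity),
      ENNReal.ofReal_le_ofReal_iff hA₁0] at h3
    linarith
  have hdrift : ∀ a : ℝ, 0 < a → _ := fun a ha =>
    rescale_drift (σ := σ) hpos hν.annulus hC₁ hS hq2 hσq hσp ha (B := A₂) hA₂0
      (fun _ => (le_abs_self _).trans (le_add_of_nonneg_right (abs_nonneg _)))
      (fun _ => (le_abs_self _).trans (le_add_of_nonneg_left (abs_nonneg _)))
  have hsym : ∀ a : ℝ, 0 < a → ∀ ξ, _ := fun a ha ξ =>
    w_mul_symbol (σ := σ) hpos ha ξ (hall a ha).1 (rescale_moments hpos hC₁ hS ha).1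
      (hdrift a ha).1 (hdrift a ha).2.1
  have hint : ∀ ξ, Integrable (symbolIntegrand σ ξ) ν := fun ξ => (hsym 1 one_pos ξ).1
  have hbig : ∀ a : ℝ, 0 < a → _ := fun a ha =>
    hmain ((rescale ν a).restrict 𝔹) (hall a ha).1 (hall a ha).2
      ((ae_restrict_mem Metric.isClosed_closedBall.measurableSet).mono fun y hy => by
        simpa using hy)
      (smallSymbol_re_nonpos (hall a ha).1)
      (fun ζ hζ => smallSymbol_rescale_re_le hpos hC₁ hp0 (fun s r hs hr => (hS s r hs hr).2) hκ
        hBκ ha (hall a ha).1 hζ)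
      ((rescale ν a).restrict {y | 1 < ‖y‖})
      ((∫ z, (1 - truncation σ (a • z)) • z ∂((rescale ν a).restrict 𝔹)) -
        ∫ z, truncation σ (a • z) • z ∂((rescale ν a).restrict {y | 1 < ‖y‖}))
      (rescale_moments hpos hC₁ hS ha).1 ((hdrift a ha).2.2.trans (by linarith))
      (scaleWeight β 1) (isWeight_scaleWeight hβ0.le one_pos)
      (fun x => ENNReal.ofReal_le_ofReal (by
        rw [div_one]
        calc (1 + ‖x‖) ^ β ≤ (1 + ‖x‖) ^ (1 : ℝ) := Real.rpow_le_rpow_of_exponent_le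
              (by linarith [norm_nonneg x]) hβ1
          _ = _ := Real.rpow_one _))
      ((lintegral_one_lt_scaleWeight_le hβ0 hβ1
        ((rescale_moments hpos hC₁ hS ha).2.2 β hβ0 (by linarith))).trans
        (ENNReal.ofReal_le_ofReal (by linarith)))
  refine ⟨hint, p, q, β, max C₁ C₂, ?_⟩
  have hC12 := le_max_left C₁ C₂
  have hC22 := le_max_right C₁ C₂
  -- The dilation by a turns the unit-scale weight into the weight of scale a, which transfers the
  -- uniform bounds to every scale without loss.
  have key : ∀ a, 0 < a → ∀ m : EuclideanSpace ℝ (Fin d) → ℂ,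
      wnorm (scaleWeight β a) (fun ξ => m (a • ξ)) = wnorm (scaleWeight β 1) m := by
    intro a ha m
    rw [wnorm_comp_smul m ha]
    simp only [scaleWeight_smul ha]
  have hpsi : ∀ a, 0 < a → ∀ ξ, ((w ν a)⁻¹ : ℝ) * (w ν a * symbol σ ν ξ) = symbol σ ν ξ := by
    intro a ha ξ
    rw [← mul_assoc, ← Complex.ofReal_mul, inv_mul_cancel₀ (hpos a ha).ne', Complex.ofReal_one,
      one_mul]
  have hmulW : ∀ a, 0 < a → ∀ {m : EuclideanSpace ℝ (Fin d) → ℂ} (c : ℝ), 0 < c → Integrable m →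
      ∀ {B : ℝ}, wnorm (scaleWeight β 1) m ≤ ENNReal.ofReal B →
      Integrable (fun ξ => (c : ℂ) * m (a • ξ)) ∧
      wnorm (scaleWeight β a) (fun ξ => (c : ℂ) * m (a • ξ)) ≤ ENNReal.ofReal (c * B) := by
    intro a ha m c hc hm B hB
    have h1 : Integrable fun ξ => m (a • ξ) := (integrable_comp_smul_iff volume m ha.ne').2 hm
    refine ⟨h1.const_mul _, ?_⟩
    rw [wnorm_const_mul _ h1 (isWeight_scaleWeight hβ0.le ha).measurable, key a ha,
      ENNReal.ofReal_mul hc.le, ← ofReal_norm, Complex.norm_of_nonneg hc.le]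
    exact mul_le_mul_right hB _
  have m1 : ∀ a : ℝ, 0 < a → _ := fun a ha =>
    hmulW a ha (w ν a)⁻¹ (inv_pos.2 (hpos a ha)) (hbig a ha).2.2.2.2.2.1 (hbig a ha).2.2.2.1
  have m2 : ∀ a : ℝ, 0 < a → _ := fun a ha =>
    hmulW a ha (w ν a)⁻¹ (inv_pos.2 (hpos a ha)) (hbig a ha).2.2.2.2.2.2.1 (hbig a ha).2.2.2.2.1
  have m3 : ∀ a : ℝ, 0 < a → ∀ v, _ := fun a ha v =>
    hmulW a ha a⁻¹ (inv_pos.2 ha) ((hbig a ha).2.2.2.2.2.2.2 v).1 ((hbig a ha).2.2.2.2.2.2.2 v).2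
  have hpsi' : ∀ a, 0 < a → ∀ ξ z,
      ((w ν a)⁻¹ : ℝ) * (w ν a * symbol σ ν ξ * z) = symbol σ ν ξ * z := by
    intro a ha ξ z
    rw [← mul_assoc, hpsi a ha]
  have hinn : ∀ a, 0 < a → ∀ (v ξ : EuclideanSpace ℝ (Fin d)) (z : ℂ),
      ((a⁻¹ : ℝ) : ℂ) * (innerC v (a • ξ) * z) = innerC v ξ * z := by
    intro a ha v ξ z
    rw [map_smul, Complex.real_smul, ← mul_assoc, ← mul_assoc, ← Complex.ofReal_mul,
      inv_mul_cancel₀ ha.ne', Complex.ofReal_one, one_mul]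
  exact
    { pos_C := by positivity
      pos_p := hp0
      pos_q := hq0
      pos_β := hβ0
      four_mul_β_le := hβp
      continuousOn_w := hcont
      pos := hpos
      mono := w_mono hpos
      upper := fun s r hs hr => (hS s r hs hr).1.trans (by
        have := hpos s hs
        have : 0 < r / s := div_pos (hs.trans_le hr) hs
        gcongr)
      lower := fun s r hs hr => (hS s r hs hr).2.trans (by
        have := hpos r (hs.trans_le hr)
        gcongr)
      continuous := by
        have h1 := (hbig 1 one_pos).1
        have : symbol σ ν = fun ξ => ((w ν 1)⁻¹ : ℝ) * levyExponent _ _ _ ((1 : ℝ) • ξ) :=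
          funext fun ξ => by rw [← (hsym 1 one_pos ξ).2, hpsi 1 one_pos]
        rw [this]
        exact continuous_const.mul (h1.comp (continuous_const_smul _))
      neg := symbol_neg
      re_nonpos := symbol_re_nonpos hint
      integrable_exp := fun a ha => by
        simp only [(hsym a ha _).2]
        exact (integrable_comp_smul_iff volume _ ha.ne').2 (hbig a ha).2.1
      wnorm_exp_le := fun a ha => by
        simp only [(hsym a ha _).2]
        rw [key a ha fun ζ => Complex.exp (levyExponent _ _ _ ζ)]
        exact (hbig a ha).2.2.1.trans (ENNReal.ofReal_le_ofReal hC22)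
      integrable_mul_exp := fun a ha => by
        have := (m1 a ha).1
        simpa only [← (hsym a ha _).2, hpsi' a ha] using this
      wnorm_mul_exp_le := fun a ha => by
        have := (m1 a ha).2
        simp only [← (hsym a ha _).2, hpsi' a ha] at this
        refine this.trans (ENNReal.ofReal_le_ofReal ?_)
        rw [div_eq_inv_mul]
        have := hpos a ha
        gcongr
      integrable_neg_mul_exp := fun a ha => by
        have := (m2 a ha).1
        simpa only [← smul_neg, ← (hsym a ha _).2, hpsi' a ha] using this
      wnorm_neg_mul_exp_le := fun a ha => by
        have := (m2 a ha).2
        simp only [← smul_neg, ← (hsym a ha _).2, hpsi' a ha] at this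
        refine this.trans (ENNReal.ofReal_le_ofReal ?_)
        rw [div_eq_inv_mul]
        have := hpos a ha
        gcongr
      integrable_inner_mul_exp := fun a ha v => by
        have := (m3 a ha v).1
        simpa only [← (hsym a ha _).2, hinn a ha] using this
      wnorm_inner_mul_exp_le := fun a ha v => by
        have := (m3 a ha v).2
        simp only [← (hsym a ha _).2, hinn a ha] at this
        refine this.trans (ENNReal.ofReal_le_ofReal ?_)
        rw [div_eq_inv_mul, mul_comm ‖v‖]
        gcongr }

end LevyKernel

end

/-! ### Scaled symbols: times versus scales, and the dissipation -/

noncomputable section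

namespace LevyKernel

variable {V : Type*} [NormedAddCommGroup V] [InnerProductSpace ℝ V]
    [FiniteDimensional ℝ V] [MeasurableSpace V] [BorelSpace V]

/-- A spatial scale `a` with `w a = t`. -/
def scale (w : ℝ → ℝ) (t : ℝ) : ℝ := Classical.epsilon fun a => 0 < a ∧ w a = t

/-- The symbol `exp (t ψ)` of the semigroup. -/
def expSymbol (ψ : V → ℂ) (t : ℝ) (ξ : V) : ℂ := Complex.exp (t * ψ ξ)

/-- The dissipation `-Re ψ`. -/
def dissipation (ψ : V → ℂ) (ξ : V) : ℝ := -(ψ ξ).re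

/-- The symbol `(-Re ψ)^(1/2) exp (t ψ)`. -/
def rootSymbol (ψ : V → ℂ) (t : ℝ) (ξ : V) : ℂ :=
  ((dissipation ψ ξ ^ (1 / 2 : ℝ) : ℝ) : ℂ) * expSymbol ψ t ξ

lemma expSymbol_add (ψ : V → ℂ) (s t : ℝ) (ξ : V) :
    expSymbol ψ (s + t) ξ = expSymbol ψ s ξ * expSymbol ψ t ξ := by
  rw [expSymbol, expSymbol, expSymbol, ← Complex.exp_add]
  push_cast; congr 1; ring

lemma norm_expSymbol (ψ : V → ℂ) (t : ℝ) (ξ : V) :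
    ‖expSymbol ψ t ξ‖ = Real.exp (-(t * dissipation ψ ξ)) := by
  rw [expSymbol, Complex.norm_exp, dissipation]
  simp

lemma isWeight_one : IsWeight (fun _ : V => (1 : ℝ≥0∞)) where
  measurable := measurable_const
  one_le _ := le_rfl
  neg _ := rfl
  add_le _ _ := by simp

namespace IsScaledSymbol

variable {ψ : V → ℂ} {w : ℝ → ℝ} {p q β C : ℝ}

lemma one_le_C (h : IsScaledSymbol ψ w p q β C) : 1 ≤ C := by
  have h1 := h.upper 1 1 one_pos le_rfl
  rw [div_one, Real.one_rpow, mul_one] at h1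
  have h2 := h.pos 1 one_pos
  by_contra hC
  push Not at hC
  nlinarith

/-- The lower power bound makes w small near 0 and large near infinity, and continuity gives the
intermediate value. -/
lemma exists_eq (h : IsScaledSymbol ψ w p q β C) {t : ℝ} (ht : 0 < t) : ∃ a, 0 < a ∧ w a = t := by
  have hC := h.pos_C
  have hw1 := h.pos 1 one_pos
  have t1 : Tendsto (fun s : ℝ => C * w 1 * s ^ p) (𝓝[>] 0) (𝓝 0) := by
    have : Tendsto (fun s : ℝ => C * w 1 * s ^ p) (𝓝[>] 0) (𝓝 (C * w 1 * 0 ^ p)) :=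
      (((Real.continuous_rpow_const h.pos_p.le).tendsto 0).const_mul _).mono_left
        nhdsWithin_le_nhds
    rwa [Real.zero_rpow h.pos_p.ne', mul_zero] at this
  have t2 : Tendsto (fun r : ℝ => r ^ p) atTop atTop := tendsto_rpow_atTop h.pos_p
  obtain ⟨s, hs, hs0, hs1⟩ := ((t1.eventually (gt_mem_nhds ht)).and
    (Ioc_mem_nhdsGT one_pos)).exists
  obtain ⟨r, hr, hr1⟩ := ((t2.eventually_ge_atTop (C * t / w 1)).and
    (eventually_ge_atTop 1)).exists
  have hws : w s ≤ t := by
    have h1 := h.lower s 1 hs0 hs1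
    have h2 : (0 : ℝ) < s ^ p := by positivity
    rw [one_div, Real.inv_rpow hs0.le, inv_mul_le_iff₀ h2] at h1
    nlinarith
  have hwr : t ≤ w r := by
    have h1 := h.lower 1 r one_pos hr1
    rw [div_one] at h1
    rw [div_le_iff₀ hw1] at hr
    nlinarith
  have hsr : s ≤ r := hs1.trans hr1
  obtain ⟨a, ha, hat⟩ := intermediate_value_Icc hsr
    (h.continuousOn_w.mono fun x hx => lt_of_lt_of_le hs0 hx.1) ⟨hws, hwr⟩
  exact ⟨a, lt_of_lt_of_le hs0 ha.1, hat⟩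

lemma scale_pos (h : IsScaledSymbol ψ w p q β C) {t : ℝ} (ht : 0 < t) : 0 < scale w t :=
  (Classical.epsilon_spec (h.exists_eq ht)).1

lemma w_scale (h : IsScaledSymbol ψ w p q β C) {t : ℝ} (ht : 0 < t) : w (scale w t) = t :=
  (Classical.epsilon_spec (h.exists_eq ht)).2

/-- This holds although `scale` is an arbitrary choice and w need not be injective: for s < t, the
reverse order of the scales would contradict monotonicity of w. -/
lemma scale_mono (h : IsScaledSymbol ψ w p q β C) {s t : ℝ} (hs : 0 < s) (hst : s ≤ t) :
    scale w s ≤ scale w t := by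
  rcases hst.eq_or_lt with rfl | hlt
  · rfl
  by_contra hc
  push Not at hc
  have := h.mono _ _ (h.scale_pos (hs.trans hlt)) hc.le
  rw [h.w_scale hs, h.w_scale (hs.trans hlt)] at this
  linarith

/-- The weight adapted to time `t`. -/
lemma isWeight (h : IsScaledSymbol ψ w p q β C) {t : ℝ} (ht : 0 < t) :
    IsWeight (scaleWeight β (scale w t) : V → ℝ≥0∞) :=
  isWeight_scaleWeight h.pos_β.le (h.scale_pos ht)

lemma wnorm_anti (h : IsScaledSymbol ψ w p q β C) {s t : ℝ} (hs : 0 < s) (hst : s ≤ t)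
    (m : V → ℂ) :
    wnorm (scaleWeight β (scale w t)) m ≤ wnorm (scaleWeight β (scale w s)) m := by
  refine wnorm_mono (fun x => ENNReal.ofReal_le_ofReal ?_) m
  have h1 := h.scale_pos hs
  have h2 := h.scale_mono hs hst
  have h3 : 0 < scale w t := h1.trans_le h2
  refine Real.rpow_le_rpow (by positivity) ?_ h.pos_β.le
  gcongr

/-- The weights differ by at most the β-th power of the ratio of scales, whose p-th power is at most
C t/s. Since β/p ≤ 1/4, a quarter power of t/s suffices. -/
lemma wnorm_le_mul (h : IsScaledSymbol ψ w p q β C) {s t : ℝ} (hs : 0 < s) (hst : s ≤ t)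
    {m : V → ℂ} (hm : Integrable m) :
    wnorm (scaleWeight β (scale w s)) m ≤
      ENNReal.ofReal (C * (t / s) ^ (1 / 4 : ℝ)) * wnorm (scaleWeight β (scale w t)) m := by
  have h1 := h.scale_pos hs
  have h2 := h.scale_mono hs hst
  have h3 : 0 < scale w t := h1.trans_le h2
  have hC := h.one_le_C
  have ht : 0 < t := hs.trans_le hst
  have hts : 1 ≤ t / s := by rwa [one_le_div hs]
  set b := scale w t / scale w s with hb
  have hb1 : 1 ≤ b := by rwa [hb, one_le_div h1]
  have hbp : b ^ p ≤ C * (t / s) := by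
    have := h.lower _ _ h1 h2
    rw [h.w_scale hs, h.w_scale ht] at this
    rw [← mul_div_assoc, le_div_iff₀ hs]
    exact this
  have hbβ : b ^ β ≤ C * (t / s) ^ (1 / 4 : ℝ) := by
    have hp := h.pos_p
    have hβ4 : β / p ≤ 1 / 4 := by
      rw [div_le_iff₀ hp]; have := h.four_mul_β_le; linarith
    have hβ0 : 0 ≤ β / p := div_nonneg h.pos_β.le hp.le
    calc b ^ β = (b ^ p) ^ (β / p) := by
          rw [← Real.rpow_mul (by linarith), mul_div_cancel₀ _ hp.ne']
      _ ≤ (C * (t / s)) ^ (β / p) := Real.rpow_le_rpow (by positivity) hbp hβ0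
      _ ≤ (C * (t / s)) ^ (1 / 4 : ℝ) :=
          Real.rpow_le_rpow_of_exponent_le (by nlinarith) hβ4
      _ = C ^ (1 / 4 : ℝ) * (t / s) ^ (1 / 4 : ℝ) := Real.mul_rpow (by linarith) (by linarith)
      _ ≤ C * (t / s) ^ (1 / 4 : ℝ) := by
          gcongr
          calc C ^ (1 / 4 : ℝ) ≤ C ^ (1 : ℝ) :=
                Real.rpow_le_rpow_of_exponent_le hC (by norm_num)
            _ = C := Real.rpow_one C
  refine wnorm_const_mul_weight_le (h.isWeight ht).measurable (fun x => ?_) hm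
  rw [scaleWeight, scaleWeight, ← ENNReal.ofReal_mul (by positivity)]
  refine ENNReal.ofReal_le_ofReal ?_
  have e : 1 + ‖x‖ / scale w s ≤ b * (1 + ‖x‖ / scale w t) := by
    have : b * (‖x‖ / scale w t) = ‖x‖ / scale w s := by rw [hb]; field_simp
    rw [mul_add, this, mul_one]
    linarith
  calc (1 + ‖x‖ / scale w s) ^ β ≤ (b * (1 + ‖x‖ / scale w t)) ^ β :=
        Real.rpow_le_rpow (by positivity) e h.pos_β.le
    _ = b ^ β * (1 + ‖x‖ / scale w t) ^ β := Real.mul_rpow (by positivity) (by positivity)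
    _ ≤ _ := by gcongr

lemma dissipation_nonneg (h : IsScaledSymbol ψ w p q β C) (ξ : V) : 0 ≤ dissipation ψ ξ :=
  neg_nonneg.2 (h.re_nonpos ξ)

lemma continuous_dissipation (h : IsScaledSymbol ψ w p q β C) : Continuous (dissipation ψ) :=
  (Complex.continuous_re.comp h.continuous).neg

lemma continuous_expSymbol (h : IsScaledSymbol ψ w p q β C) (t : ℝ) :
    Continuous (expSymbol ψ t) := by
  have := h.continuous
  unfold expSymbol
  fun_prop

lemma continuous_rootSymbol (h : IsScaledSymbol ψ w p q β C) (t : ℝ) :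
    Continuous (rootSymbol ψ t) := by
  have := h.continuous_expSymbol t
  have h2 : Continuous fun ξ => dissipation ψ ξ ^ (1 / 2 : ℝ) :=
    h.continuous_dissipation.rpow_const fun _ => Or.inr (by norm_num)
  unfold rootSymbol
  fun_prop

lemma integrable_expSymbol (h : IsScaledSymbol ψ w p q β C) {t : ℝ} (ht : 0 < t) :
    Integrable (expSymbol ψ t) := by
  have := h.integrable_exp _ (h.scale_pos ht)
  rwa [h.w_scale ht] at this

lemma wnorm_expSymbol_le (h : IsScaledSymbol ψ w p q β C) {t : ℝ} (ht : 0 < t) :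
    wnorm (scaleWeight β (scale w t)) (expSymbol ψ t) ≤ ENNReal.ofReal C := by
  have := h.wnorm_exp_le _ (h.scale_pos ht)
  rwa [h.w_scale ht] at this

lemma integrable_mul_expSymbol (h : IsScaledSymbol ψ w p q β C) {t : ℝ} (ht : 0 < t) :
    Integrable fun ξ => ψ ξ * expSymbol ψ t ξ := by
  have := h.integrable_mul_exp _ (h.scale_pos ht)
  rwa [h.w_scale ht] at this

lemma wnorm_mul_expSymbol_le (h : IsScaledSymbol ψ w p q β C) {t : ℝ} (ht : 0 < t) :
    wnorm (scaleWeight β (scale w t)) (fun ξ => ψ ξ * expSymbol ψ t ξ) ≤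
      ENNReal.ofReal (C / t) := by
  have := h.wnorm_mul_exp_le _ (h.scale_pos ht)
  rwa [h.w_scale ht] at this

lemma integrable_inner_mul_expSymbol (h : IsScaledSymbol ψ w p q β C) {t : ℝ} (ht : 0 < t)
    (v : V) : Integrable fun ξ => innerC v ξ * expSymbol ψ t ξ := by
  have := h.integrable_inner_mul_exp _ (h.scale_pos ht) v
  rwa [h.w_scale ht] at this

lemma wnorm_inner_mul_expSymbol_le (h : IsScaledSymbol ψ w p q β C) {t : ℝ} (ht : 0 < t) (v : V) :
    wnorm (scaleWeight β (scale w t)) (fun ξ => innerC v ξ * expSymbol ψ t ξ) ≤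
      ENNReal.ofReal (C * ‖v‖ / scale w t) := by
  have := h.wnorm_inner_mul_exp_le _ (h.scale_pos ht) v
  rwa [h.w_scale ht] at this

/-- This identity is the reason why `IsScaledSymbol` also controls ψ(-ξ) exp(tψ(ξ)): the real part
is recovered from two multipliers that are already bounded. -/
lemma dissipation_eq (h : IsScaledSymbol ψ w p q β C) (ξ : V) :
    (dissipation ψ ξ : ℂ) = -(1 / 2) * (ψ ξ + ψ (-ξ)) := by
  rw [h.neg, Complex.add_conj, dissipation]
  push_cast; ring

lemma integrable_dissipation_mul_expSymbol (h : IsScaledSymbol ψ w p q β C) {t : ℝ} (ht : 0 < t) :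
    Integrable fun ξ => (dissipation ψ ξ : ℂ) * expSymbol ψ t ξ := by
  have h1 := h.integrable_mul_exp _ (h.scale_pos ht)
  have h2 := h.integrable_neg_mul_exp _ (h.scale_pos ht)
  rw [h.w_scale ht] at h1 h2
  refine ((h1.add h2).const_mul (-(1 / 2))).congr (ae_of_all _ fun ξ => ?_)
  simp only [Pi.add_apply]
  rw [h.dissipation_eq, expSymbol]; ring

lemma wnorm_dissipation_mul_expSymbol_le (h : IsScaledSymbol ψ w p q β C) {t : ℝ} (ht : 0 < t) :
    wnorm (scaleWeight β (scale w t)) (fun ξ => (dissipation ψ ξ : ℂ) * expSymbol ψ t ξ) ≤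
      ENNReal.ofReal (C / t) := by
  have h1 := h.integrable_mul_exp _ (h.scale_pos ht)
  have h2 := h.integrable_neg_mul_exp _ (h.scale_pos ht)
  have h3 := h.wnorm_mul_exp_le _ (h.scale_pos ht)
  have h4 := h.wnorm_neg_mul_exp_le _ (h.scale_pos ht)
  rw [h.w_scale ht] at h1 h2 h3 h4
  have e : (fun ξ => (dissipation ψ ξ : ℂ) * expSymbol ψ t ξ) = fun ξ => (-(1 / 2) : ℂ) *
      (ψ ξ * Complex.exp (t * ψ ξ) + ψ (-ξ) * Complex.exp (t * ψ ξ)) := by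
    ext ξ; rw [h.dissipation_eq, expSymbol]; ring
  have hn : ‖(-(1 / 2) : ℂ)‖ₑ = ENNReal.ofReal (1 / 2) := by
    rw [← ofReal_norm]; norm_num
  have hC := h.pos_C
  rw [e, wnorm_const_mul (fun ξ => ψ ξ * Complex.exp (t * ψ ξ) + ψ (-ξ) * Complex.exp (t * ψ ξ))
    (h1.add h2) (h.isWeight ht).measurable, hn]
  calc _ ≤ ENNReal.ofReal (1 / 2) * (ENNReal.ofReal (C / t) + ENNReal.ofReal (C / t)) := by
        gcongr
        exact (wnorm_add_le h1 h2 (h.isWeight ht).measurable).trans (add_le_add h3 h4)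
    _ = _ := by
        rw [← ENNReal.ofReal_add (by positivity) (by positivity),
          ← ENNReal.ofReal_mul (by norm_num)]
        congr 1; ring

/-- The symbol `exp (t Re ψ)`. -/
lemma exp_neg_dissipation_eq (h : IsScaledSymbol ψ w p q β C) (r : ℝ) (ξ : V) :
    ((Real.exp (-(r * dissipation ψ ξ)) : ℝ) : ℂ) =
      expSymbol ψ (r / 2) ξ * expSymbol ψ (r / 2) (-ξ) := by
  rw [expSymbol, expSymbol, ← Complex.exp_add, Complex.ofReal_exp]
  congr 1
  push_cast
  rw [h.dissipation_eq]; ring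

lemma integrable_exp_neg_dissipation (h : IsScaledSymbol ψ w p q β C) {r : ℝ} (hr : 0 < r) :
    Integrable fun ξ => ((Real.exp (-(r * dissipation ψ ξ)) : ℝ) : ℂ) := by
  refine Integrable.ofReal ((h.integrable_expSymbol hr).norm.congr (ae_of_all _ fun ξ => ?_))
  exact norm_expSymbol ψ r ξ

lemma continuous_exp_neg_dissipation (h : IsScaledSymbol ψ w p q β C) (r : ℝ) :
    Continuous fun ξ => ((Real.exp (-(r * dissipation ψ ξ)) : ℝ) : ℂ) := by
  have := h.continuous_dissipation
  fun_prop

lemma wnorm_expSymbol_neg_le (h : IsScaledSymbol ψ w p q β C) {t : ℝ} (ht : 0 < t) :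
    wnorm (scaleWeight β (scale w t)) (fun ξ => expSymbol ψ t (-ξ)) ≤ ENNReal.ofReal C := by
  rw [wnorm_comp_neg (h.isWeight ht)]
  exact h.wnorm_expSymbol_le ht

/-- The symmetrized semigroup at time r is the product of the semigroup at time r/2 and its
reflection. The weight at time r is below that at time r/2, where submultiplicativity applies. -/
lemma wnorm_exp_neg_dissipation_le (h : IsScaledSymbol ψ w p q β C) {r : ℝ} (hr : 0 < r) :
    wnorm (scaleWeight β (scale w r)) (fun ξ => ((Real.exp (-(r * dissipation ψ ξ)) : ℝ) : ℂ)) ≤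
      ENNReal.ofReal (C ^ 2) := by
  have hr2 : 0 < r / 2 := by positivity
  simp only [h.exp_neg_dissipation_eq]
  refine (h.wnorm_anti hr2 (by linarith) _).trans ?_
  have h1 := h.wnorm_expSymbol_neg_le hr2
  refine (wnorm_mul_le (h.isWeight hr2) (h.integrable_expSymbol hr2) (h.continuous_expSymbol _)
    (h.integrable_expSymbol hr2).comp_neg ((h.continuous_expSymbol _).comp continuous_neg)
    (h1.trans_lt ENNReal.ofReal_lt_top).ne).trans ?_
  rw [sq, ENNReal.ofReal_mul h.pos_C.le]
  exact mul_le_mul' (h.wnorm_expSymbol_le hr2) h1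

lemma integrable_dissipation_mul_exp (h : IsScaledSymbol ψ w p q β C) {r : ℝ} (hr : 0 < r) :
    Integrable fun ξ => (dissipation ψ ξ : ℂ) *
      ((Real.exp (-(r * dissipation ψ ξ)) : ℝ) : ℂ) := by
  refine (h.integrable_dissipation_mul_expSymbol hr).mono
    ((Complex.continuous_ofReal.comp h.continuous_dissipation).mul
      (h.continuous_exp_neg_dissipation r)).aestronglyMeasurable (ae_of_all _ fun ξ => ?_)
  rw [norm_mul, norm_mul, norm_expSymbol, Complex.norm_of_nonneg (Real.exp_nonneg _)]

lemma wnorm_dissipation_mul_exp_le (h : IsScaledSymbol ψ w p q β C) {r : ℝ} (hr : 0 < r) :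
    wnorm (scaleWeight β (scale w r)) (fun ξ => (dissipation ψ ξ : ℂ) *
      ((Real.exp (-(r * dissipation ψ ξ)) : ℝ) : ℂ)) ≤ ENNReal.ofReal (2 * C ^ 2 / r) := by
  have hr2 : 0 < r / 2 := by positivity
  simp only [h.exp_neg_dissipation_eq, ← mul_assoc]
  refine (h.wnorm_anti hr2 (by linarith) _).trans ?_
  have h1 := h.wnorm_expSymbol_neg_le hr2
  refine (wnorm_mul_le (h.isWeight hr2) (h.integrable_dissipation_mul_expSymbol hr2)
    ((Complex.continuous_ofReal.comp h.continuous_dissipation).mul (h.continuous_expSymbol _))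
    (h.integrable_expSymbol hr2).comp_neg ((h.continuous_expSymbol _).comp continuous_neg)
    (h1.trans_lt ENNReal.ofReal_lt_top).ne).trans ?_
  have hC := h.pos_C
  rw [show 2 * C ^ 2 / r = C / (r / 2) * C by field_simp, ENNReal.ofReal_mul (by positivity)]
  exact mul_le_mul' (h.wnorm_dissipation_mul_expSymbol_le hr2) h1

end IsScaledSymbol

end LevyKernel

end

/-! ### The square root of the dissipation by subordination -/

noncomputable section

namespace LevyKernel

variable {V : Type*} [NormedAddCommGroup V] [InnerProductSpace ℝ V]
    [FiniteDimensional ℝ V] [MeasurableSpace V] [BorelSpace V]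

/-- Subordination formula for the square root. -/
lemma integral_rpow_neg_half_mul_exp {x : ℝ} (hx : 0 ≤ x) :
    ∫ r in Ioi (0 : ℝ), r ^ (-(1 / 2) : ℝ) * (x * Real.exp (-(r * x))) =
      √Real.pi * x ^ (1 / 2 : ℝ) := by
  rcases hx.eq_or_lt with rfl | hx
  · simp
  have h := Real.integral_rpow_mul_exp_neg_mul_Ioi (a := 1 / 2) (by norm_num) hx
  rw [Real.Gamma_one_half_eq, show (1 / 2 - 1 : ℝ) = -(1 / 2) by norm_num] at h
  calc _ = ∫ r in Ioi (0 : ℝ), x * (r ^ (-(1 / 2) : ℝ) * Real.exp (-(x * r))) := by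
        congr 1; ext r; rw [mul_comm r x]; ring
    _ = _ := by
        rw [integral_const_mul, h, one_div x, Real.inv_rpow hx.le, ← mul_assoc, mul_comm (√Real.pi)]
        congr 1
        rw [← Real.rpow_neg hx.le]
        nth_rewrite 1 [← Real.rpow_one x]
        rw [← Real.rpow_add hx]; norm_num

lemma integrableOn_rpow_neg_half_mul_exp {x : ℝ} (hx : 0 ≤ x) :
    IntegrableOn (fun r : ℝ => r ^ (-(1 / 2) : ℝ) * (x * Real.exp (-(r * x)))) (Ioi 0) := by
  rcases hx.eq_or_lt with rfl | hx
  · simp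
  have h := integrableOn_rpow_mul_exp_neg_mul_rpow (p := 1) (s := -(1 / 2)) (b := x)
    (by norm_num) one_pos hx
  refine (h.const_mul x).congr (ae_of_all _ fun r => ?_)
  simp only [Real.rpow_one]
  rw [mul_comm r x]; ring_nf

namespace IsScaledSymbol

variable {ψ : V → ℂ} {w : ℝ → ℝ} {p q β C : ℝ}

lemma integrable_rootSymbol (h : IsScaledSymbol ψ w p q β C) {t : ℝ} (ht : 0 < t) :
    Integrable (rootSymbol ψ t) := by
  refine (((h.integrable_expSymbol ht).norm.add
    (h.integrable_dissipation_mul_expSymbol ht).norm)).mono'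
    (h.continuous_rootSymbol t).aestronglyMeasurable (ae_of_all _ fun ξ => ?_)
  have hx := h.dissipation_nonneg ξ
  simp only [Pi.add_apply, rootSymbol, norm_mul, Complex.norm_real, Real.norm_eq_abs]
  rw [abs_of_nonneg hx, abs_of_nonneg (Real.rpow_nonneg hx _), ← one_add_mul]
  gcongr
  -- √x ≤ 1 + x: integrability is interpolated between the multipliers without and with the
  -- dissipation.
  rw [← Real.sqrt_eq_rpow]
  nlinarith [Real.sq_sqrt hx, sq_nonneg (√(dissipation ψ ξ) - 1), Real.sqrt_nonneg (dissipation ψ ξ)]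

/-- The integrand in the subordination formula for `rootSymbol`. -/
def subordinationIntegrand (ψ : V → ℂ) (t r : ℝ) (ξ : V) : ℂ :=
  ((r ^ (-(1 / 2) : ℝ) : ℝ) : ℂ) *
    ((dissipation ψ ξ : ℂ) * ((Real.exp (-(r * dissipation ψ ξ)) : ℝ) : ℂ) * expSymbol ψ t ξ)

lemma subordinationIntegrand_eq (ψ : V → ℂ) (t r : ℝ) (ξ : V) :
    subordinationIntegrand ψ t r ξ = ((r ^ (-(1 / 2) : ℝ) *
      (dissipation ψ ξ * Real.exp (-(r * dissipation ψ ξ))) : ℝ) : ℂ) * expSymbol ψ t ξ := by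
  rw [subordinationIntegrand]; push_cast; ring

lemma rootSymbol_eq_integral (h : IsScaledSymbol ψ w p q β C) (t : ℝ) (ξ : V) :
    rootSymbol ψ t ξ = ((√Real.pi)⁻¹ : ℝ) *
      ∫ r in Ioi (0 : ℝ), subordinationIntegrand ψ t r ξ := by
  have hpi : √Real.pi ≠ 0 := (Real.sqrt_pos.2 Real.pi_pos).ne'
  simp only [subordinationIntegrand_eq]
  rw [integral_mul_const, integral_complex_ofReal,
    integral_rpow_neg_half_mul_exp (h.dissipation_nonneg ξ), rootSymbol, ← mul_assoc,
    ← Complex.ofReal_mul, ← mul_assoc, inv_mul_cancel₀ hpi, one_mul]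

lemma stronglyMeasurable_subordinationIntegrand (h : IsScaledSymbol ψ w p q β C) (t : ℝ) :
    StronglyMeasurable (Function.uncurry (subordinationIntegrand ψ t)) := by
  have h1 := h.continuous_dissipation
  have h2 := h.continuous_expSymbol t
  have h3 : Continuous fun z : ℝ × V => (dissipation ψ z.2 : ℂ) *
      ((Real.exp (-(z.1 * dissipation ψ z.2)) : ℝ) : ℂ) * expSymbol ψ t z.2 := by fun_prop
  refine Measurable.stronglyMeasurable ?_
  refine Measurable.mul ?_ h3.measurable
  exact Complex.measurable_ofReal.comp (measurable_fst.pow_const _)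

lemma norm_subordinationIntegrand (h : IsScaledSymbol ψ w p q β C) (t : ℝ) {r : ℝ} (hr : 0 ≤ r)
    (ξ : V) : ‖subordinationIntegrand ψ t r ξ‖ = (r ^ (-(1 / 2) : ℝ) *
      (dissipation ψ ξ * Real.exp (-(r * dissipation ψ ξ)))) * ‖expSymbol ψ t ξ‖ := by
  have hx := h.dissipation_nonneg ξ
  rw [subordinationIntegrand_eq, norm_mul, Complex.norm_of_nonneg (by positivity)]

/-- Integrating the norm in r first gives exactly √π times the norm of the root symbol, which is
already known to be integrable. -/
lemma integrable_subordinationIntegrand (h : IsScaledSymbol ψ w p q β C) {t : ℝ} (ht : 0 < t) :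
    Integrable (Function.uncurry (subordinationIntegrand ψ t))
      ((volume.restrict (Ioi 0)).prod volume) := by
  rw [integrable_prod_iff' (h.stronglyMeasurable_subordinationIntegrand t).aestronglyMeasurable]
  constructor
  · refine ae_of_all _ fun ξ => ?_
    simp only [Function.uncurry, subordinationIntegrand_eq]
    exact ((integrableOn_rpow_neg_half_mul_exp (h.dissipation_nonneg ξ)).ofReal).mul_const _
  · refine ((h.integrable_rootSymbol ht).norm.const_mul √Real.pi).congr (ae_of_all _ fun ξ => ?_)
    have hx := h.dissipation_nonneg ξ
    simp only [Function.uncurry]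
    rw [setIntegral_congr_fun measurableSet_Ioi
      (fun r hr => h.norm_subordinationIntegrand t (le_of_lt hr) ξ), integral_mul_const,
      integral_rpow_neg_half_mul_exp hx, rootSymbol, norm_mul, Complex.norm_of_nonneg (by positivity)]
    ring

/-- The weighted norm of `(-Re ψ)^(1/2) exp (t ψ)` is of order `t^(-1/2)`. -/
lemma wnorm_rootSymbol_le (h : IsScaledSymbol ψ w p q β C) {t : ℝ} (ht : 0 < t) :
    wnorm (scaleWeight β (scale w t)) (rootSymbol ψ t) ≤
      ENNReal.ofReal ((2 * C ^ 3 + 8 * C ^ 4) * t ^ (-(1 / 2) : ℝ)) := by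
  have hC := h.pos_C
  have hW := h.isWeight ht
  have hpi : (√Real.pi)⁻¹ ≤ 1 := inv_le_one_of_one_le₀ (by
    rw [Real.one_le_sqrt]; linarith [Real.pi_gt_three])
  have hint := h.integrable_subordinationIntegrand ht
  have hcd : Continuous fun ξ => (dissipation ψ ξ : ℂ) :=
    Complex.continuous_ofReal.comp h.continuous_dissipation
  have hde : ∀ r, Continuous fun ξ => (dissipation ψ ξ : ℂ) *
      ((Real.exp (-(r * dissipation ψ ξ)) : ℝ) : ℂ) := fun r =>
    hcd.mul (h.continuous_exp_neg_dissipation r)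
  have hprod : ∀ r, 0 < r → Integrable fun ξ => (dissipation ψ ξ : ℂ) *
      ((Real.exp (-(r * dissipation ψ ξ)) : ℝ) : ℂ) * expSymbol ψ t ξ := fun r hr =>
    (h.integrable_dissipation_mul_exp hr).mono
      ((hde r).mul (h.continuous_expSymbol t)).aestronglyMeasurable (ae_of_all _ fun ξ => by
        rw [norm_mul _ (expSymbol ψ t ξ), norm_expSymbol]
        refine mul_le_of_le_one_right (norm_nonneg _) ?_
        rw [Real.exp_le_one_iff, neg_nonpos]
        exact mul_nonneg ht.le (h.dissipation_nonneg ξ))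
  have hr1 : ∀ r, 0 < r → wnorm (scaleWeight β (scale w t)) (subordinationIntegrand ψ t r) =
      ENNReal.ofReal (r ^ (-(1 / 2) : ℝ)) * wnorm (scaleWeight β (scale w t)) (fun ξ =>
        (dissipation ψ ξ : ℂ) * ((Real.exp (-(r * dissipation ψ ξ)) : ℝ) : ℂ) *
          expSymbol ψ t ξ) := fun r hr => by
    unfold subordinationIntegrand
    rw [wnorm_const_mul _ (hprod r hr) hW.measurable, ← ofReal_norm,
      Complex.norm_of_nonneg (by positivity)]
  -- For r ≤ t the dissipation is paired with exp(tψ), at cost C/t. The factor exp(-r·dissipation)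
  -- is merely bounded, so r^(-1/2) remains and is integrable at 0.
  have hsmall : ∀ r ∈ Ioc 0 t, wnorm (scaleWeight β (scale w t)) (subordinationIntegrand ψ t r) ≤
      ENNReal.ofReal (C ^ 3 / t * r ^ (-(1 / 2) : ℝ)) := by
    rintro r ⟨hr, hrt⟩
    have h1 := (h.wnorm_anti hr hrt _).trans (h.wnorm_exp_neg_dissipation_le hr)
    have e : (fun ξ => (dissipation ψ ξ : ℂ) * ((Real.exp (-(r * dissipation ψ ξ)) : ℝ) : ℂ) *
          expSymbol ψ t ξ) = fun ξ => ((dissipation ψ ξ : ℂ) * expSymbol ψ t ξ) *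
          ((Real.exp (-(r * dissipation ψ ξ)) : ℝ) : ℂ) := by ext ξ; ring
    rw [hr1 r hr, e]
    calc _ ≤ ENNReal.ofReal (r ^ (-(1 / 2) : ℝ)) *
          (ENNReal.ofReal (C / t) * ENNReal.ofReal (C ^ 2)) := by
          gcongr
          refine (wnorm_mul_le hW (h.integrable_dissipation_mul_expSymbol ht)
            (hcd.mul (h.continuous_expSymbol t)) (h.integrable_exp_neg_dissipation hr)
            (h.continuous_exp_neg_dissipation r) (h1.trans_lt ENNReal.ofReal_lt_top).ne).trans ?_
          exact mul_le_mul' (h.wnorm_dissipation_mul_expSymbol_le ht) h1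
      _ = _ := by
          rw [← ENNReal.ofReal_mul (by positivity), ← ENNReal.ofReal_mul (by positivity)]
          congr 1; ring
  -- For r > t the dissipation is paired with exp(-r·dissipation), at cost of order 1/r. Passing to
  -- the weight of time t loses (r/t)^(1/4), and r^(-1/2 - 1 + 1/4) = r^(-5/4) is integrable at
  -- infinity.
  have hlarge : ∀ r ∈ Ioi t, wnorm (scaleWeight β (scale w t)) (subordinationIntegrand ψ t r) ≤
      ENNReal.ofReal (2 * C ^ 4 * t ^ (-(1 / 4) : ℝ) * r ^ (-(5 / 4) : ℝ)) := by
    intro r hrt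
    rw [mem_Ioi] at hrt
    have hr : 0 < r := ht.trans hrt
    have h1 := (h.wnorm_le_mul ht hrt.le (h.integrable_dissipation_mul_exp hr)).trans
      (mul_le_mul_right (h.wnorm_dissipation_mul_exp_le hr) _)
    have h2 := h.wnorm_expSymbol_le ht
    rw [hr1 r hr]
    calc _ ≤ ENNReal.ofReal (r ^ (-(1 / 2) : ℝ)) *
          (ENNReal.ofReal (C * (r / t) ^ (1 / 4 : ℝ)) * ENNReal.ofReal (2 * C ^ 2 / r) *
            ENNReal.ofReal C) := by
          gcongr
          exact (wnorm_mul_le hW (h.integrable_dissipation_mul_exp hr) (hde r)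
            (h.integrable_expSymbol ht) (h.continuous_expSymbol t)
            (h2.trans_lt ENNReal.ofReal_lt_top).ne).trans (mul_le_mul' h1 h2)
      _ = _ := by
          rw [← ENNReal.ofReal_mul (by positivity), ← ENNReal.ofReal_mul (by positivity),
            ← ENNReal.ofReal_mul (by positivity)]
          congr 1
          rw [Real.div_rpow hr.le ht.le, Real.rpow_neg ht.le,
            show (-(5 / 4) : ℝ) = -(1 / 2) + 1 / 4 + -1 by norm_num, Real.rpow_add hr,
            Real.rpow_add hr, Real.rpow_neg_one]
          ring
  have e : rootSymbol ψ t = fun ξ => (((√Real.pi)⁻¹ : ℝ) : ℂ) *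
      ∫ r in Ioi (0 : ℝ), subordinationIntegrand ψ t r ξ := funext (h.rootSymbol_eq_integral t)
  have hint2 : Integrable fun ξ => ∫ r in Ioi (0 : ℝ), subordinationIntegrand ψ t r ξ :=
    hint.integral_prod_right
  rw [e, wnorm_const_mul _ hint2 hW.measurable, ← ofReal_norm,
    Complex.norm_of_nonneg (by positivity)]
  calc _ ≤ 1 * ∫⁻ r in Ioi (0 : ℝ), wnorm (scaleWeight β (scale w t))
          (subordinationIntegrand ψ t r) := by
        gcongr
        · simpa using hpi
        · exact wnorm_integral_le hW.measurable (h.stronglyMeasurable_subordinationIntegrand t) hint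
    _ ≤ (∫⁻ r in Ioc 0 t, ENNReal.ofReal (C ^ 3 / t * r ^ (-(1 / 2) : ℝ))) +
        ∫⁻ r in Ioi t, ENNReal.ofReal (2 * C ^ 4 * t ^ (-(1 / 4) : ℝ) * r ^ (-(5 / 4) : ℝ)) := by
        rw [one_mul, ← Ioc_union_Ioi_eq_Ioi ht.le]
        exact (lintegral_union_le _ _ _).trans (add_le_add
          (setLIntegral_mono' measurableSet_Ioc hsmall) (setLIntegral_mono' measurableSet_Ioi hlarge))
    _ = ENNReal.ofReal (2 * C ^ 3 * t ^ (-(1 / 2) : ℝ)) +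
        ENNReal.ofReal (8 * C ^ 4 * t ^ (-(1 / 2) : ℝ)) := by
        congr 1
        · have hi : IntegrableOn (fun r : ℝ => C ^ 3 / t * r ^ (-(1 / 2) : ℝ)) (Ioc 0 t) :=
            ((intervalIntegrable_iff_integrableOn_Ioc_of_le ht.le).1
              (intervalIntegral.intervalIntegrable_rpow' (by norm_num))).const_mul _
          rw [← ofReal_integral_eq_lintegral_ofReal hi, integral_const_mul,
            ← intervalIntegral.integral_of_le ht.le, integral_rpow (Or.inl (by norm_num))]
          · congr 1
            rw [show (-(1 / 2) + 1 : ℝ) = 1 / 2 by norm_num, Real.zero_rpow (by norm_num),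
              show (-(1 / 2) : ℝ) = 1 / 2 + -1 by norm_num, Real.rpow_add ht, Real.rpow_neg_one]
            field_simp; ring
          · filter_upwards [ae_restrict_mem measurableSet_Ioc] with r hr
            have := hr.1
            simp only [Pi.zero_apply]
            positivity
        · have hi : IntegrableOn (fun r : ℝ => 2 * C ^ 4 * t ^ (-(1 / 4) : ℝ) * r ^ (-(5 / 4) : ℝ))
              (Ioi t) := (integrableOn_Ioi_rpow_of_lt (by norm_num) ht).const_mul _
          rw [← ofReal_integral_eq_lintegral_ofReal hi, integral_const_mul,
            integral_Ioi_rpow_of_lt (by norm_num) ht]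
          · congr 1
            rw [show (-(5 / 4) + 1 : ℝ) = -(1 / 4) by norm_num,
              show (-(1 / 2) : ℝ) = -(1 / 4) + -(1 / 4) by norm_num, Real.rpow_add ht]
            ring
          · filter_upwards [ae_restrict_mem measurableSet_Ioi] with r hr
            have : 0 < r := ht.trans hr
            simp only [Pi.zero_apply]
            positivity
    _ = _ := by
        rw [← ENNReal.ofReal_add (by positivity) (by positivity)]
        congr 1; ring

end IsScaledSymbol

end LevyKernel

end

/-! ### L¹ moduli of continuity and tails of the undamped kernel -/

noncomputable section

namespace LevyKernel

variable {V : Type*} [NormedAddCommGroup V] [InnerProductSpace ℝ V]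
    [FiniteDimensional ℝ V] [MeasurableSpace V] [BorelSpace V]

lemma wnorm_one (m : V → ℂ) : wnorm (fun _ => 1) m = ∫⁻ x, ‖𝓕⁻ m x‖ₑ := by
  simp [wnorm]

lemma wnorm_one_le {W : V → ℝ≥0∞} (hW : IsWeight W) (m : V → ℂ) :
    wnorm (fun _ => 1) m ≤ wnorm W m := wnorm_mono hW.one_le m

lemma fourierInv_sub_apply {m₁ m₂ : V → ℂ} (h₁ : Integrable m₁) (h₂ : Integrable m₂) (x : V) :
    𝓕⁻ (fun ξ => m₁ ξ - m₂ ξ) x = 𝓕⁻ m₁ x - 𝓕⁻ m₂ x := by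
  simp only [fourierInv_eq_phase]
  rw [← integral_sub (integrable_phase_mul h₁ x) (integrable_phase_mul h₂ x)]
  congr 1; ext ξ; ring

lemma phase_sub_one_eq_integral (u : ℝ) :
    phase u - 1 = ∫ r in Ioc (0 : ℝ) 1, 2 * Real.pi * Complex.I * (phase (r * u) * (u : ℂ)) := by
  have hd : ∀ r : ℝ, HasDerivAt (fun r : ℝ => phase (r * u))
      (2 * Real.pi * Complex.I * (phase (r * u) * (u : ℂ))) r := by
    intro r
    have h1 := (hasDerivAt_phase (r * u)).scomp r ((hasDerivAt_id r).mul_const u)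
    refine h1.congr_deriv ?_
    simp only [one_mul, Complex.real_smul]; ring
  have h := intervalIntegral.integral_eq_sub_of_hasDerivAt (a := 0) (b := 1) (fun r _ => hd r)
    (Continuous.intervalIntegrable (by fun_prop) _ _)
  rw [one_mul, zero_mul, phase_zero, intervalIntegral.integral_of_le zero_le_one] at h
  exact h.symm

namespace IsScaledSymbol

variable {ψ : V → ℂ} {w : ℝ → ℝ} {p q β C : ℝ}

/-- The increment is the integral along the segment of the derivative in direction y. That
derivative has norm at most 2πC‖y‖/scale, and the intermediate translations do not change L¹ norms.
-/
lemma lintegral_translate_le (h : IsScaledSymbol ψ w p q β C) {t : ℝ} (ht : 0 < t) (y : V) :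
    wnorm (fun _ => 1) (fun ξ => (phase ⟪ξ, y⟫ - 1) * expSymbol ψ t ξ) ≤
      ENNReal.ofReal (2 * Real.pi * (C * ‖y‖ / scale w t)) := by
  have hi := h.integrable_inner_mul_expSymbol ht y
  have hcE := h.continuous_expSymbol t
  set m : ℝ → V → ℂ := fun r ξ =>
    (2 * Real.pi * Complex.I) * (phase ⟪ξ, r • y⟫ * (innerC y ξ * expSymbol ψ t ξ)) with hm
  have e : (fun ξ => (phase ⟪ξ, y⟫ - 1) * expSymbol ψ t ξ) =
      fun ξ => ∫ r in Ioc (0 : ℝ) 1, m r ξ := by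
    ext ξ
    rw [phase_sub_one_eq_integral, ← integral_mul_const]
    congr 1; ext r
    simp only [hm, innerC_apply, real_inner_smul_right, real_inner_comm ξ y]; ring
  have hcont : Continuous (Function.uncurry m) := by
    unfold Function.uncurry
    simp only [hm]
    fun_prop
  have hjoint : Integrable (Function.uncurry m) ((volume.restrict (Ioc (0 : ℝ) 1)).prod volume) := by
    refine Integrable.const_mul ?_ _
    refine (hi.comp_snd (volume.restrict (Ioc (0 : ℝ) 1))).bdd_mul (c := 1) ?_
      (ae_of_all _ fun z => by simp)
    exact (by fun_prop : Continuous fun z : ℝ × V => phase ⟪z.2, z.1 • y⟫).aestronglyMeasurable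
  rw [e]
  refine (wnorm_integral_le measurable_const hcont.stronglyMeasurable hjoint).trans ?_
  have hb : ∀ r : ℝ, wnorm (fun _ => 1) (m r) ≤
      ENNReal.ofReal (2 * Real.pi * (C * ‖y‖ / scale w t)) := by
    intro r
    have h1 := wnorm_phase_mul_le isWeight_one hi (r • y)
    rw [one_mul] at h1
    simp only [hm]
    rw [wnorm_const_mul _ (integrable_phase_mul hi (r • y)) measurable_const, ← ofReal_norm,
      norm_two_pi_I,
      ENNReal.ofReal_mul (p := 2 * Real.pi) (by positivity)]
    refine mul_le_mul_right (h1.trans ((wnorm_one_le (h.isWeight ht) _).trans ?_)) _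
    exact h.wnorm_inner_mul_expSymbol_le ht y
  calc _ ≤ ∫⁻ _ in Ioc (0 : ℝ) 1, ENNReal.ofReal (2 * Real.pi * (C * ‖y‖ / scale w t)) :=
        lintegral_mono hb
    _ = _ := by simp

/-- Integrate the time derivative ψ exp(uψ), of norm at most C/u ≤ C/s, over [s, t]. -/
lemma lintegral_expSymbol_sub_le (h : IsScaledSymbol ψ w p q β C) {s t : ℝ} (hs : 0 < s)
    (hst : s ≤ t) :
    wnorm (fun _ => 1) (fun ξ => expSymbol ψ t ξ - expSymbol ψ s ξ) ≤
      ENNReal.ofReal (C / s * (t - s)) := by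
  have hC := h.pos_C
  have hcψ := h.continuous
  set m : ℝ → V → ℂ := fun u ξ => ψ ξ * expSymbol ψ u ξ with hm
  have hcont2 : Continuous (Function.uncurry m) := by
    unfold Function.uncurry
    simp only [hm, expSymbol]
    fun_prop
  have e : (fun ξ => expSymbol ψ t ξ - expSymbol ψ s ξ) = fun ξ => ∫ u in Ioc s t, m u ξ := by
    ext ξ
    have hd : ∀ u : ℝ, HasDerivAt (fun u : ℝ => expSymbol ψ u ξ) (m u ξ) u := by
      intro u
      have h1 : HasDerivAt (fun u : ℝ => (u : ℂ) * ψ ξ) (ψ ξ) u := by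
        simpa using (Complex.ofRealCLM.hasDerivAt (x := u)).mul_const (ψ ξ)
      exact h1.cexp.congr_deriv (by simp only [hm, expSymbol]; ring)
    have hcu : Continuous fun u => m u ξ :=
      hcont2.comp (by fun_prop : Continuous fun u : ℝ => (u, ξ))
    rw [← intervalIntegral.integral_of_le hst]
    exact (intervalIntegral.integral_eq_sub_of_hasDerivAt (fun u _ => hd u)
      (hcu.intervalIntegrable _ _)).symm
  have hjoint : Integrable (Function.uncurry m) ((volume.restrict (Ioc s t)).prod volume) := by
    refine ((h.integrable_mul_expSymbol hs).comp_snd (volume.restrict (Ioc s t))).mono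
      hcont2.aestronglyMeasurable ?_
    have hae : ∀ᵐ z ∂((volume.restrict (Ioc s t)).prod (volume : Measure V)), z.1 ∈ Ioc s t :=
      Measure.quasiMeasurePreserving_fst.ae (ae_restrict_mem measurableSet_Ioc)
    filter_upwards [hae] with z hz
    simp only [Function.uncurry, hm, norm_mul, norm_expSymbol]
    have := h.dissipation_nonneg z.2
    have := hz.1.le
    gcongr
  rw [e]
  refine (wnorm_integral_le measurable_const hcont2.stronglyMeasurable hjoint).trans ?_
  calc _ ≤ ∫⁻ _ in Ioc s t, ENNReal.ofReal (C / s) := by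
        refine setLIntegral_mono' measurableSet_Ioc fun u hu => ?_
        have hu0 : 0 < u := hs.trans hu.1
        refine (wnorm_one_le (h.isWeight hu0) _).trans ((h.wnorm_mul_expSymbol_le hu0).trans ?_)
        refine ENNReal.ofReal_le_ofReal ?_
        have := hu.1.le
        gcongr
    _ = _ := by
        rw [setLIntegral_const, Real.volume_Ioc, ← ENNReal.ofReal_mul (by positivity)]

/-- The constant in the bound for `rootSymbol`. -/
def rootConst (C : ℝ) : ℝ := 2 * C ^ 3 + 8 * C ^ 4

lemma rootConst_pos (h : IsScaledSymbol ψ w p q β C) : 0 < rootConst C := by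
  have := h.pos_C
  unfold rootConst; positivity

lemma rootSymbol_add (ψ : V → ℂ) (s t : ℝ) (ξ : V) :
    rootSymbol ψ (s + t) ξ = expSymbol ψ s ξ * rootSymbol ψ t ξ := by
  rw [rootSymbol, rootSymbol, expSymbol_add]; ring

lemma wnorm_one_rootSymbol_le (h : IsScaledSymbol ψ w p q β C) {t : ℝ} (ht : 0 < t) :
    wnorm (fun _ => 1) (rootSymbol ψ t) ≤ ENNReal.ofReal (rootConst C * t ^ (-(1 / 2) : ℝ)) :=
  (wnorm_one_le (h.isWeight ht) _).trans (h.wnorm_rootSymbol_le ht)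

lemma half_rpow_le {t : ℝ} (ht : 0 < t) :
    (t / 2) ^ (-(1 / 2) : ℝ) ≤ 2 * t ^ (-(1 / 2) : ℝ) := by
  rw [Real.div_rpow ht.le two_pos.le, div_eq_mul_inv, mul_comm]
  gcongr
  rw [← Real.rpow_neg two_pos.le, neg_neg]
  calc (2 : ℝ) ^ (1 / 2 : ℝ) ≤ 2 ^ (1 : ℝ) :=
        Real.rpow_le_rpow_of_exponent_le one_le_two (by norm_num)
    _ = 2 := Real.rpow_one 2

/-- The device for both moduli of continuity: one half of the time carries the square root and
yields t^(-1/2), while the other half stays in m and carries the increment. -/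
lemma wnorm_one_mul_rootSymbol_le (h : IsScaledSymbol ψ w p q β C) {t : ℝ} (ht : 0 < t)
    {m : V → ℂ} (hm : Integrable m) (hc : Continuous m) {B : ℝ} (hB0 : 0 ≤ B)
    (hB : wnorm (fun _ => 1) m ≤ ENNReal.ofReal B) :
    wnorm (fun _ => 1) (fun ξ => m ξ * rootSymbol ψ (t / 2) ξ) ≤
      ENNReal.ofReal (2 * rootConst C * t ^ (-(1 / 2) : ℝ) * B) := by
  have ht2 : 0 < t / 2 := by positivity
  have h1 := h.wnorm_one_rootSymbol_le ht2
  refine (wnorm_mul_le isWeight_one hm hc (h.integrable_rootSymbol ht2)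
    (h.continuous_rootSymbol _) (h1.trans_lt ENNReal.ofReal_lt_top).ne).trans
    ((mul_le_mul' hB h1).trans ?_)
  rw [← ENNReal.ofReal_mul hB0]
  refine ENNReal.ofReal_le_ofReal ?_
  have := h.rootConst_pos
  calc B * (rootConst C * (t / 2) ^ (-(1 / 2) : ℝ))
      ≤ B * (rootConst C * (2 * t ^ (-(1 / 2) : ℝ))) := by gcongr; exact half_rpow_le ht
    _ = _ := by ring

/-- `L¹` modulus of continuity in space. -/
lemma lintegral_rootKernel_translate_le (h : IsScaledSymbol ψ w p q β C) {t : ℝ} (ht : 0 < t)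
    (y : V) :
    ∫⁻ x, ‖𝓕⁻ (rootSymbol ψ t) (x - y) - 𝓕⁻ (rootSymbol ψ t) x‖ₑ ≤
      ENNReal.ofReal (4 * Real.pi * C * rootConst C * t ^ (-(1 / 2) : ℝ) *
        (‖y‖ / scale w (t / 2))) := by
  have ht2 : 0 < t / 2 := by positivity
  have hC := h.pos_C
  have hs := h.scale_pos ht2
  have hr := h.integrable_rootSymbol ht
  have e : ∀ x, 𝓕⁻ (rootSymbol ψ t) (x - y) - 𝓕⁻ (rootSymbol ψ t) x =
      𝓕⁻ (fun ξ => (phase ⟪ξ, -y⟫ - 1) * expSymbol ψ (t / 2) ξ * rootSymbol ψ (t / 2) ξ) x := by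
    intro x
    rw [sub_eq_add_neg x y, ← fourierInv_phase_mul,
      ← fourierInv_sub_apply (integrable_phase_mul hr (-y)) hr]
    refine congrArg (fun m : V → ℂ => 𝓕⁻ m x) (funext fun ξ => ?_)
    rw [mul_assoc, ← rootSymbol_add, add_halves]; ring
  simp only [e]
  rw [← wnorm_one]
  have hi := h.integrable_expSymbol ht2
  have hce := h.continuous_expSymbol (t / 2)
  refine (h.wnorm_one_mul_rootSymbol_le ht (B := 2 * Real.pi * (C * ‖-y‖ / scale w (t / 2)))
    (((integrable_phase_mul hi (-y)).sub hi).congr (ae_of_all _ fun ξ => ?_)) (by fun_prop)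
    (by positivity) (h.lintegral_translate_le ht2 (-y))).trans (le_of_eq ?_)
  · simp only [Pi.sub_apply]; ring
  · rw [norm_neg]; congr 1; ring

/-- `L¹` modulus of continuity in time. -/
lemma lintegral_rootKernel_sub_le (h : IsScaledSymbol ψ w p q β C) {s t : ℝ} (hs : 0 < s)
    (hst : s ≤ t) :
    ∫⁻ x, ‖𝓕⁻ (rootSymbol ψ t) x - 𝓕⁻ (rootSymbol ψ s) x‖ₑ ≤
      ENNReal.ofReal (4 * C * rootConst C * s ^ (-(1 / 2) : ℝ) * ((t - s) / s)) := by
  have hs2 : 0 < s / 2 := by positivity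
  have hts : 0 < t - s / 2 := by linarith
  have hC := h.pos_C
  have e : ∀ x, 𝓕⁻ (rootSymbol ψ t) x - 𝓕⁻ (rootSymbol ψ s) x = 𝓕⁻ (fun ξ =>
      (expSymbol ψ (t - s / 2) ξ - expSymbol ψ (s / 2) ξ) * rootSymbol ψ (s / 2) ξ) x := by
    intro x
    rw [← fourierInv_sub_apply (h.integrable_rootSymbol (hs.trans_le hst))
      (h.integrable_rootSymbol hs)]
    refine congrArg (fun m : V → ℂ => 𝓕⁻ m x) (funext fun ξ => ?_)
    rw [sub_mul, ← rootSymbol_add, ← rootSymbol_add, add_halves, sub_add_cancel]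
  simp only [e]
  rw [← wnorm_one]
  have h1 := h.lintegral_expSymbol_sub_le hs2 (by linarith : s / 2 ≤ t - s / 2)
  refine (h.wnorm_one_mul_rootSymbol_le hs
    ((h.integrable_expSymbol hts).sub (h.integrable_expSymbol hs2))
    ((h.continuous_expSymbol _).sub (h.continuous_expSymbol _)) ?_ h1).trans (le_of_eq ?_)
  · have : 0 ≤ t - s / 2 - s / 2 := by linarith
    positivity
  · congr 1
    rw [show t - s / 2 - s / 2 = t - s by ring]
    field_simp; ring

lemma lintegral_rootKernel_le (h : IsScaledSymbol ψ w p q β C) {t : ℝ} (ht : 0 < t) :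
    ∫⁻ x, ‖𝓕⁻ (rootSymbol ψ t) x‖ₑ ≤ ENNReal.ofReal (rootConst C * t ^ (-(1 / 2) : ℝ)) := by
  rw [← wnorm_one]
  exact h.wnorm_one_rootSymbol_le ht

/-- Tails in space. -/
lemma lintegral_rootKernel_tail_le (h : IsScaledSymbol ψ w p q β C) {t : ℝ} (ht : 0 < t)
    {r : ℝ} (hr : 0 < r) :
    ∫⁻ x in {x : V | r ≤ ‖x‖}, ‖𝓕⁻ (rootSymbol ψ t) x‖ₑ ≤
      ENNReal.ofReal (rootConst C * t ^ (-(1 / 2) : ℝ) * (scale w t / r) ^ β) := by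
  have hs := h.scale_pos ht
  have hβ := h.pos_β
  have hK := h.rootConst_pos
  have hms : MeasurableSet {x : V | r ≤ ‖x‖} := measurableSet_le measurable_const measurable_norm
  calc ∫⁻ x in {x : V | r ≤ ‖x‖}, ‖𝓕⁻ (rootSymbol ψ t) x‖ₑ
      ≤ ∫⁻ x in {x : V | r ≤ ‖x‖}, ENNReal.ofReal ((scale w t / r) ^ β) *
          (scaleWeight β (scale w t) x * ‖𝓕⁻ (rootSymbol ψ t) x‖ₑ) := by
        refine setLIntegral_mono' hms fun x hx => ?_
        rw [mem_ofPred_eq] at hx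
        rw [← mul_assoc]
        -- Chebyshev's inequality: on ‖x‖ ≥ r the weight is at least (r / scale)^β.
        refine le_mul_of_one_le_left' ?_
        rw [scaleWeight, ← ENNReal.ofReal_mul (by positivity), ENNReal.one_le_ofReal,
          ← Real.mul_rpow (by positivity) (by positivity)]
        refine Real.one_le_rpow ?_ hβ.le
        rw [div_mul_eq_mul_div, one_le_div hr, mul_add, mul_div_cancel₀ _ hs.ne']
        linarith
    _ ≤ ENNReal.ofReal ((scale w t / r) ^ β) *
          wnorm (scaleWeight β (scale w t)) (rootSymbol ψ t) := by
        rw [lintegral_const_mul' _ _ ENNReal.ofReal_ne_top]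
        exact mul_le_mul_right (setLIntegral_le_lintegral _ _) _
    _ ≤ _ := by
        refine (mul_le_mul_right (h.wnorm_rootSymbol_le ht) _).trans (le_of_eq ?_)
        rw [← ENNReal.ofReal_mul (by positivity), mul_comm, rootConst]

end IsScaledSymbol

end LevyKernel

end

/-! ### Damping, cut-off and comparison of scales -/

noncomputable section

namespace LevyKernel

variable {V : Type*} [NormedAddCommGroup V] [InnerProductSpace ℝ V]
    [FiniteDimensional ℝ V] [MeasurableSpace V] [BorelSpace V]

/-- The damped kernel with symbol `(-Re ψ)^(1/2) exp (t (ψ - lam))`, cut off at times below `ε`. -/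
def rootKernel (ψ : V → ℂ) (lam ε t : ℝ) (x : V) : ℂ :=
  if ε ≤ t then ((Real.exp (-lam * t) : ℝ) : ℂ) * 𝓕⁻ (rootSymbol ψ t) x else 0

section Pointwise

variable {ψ : V → ℂ} {lam ε : ℝ}

lemma enorm_ofReal_mul_le {c : ℝ} (h0 : 0 ≤ c) (h1 : c ≤ 1) (z : ℂ) : ‖(c : ℂ) * z‖ₑ ≤ ‖z‖ₑ := by
  rw [enorm_mul, ← ofReal_norm (c : ℂ), Complex.norm_of_nonneg h0]
  exact mul_le_of_le_one_left' (by simpa using h1)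

lemma exp_neg_mul_le_one (hlam : 0 ≤ lam) {t : ℝ} (ht : 0 ≤ t) : Real.exp (-lam * t) ≤ 1 := by
  rw [Real.exp_le_one_iff]; nlinarith

lemma rootKernel_of_nonpos (hε : 0 < ε) {t : ℝ} (ht : t ≤ 0) (x : V) :
    rootKernel ψ lam ε t x = 0 := if_neg (by linarith)

lemma enorm_rootKernel_le (hlam : 0 ≤ lam) {t : ℝ} (ht : 0 ≤ t) (x : V) :
    ‖rootKernel ψ lam ε t x‖ₑ ≤ ‖𝓕⁻ (rootSymbol ψ t) x‖ₑ := by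
  unfold rootKernel
  split_ifs
  · exact enorm_ofReal_mul_le (Real.exp_nonneg _) (exp_neg_mul_le_one hlam ht) _
  · simp

lemma enorm_rootKernel_translate_le (hlam : 0 ≤ lam) {t : ℝ} (ht : 0 ≤ t) (x y : V) :
    ‖rootKernel ψ lam ε t (x - y) - rootKernel ψ lam ε t x‖ₑ ≤
      ‖𝓕⁻ (rootSymbol ψ t) (x - y) - 𝓕⁻ (rootSymbol ψ t) x‖ₑ := by
  unfold rootKernel
  split_ifs
  · rw [← mul_sub]
    exact enorm_ofReal_mul_le (Real.exp_nonneg _) (exp_neg_mul_le_one hlam ht) _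
  · simp

/-- Since lam·s·exp(-lam·s) ≤ 1, the damping varies by at most the same relative increment (t - s)/s
as the kernel. This is what makes the final constants independent of lam. -/
lemma abs_exp_sub_exp_le (hlam : 0 ≤ lam) {s t : ℝ} (hs : 0 < s) (hst : s ≤ t) :
    |Real.exp (-lam * t) - Real.exp (-lam * s)| ≤ (t - s) / s := by
  have h1 : Real.exp (-lam * t) = Real.exp (-lam * s) * Real.exp (-(lam * (t - s))) := by
    rw [← Real.exp_add]; congr 1; ring
  have h2 : 1 - lam * (t - s) ≤ Real.exp (-(lam * (t - s))) := by
    have := Real.add_one_le_exp (-(lam * (t - s))); linarith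
  have h3 : Real.exp (-(lam * (t - s))) ≤ 1 := by
    rw [Real.exp_le_one_iff]; nlinarith
  have h4 : Real.exp (-lam * s) * (lam * s) ≤ 1 := by
    have h5 := Real.add_one_le_exp (lam * s)
    have h6 : Real.exp (-lam * s) * Real.exp (lam * s) = 1 := by
      rw [← Real.exp_add]; simp
    have := Real.exp_pos (-lam * s)
    nlinarith
  have h0 := Real.exp_pos (-lam * s)
  rw [abs_sub_comm, abs_of_nonneg (by rw [h1]; nlinarith), h1, le_div_iff₀ hs]
  have h7 : 0 ≤ t - s := by linarith
  calc (Real.exp (-lam * s) - Real.exp (-lam * s) * Real.exp (-(lam * (t - s)))) * s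
      = Real.exp (-lam * s) * (1 - Real.exp (-(lam * (t - s)))) * s := by ring
    _ ≤ Real.exp (-lam * s) * (lam * (t - s)) * s := by gcongr; linarith
    _ = Real.exp (-lam * s) * (lam * s) * (t - s) := by ring
    _ ≤ 1 * (t - s) := by gcongr
    _ = t - s := one_mul _

end Pointwise

namespace IsScaledSymbol

variable {ψ : V → ℂ} {w : ℝ → ℝ} {p q β C : ℝ} {lam ε : ℝ}

lemma measurable_enorm_rootKernel_sub (h : IsScaledSymbol ψ w p q β C) (hε : 0 < ε) (s t : ℝ)
    (y z : V) :
    Measurable fun x => ‖rootKernel ψ lam ε s (x - y) - rootKernel ψ lam ε t (x - z)‖ₑ := by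
  have hk : ∀ t, Measurable fun x => rootKernel ψ lam ε t x := by
    intro t
    unfold rootKernel
    split_ifs with ht
    · exact (continuous_fourierInv (h.integrable_rootSymbol (hε.trans_le ht))).measurable.const_mul _
    · exact measurable_const
  exact (((hk s).comp (measurable_id.sub_const y)).sub ((hk t).comp (measurable_id.sub_const z))).enorm

open scoped Classical in
/-- `L¹` modulus of continuity in time for the damped kernel. -/
lemma lintegral_rootKernel_time_le (h : IsScaledSymbol ψ w p q β C) (hlam : 0 ≤ lam) {s t : ℝ}
    (hs : 0 < s) (hst : s ≤ t) :
    ∫⁻ x, ‖rootKernel ψ lam ε t x - rootKernel ψ lam ε s x‖ₑ ≤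
      ENNReal.ofReal ((4 * C + 1) * rootConst C * s ^ (-(1 / 2) : ℝ) *
        ((t - s) / s + if s < ε ∧ ε ≤ t then 1 else 0)) := by
  have ht : 0 < t := hs.trans_le hst
  have hC := h.pos_C
  have hR := h.rootConst_pos
  have hd : 0 ≤ (t - s) / s := div_nonneg (by linarith) hs.le
  have hs2 : (0 : ℝ) < s ^ (-(1 / 2) : ℝ) := by positivity
  by_cases h1 : ε ≤ s
  · have h2 : ¬(s < ε ∧ ε ≤ t) := fun h' => by linarith [h'.1]
    rw [if_neg h2, add_zero]
    have hms : Measurable fun x => ‖𝓕⁻ (rootSymbol ψ t) x - 𝓕⁻ (rootSymbol ψ s) x‖ₑ :=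
      ((continuous_fourierInv (h.integrable_rootSymbol ht)).sub
        (continuous_fourierInv (h.integrable_rootSymbol hs))).measurable.enorm
    calc ∫⁻ x, ‖rootKernel ψ lam ε t x - rootKernel ψ lam ε s x‖ₑ
        ≤ ∫⁻ x, (‖𝓕⁻ (rootSymbol ψ t) x - 𝓕⁻ (rootSymbol ψ s) x‖ₑ +
            ENNReal.ofReal ((t - s) / s) * ‖𝓕⁻ (rootSymbol ψ s) x‖ₑ) := by
          refine lintegral_mono fun x => ?_
          rw [rootKernel, rootKernel, if_pos (h1.trans hst), if_pos h1]
          have e : ((Real.exp (-lam * t) : ℝ) : ℂ) * 𝓕⁻ (rootSymbol ψ t) x -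
              ((Real.exp (-lam * s) : ℝ) : ℂ) * 𝓕⁻ (rootSymbol ψ s) x =
              ((Real.exp (-lam * t) : ℝ) : ℂ) *
                (𝓕⁻ (rootSymbol ψ t) x - 𝓕⁻ (rootSymbol ψ s) x) +
              ((Real.exp (-lam * t) - Real.exp (-lam * s) : ℝ) : ℂ) *
                𝓕⁻ (rootSymbol ψ s) x := by push_cast; ring
          rw [e]
          refine (enorm_add_le _ _).trans (add_le_add
            (enorm_ofReal_mul_le (Real.exp_nonneg _) (exp_neg_mul_le_one hlam ht.le) _) ?_)
          rw [enorm_mul]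
          refine mul_le_mul_left ?_ _
          rw [← ofReal_norm, Complex.norm_real, Real.norm_eq_abs]
          exact ENNReal.ofReal_le_ofReal (abs_exp_sub_exp_le hlam hs hst)
      _ ≤ ENNReal.ofReal (4 * C * rootConst C * s ^ (-(1 / 2) : ℝ) * ((t - s) / s)) +
            ENNReal.ofReal ((t - s) / s) *
              ENNReal.ofReal (rootConst C * s ^ (-(1 / 2) : ℝ)) := by
          rw [lintegral_add_left hms, lintegral_const_mul' _ _ ENNReal.ofReal_ne_top]
          exact add_le_add (h.lintegral_rootKernel_sub_le hs hst)
            (mul_le_mul_right (h.lintegral_rootKernel_le hs) _)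
      _ = _ := by
          rw [← ENNReal.ofReal_mul hd, ← ENNReal.ofReal_add (by positivity) (by positivity)]
          congr 1; ring
  · push Not at h1
    by_cases h2 : ε ≤ t
    · rw [if_pos ⟨h1, h2⟩]
      calc _ ≤ ∫⁻ x, ‖𝓕⁻ (rootSymbol ψ t) x‖ₑ := lintegral_mono fun x => by
            rw [rootKernel.eq_def ψ lam ε s, if_neg h1.not_ge, sub_zero]
            exact enorm_rootKernel_le hlam ht.le x
        _ ≤ _ := (h.lintegral_rootKernel_le ht).trans (ENNReal.ofReal_le_ofReal ?_)
      have h3 : t ^ (-(1 / 2) : ℝ) ≤ s ^ (-(1 / 2) : ℝ) :=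
        Real.rpow_le_rpow_of_nonpos hs hst (by norm_num)
      calc rootConst C * t ^ (-(1 / 2) : ℝ) ≤ 1 * rootConst C * s ^ (-(1 / 2) : ℝ) * 1 := by
            rw [one_mul, mul_one]; gcongr
        _ ≤ _ := by gcongr <;> linarith
    · have : ∀ x, ‖rootKernel ψ lam ε t x - rootKernel ψ lam ε s x‖ₑ = 0 := fun x => by
        rw [rootKernel, rootKernel, if_neg h2, if_neg h1.not_ge]; simp
      simp [this]

/-- Upper bound for small scales. -/
lemma scale_div_rpow_le (h : IsScaledSymbol ψ w p q β C) {u η M : ℝ} (hu : 0 < u) (hη : 0 < η)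
    (huM : u ≤ M * w η) :
    (scale w u / η) ^ β ≤ (C ^ (β / q) + (C * M) ^ (β / p)) * (u / w η) ^ (β / q) := by
  have hs := h.scale_pos hu
  have hδ := h.pos η hη
  have hC := h.pos_C
  have hp := h.pos_p
  have hq := h.pos_q
  have hβ := h.pos_β
  have hM : 0 < M := by
    by_contra hM; push Not at hM; nlinarith
  have hx : 0 < u / w η := by positivity
  set y := scale w u / η with hy
  have hy0 : 0 < y := by positivity
  have hroot : ∀ r, 0 < r → y ^ r ≤ C * (u / w η) → y ^ β ≤ (C * (u / w η)) ^ (β / r) := by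
    intro r hr hyr
    calc y ^ β = (y ^ r) ^ (β / r) := by rw [← Real.rpow_mul hy0.le, mul_div_cancel₀ _ hr.ne']
      _ ≤ _ := Real.rpow_le_rpow (by positivity) hyr (by positivity)
  -- Below η the upper power bound gives the exponent β/q. Above η the lower bound gives β/p
  -- instead, but there u / w η lies in [1, M], so powers of it only change the constant.
  rcases le_total (scale w u) η with hle | hle
  · have h1 := h.upper _ _ hs hle
    rw [h.w_scale hu] at h1
    have h2 : y ^ q ≤ C * (u / w η) := by
      rw [hy, ← inv_div, Real.inv_rpow (by positivity), ← mul_div_assoc, le_div_iff₀ hδ,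
        inv_mul_le_iff₀ (by positivity)]
      linarith
    calc y ^ β ≤ (C * (u / w η)) ^ (β / q) := hroot q hq h2
      _ = C ^ (β / q) * (u / w η) ^ (β / q) := Real.mul_rpow hC.le hx.le
      _ ≤ _ := by gcongr; exact le_add_of_nonneg_right (by positivity)
  · have h1 := h.lower _ _ hη hle
    have h3 := h.mono _ _ hη hle
    rw [h.w_scale hu] at h1 h3
    have h2 : y ^ p ≤ C * (u / w η) := by
      rw [← mul_div_assoc, le_div_iff₀ hδ]; exact h1
    have hx1 : 1 ≤ u / w η := by rwa [one_le_div hδ]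
    calc y ^ β ≤ (C * (u / w η)) ^ (β / p) := hroot p hp h2
      _ ≤ (C * M) ^ (β / p) * 1 := by
          rw [mul_one]
          gcongr
          rwa [div_le_iff₀ hδ]
      _ ≤ (C * M) ^ (β / p) * (u / w η) ^ (β / q) := by
          gcongr
          exact Real.one_le_rpow hx1 (by positivity)
      _ ≤ _ := by gcongr; exact le_add_of_nonneg_left (by positivity)

/-- As w η < u forces η ≤ scale w u, the upper power bound between these two radii can be inverted.
-/
lemma div_scale_le (h : IsScaledSymbol ψ w p q β C) {u η : ℝ} (hη : 0 < η) (hu : w η < u) :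
    η / scale w u ≤ (C * w η / u) ^ (1 / q) := by
  have hδ := h.pos η hη
  have hu0 : 0 < u := hδ.trans hu
  have hs := h.scale_pos hu0
  have hC := h.one_le_C
  have hq := h.pos_q
  have hle : η ≤ scale w u := by
    by_contra hle
    push Not at hle
    have h1 := h.mono _ _ hs hle.le
    rw [h.w_scale hu0] at h1
    linarith
  have h1 := h.upper _ _ hη hle
  rw [h.w_scale hu0] at h1
  have h2 : (η / scale w u) ^ q ≤ C * w η / u := by
    rw [← inv_div, Real.inv_rpow (by positivity), le_div_iff₀ hu0,
      inv_mul_le_iff₀ (by positivity)]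
    linarith
  calc η / scale w u = ((η / scale w u) ^ q) ^ (1 / q) := by
        rw [← Real.rpow_mul (by positivity), mul_one_div_cancel hq.ne', Real.rpow_one]
    _ ≤ _ := Real.rpow_le_rpow (by positivity) h2 (by positivity)

end IsScaledSymbol

end LevyKernel

end

/-! ### Near and far regions in time -/

noncomputable section

namespace LevyKernel

variable {V : Type*} [NormedAddCommGroup V] [InnerProductSpace ℝ V]
    [FiniteDimensional ℝ V] [MeasurableSpace V] [BorelSpace V]

namespace IsScaledSymbol

variable {ψ : V → ℂ} {w : ℝ → ℝ} {p q β C : ℝ} {lam ε : ℝ}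

/-- The bound for the tail of the kernel at time `u ≤ M * δ`. -/
def tailBound (q β B M δ u : ℝ) : ℝ :=
  (Ioc 0 (M * δ)).indicator (fun u => B * u ^ (-(1 / 2) : ℝ) * (u / δ) ^ (β / q)) u

/-- The square is a multiple of u^(2β/q - 1), integrable at 0 thanks to the spatial decay exponent
β. All powers of δ cancel, so the bound is the same at every scale. -/
lemma lintegral_tailBound_sq {q β B M δ : ℝ} (hq : 0 < q) (hβ : 0 < β) (hM : 0 < M)
    (hδ : 0 < δ) :
    ∫⁻ u, ENNReal.ofReal (tailBound q β B M δ u ^ 2) =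
      ENNReal.ofReal (B ^ 2 * M ^ (2 * β / q) / (2 * β / q)) := by
  set γ := 2 * β / q with hγ
  have hγ0 : 0 < γ := by positivity
  have hMδ : 0 < M * δ := by positivity
  have e : ∀ u, ENNReal.ofReal (tailBound q β B M δ u ^ 2) = (Ioc 0 (M * δ)).indicator
      (fun u => ENNReal.ofReal (B ^ 2 * (δ ^ γ)⁻¹ * u ^ (γ - 1))) u := by
    intro u
    unfold tailBound
    by_cases hu : u ∈ Ioc 0 (M * δ)
    · rw [indicator_of_mem hu, indicator_of_mem hu]
      congr 1
      have hu0 := hu.1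
      rw [mul_pow, mul_pow, ← Real.rpow_natCast (u ^ _), ← Real.rpow_mul hu0.le,
        ← Real.rpow_natCast ((u / δ) ^ _), ← Real.rpow_mul (by positivity),
        show β / q * ((2 : ℕ) : ℝ) = γ by rw [hγ]; push_cast; ring,
        show (-(1 / 2) * ((2 : ℕ) : ℝ) : ℝ) = -1 by norm_num, Real.div_rpow hu0.le hδ.le,
        sub_eq_add_neg, Real.rpow_add hu0]
      ring
    · rw [indicator_of_notMem hu, indicator_of_notMem hu]; simp
  simp only [e]
  rw [lintegral_indicator measurableSet_Ioc]
  have hi : IntegrableOn (fun u : ℝ => B ^ 2 * (δ ^ γ)⁻¹ * u ^ (γ - 1)) (Ioc 0 (M * δ)) :=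
    ((intervalIntegrable_iff_integrableOn_Ioc_of_le hMδ.le).1
      (intervalIntegral.intervalIntegrable_rpow' (by linarith))).const_mul _
  rw [← ofReal_integral_eq_lintegral_ofReal hi, integral_const_mul,
    ← intervalIntegral.integral_of_le hMδ.le, integral_rpow (Or.inl (by linarith))]
  · congr 1
    rw [sub_add_cancel, Real.zero_rpow hγ0.ne', Real.mul_rpow hM.le hδ.le]
    have : 0 < δ ^ γ := by positivity
    field_simp; ring
  · filter_upwards [ae_restrict_mem measurableSet_Ioc] with u hu
    have := hu.1
    simp only [Pi.zero_apply]
    positivity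

lemma lintegral_rootKernel_tail_le_tailBound (h : IsScaledSymbol ψ w p q β C) (hlam : 0 ≤ lam)
    (hε : 0 < ε) {η M : ℝ} (hη : 0 < η) {u : ℝ} (huM : u ≤ M * w η) :
    ∫⁻ x in {x : V | η ≤ ‖x‖}, ‖rootKernel ψ lam ε u x‖ₑ ≤
      ENNReal.ofReal (tailBound q β (rootConst C * (C ^ (β / q) + (C * M) ^ (β / p))) M (w η) u) := by
  rcases le_or_gt u 0 with hu | hu
  · simp [rootKernel_of_nonpos hε hu]
  · rw [tailBound, indicator_of_mem (show u ∈ Ioc 0 (M * w η) from ⟨hu, huM⟩)]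
    refine (lintegral_mono fun x => enorm_rootKernel_le hlam hu.le x).trans
      ((h.lintegral_rootKernel_tail_le hu hη).trans (ENNReal.ofReal_le_ofReal ?_))
    have hR := h.rootConst_pos
    calc _ ≤ rootConst C * u ^ (-(1 / 2) : ℝ) *
          ((C ^ (β / q) + (C * M) ^ (β / p)) * (u / w η) ^ (β / q)) := by
          gcongr; exact h.scale_div_rpow_le hu hη huM
      _ = _ := by ring

/-- The region close to the origin in time, away from the origin in space. -/
lemma lintegral_near_le (h : IsScaledSymbol ψ w p q β C) (hlam : 0 ≤ lam)
    (hε : 0 < ε) {η M R : ℝ} (hη : 0 < η) (hR : 2 * η ≤ R) {s t : ℝ} {y : V} (hy : ‖y‖ ≤ η)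
    (ht : t ≤ M * w η) (hts : t - s ≤ M * w η) :
    ∫⁻ x in {x : V | R ≤ ‖x‖}, ‖rootKernel ψ lam ε (t - s) (x - y) - rootKernel ψ lam ε t x‖ₑ ≤
      ENNReal.ofReal (tailBound q β (rootConst C * (C ^ (β / q) + (C * M) ^ (β / p))) M (w η)
        (t - s)) +
      ENNReal.ofReal (tailBound q β (rootConst C * (C ^ (β / q) + (C * M) ^ (β / p))) M (w η) t) := by
  have hms : ∀ r, MeasurableSet {x : V | r ≤ ‖x‖} := fun r =>
    measurableSet_le measurable_const measurable_norm
  have hm : Measurable fun x : V => ‖rootKernel ψ lam ε t x‖ₑ := by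
    unfold rootKernel
    split_ifs with ht
    · exact ((continuous_fourierInv (h.integrable_rootSymbol
        (hε.trans_le ht))).measurable.const_mul _).enorm
    · exact measurable_const.enorm
  calc _ ≤ ∫⁻ x in {x : V | R ≤ ‖x‖}, (‖rootKernel ψ lam ε (t - s) (x - y)‖ₑ +
          ‖rootKernel ψ lam ε t x‖ₑ) := lintegral_mono fun x => by
        rw [sub_eq_add_neg]
        exact (enorm_add_le _ _).trans_eq (by rw [enorm_neg])
    _ = (∫⁻ x in {x : V | R ≤ ‖x‖}, ‖rootKernel ψ lam ε (t - s) (x - y)‖ₑ) +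
          ∫⁻ x in {x : V | R ≤ ‖x‖}, ‖rootKernel ψ lam ε t x‖ₑ := lintegral_add_right _ hm
    _ ≤ (∫⁻ x in {x : V | η ≤ ‖x‖}, ‖rootKernel ψ lam ε (t - s) x‖ₑ) +
          ∫⁻ x in {x : V | η ≤ ‖x‖}, ‖rootKernel ψ lam ε t x‖ₑ := by
        -- As R ≥ 2η and ‖y‖ ≤ η, the shifted point x - y stays outside the ball of radius η, so the
        -- same tail estimate serves for both kernels.
        refine add_le_add ?_ (lintegral_mono_set fun x hx => ?_)
        · rw [← lintegral_indicator (hms R), ← lintegral_indicator (hms η),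
            ← lintegral_sub_right_eq_self
              ({x : V | η ≤ ‖x‖}.indicator fun x => ‖rootKernel ψ lam ε (t - s) x‖ₑ) y]
          refine lintegral_mono fun x => ?_
          by_cases hx : x ∈ {x : V | R ≤ ‖x‖}
          · rw [indicator_of_mem hx, indicator_of_mem]
            rw [mem_ofPred_eq] at hx ⊢
            have := norm_sub_norm_le x y
            linarith
          · rw [indicator_of_notMem hx]; exact zero_le
        · rw [mem_ofPred_eq] at hx ⊢; linarith
    _ ≤ _ := add_le_add (h.lintegral_rootKernel_tail_le_tailBound hlam hε hη hts)
        (h.lintegral_rootKernel_tail_le_tailBound hlam hε hη ht)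

open scoped Classical in
/-- The region away from the origin in time. -/
lemma lintegral_far_le (h : IsScaledSymbol ψ w p q β C) (hlam : 0 ≤ lam)
    (hε : 0 < ε) {η : ℝ} (hη : 0 < η) {s t : ℝ} {y : V} (hy : ‖y‖ ≤ η) (hs : |s| ≤ w η)
    (ht : 4 * C * w η ≤ t) :
    ∫⁻ x, ‖rootKernel ψ lam ε (t - s) (x - y) - rootKernel ψ lam ε t x‖ₑ ≤
      ENNReal.ofReal ((8 * Real.pi * C + 2 * (4 * C + 1)) * rootConst C * t ^ (-(1 / 2) : ℝ) *
        ((4 * C * w η / t) ^ min (1 / q) 1 + if |t - ε| ≤ w η then 1 else 0)) := by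
  have hδ := h.pos η hη
  have hC := h.one_le_C
  have hR := h.rootConst_pos
  have hq := h.pos_q
  obtain ⟨hs1, hs2⟩ := abs_le.1 hs
  set δ := w η with hδdef
  have h4 : 4 * δ ≤ t := by nlinarith
  have ht0 : 0 < t := by linarith
  set u := t - s with hu
  have hut : t / 2 ≤ u := by linarith
  have hu0 : 0 < u := by linarith
  -- Spatial increments decay like X^(1/q) and temporal ones like X. Since X ≤ 1, the smaller
  -- exponent covers both.
  set γ := min (1 / q) 1 with hγ
  have hγ0 : 0 < γ := lt_min (by positivity) one_pos
  set X := 4 * C * δ / t with hX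
  have hX0 : 0 < X := by positivity
  have hX1 : X ≤ 1 := by rwa [hX, div_le_one ht0]
  set τ := t ^ (-(1 / 2) : ℝ) with hτ
  have hτ0 : 0 < τ := by positivity
  have hmin : ∀ v, t / 2 ≤ v → v ^ (-(1 / 2) : ℝ) ≤ 2 * τ := fun v hv =>
    (Real.rpow_le_rpow_of_nonpos (by positivity) hv (by norm_num)).trans (half_rpow_le ht0)
  set J : ℝ := if |t - ε| ≤ δ then 1 else 0 with hJ
  have hJ0 : 0 ≤ J := by rw [hJ]; split_ifs <;> norm_num
  have hspace : ∫⁻ x, ‖rootKernel ψ lam ε u (x - y) - rootKernel ψ lam ε u x‖ₑ ≤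
      ENNReal.ofReal (8 * Real.pi * C * rootConst C * τ * X ^ γ) := by
    refine (lintegral_mono fun x => enorm_rootKernel_translate_le hlam hu0.le x y).trans
      ((h.lintegral_rootKernel_translate_le hu0 y).trans (ENNReal.ofReal_le_ofReal ?_))
    have hsc := h.scale_pos (by positivity : 0 < u / 2)
    have h1 : ‖y‖ / scale w (u / 2) ≤ X ^ γ := by
      calc ‖y‖ / scale w (u / 2) ≤ η / scale w (u / 2) := by gcongr
        _ ≤ (C * w η / (u / 2)) ^ (1 / q) := h.div_scale_le hη (by rw [← hδdef]; linarith)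
        _ ≤ X ^ (1 / q) := by
            refine Real.rpow_le_rpow (by positivity) ?_ (by positivity)
            rw [hX, ← hδdef, div_le_div_iff₀ (by positivity) ht0]
            have : 0 < C * δ := by positivity
            nlinarith
        _ ≤ X ^ γ := Real.rpow_le_rpow_of_exponent_ge hX0 hX1 (min_le_left _ _)
    calc _ ≤ 4 * Real.pi * C * rootConst C * (2 * τ) * X ^ γ := by gcongr; exact hmin u hut
      _ = _ := by ring
  have htime : ∫⁻ x, ‖rootKernel ψ lam ε u x - rootKernel ψ lam ε t x‖ₑ ≤
      ENNReal.ofReal (2 * (4 * C + 1) * rootConst C * τ * (X ^ γ + J)) := by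
    -- The shifted time t - s may lie on either side of t, so the estimate is stated for an ordered
    -- pair containing t. If ε separates the pair, it is within δ of t.
    have key : ∀ a b : ℝ, a ≤ b → t / 2 ≤ a → b - a ≤ δ → (a = t ∨ b = t) →
        ∫⁻ x, ‖rootKernel ψ lam ε b x - rootKernel ψ lam ε a x‖ₑ ≤
          ENNReal.ofReal (2 * (4 * C + 1) * rootConst C * τ * (X ^ γ + J)) := by
      intro a b hab ha hbδ hor
      have ha0 : 0 < a := by linarith
      refine (h.lintegral_rootKernel_time_le hlam ha0 hab).trans (ENNReal.ofReal_le_ofReal ?_)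
      have h1 : (b - a) / a ≤ X ^ γ := by
        calc (b - a) / a ≤ X := by
              rw [hX, div_le_div_iff₀ ha0 ht0]
              have h0 : 0 ≤ b - a := by linarith
              calc (b - a) * t ≤ δ * t := by gcongr
                _ ≤ 4 * C * δ * a := by nlinarith [mul_pos hδ ha0]
          _ = X ^ (1 : ℝ) := (Real.rpow_one X).symm
          _ ≤ X ^ γ := Real.rpow_le_rpow_of_exponent_ge hX0 hX1 (min_le_right _ _)
      have h2 : (if a < ε ∧ ε ≤ b then (1 : ℝ) else 0) ≤ J := by
        by_cases hc : a < ε ∧ ε ≤ b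
        · have : |t - ε| ≤ δ := by
            rw [abs_le]
            rcases hor with rfl | rfl <;> constructor <;> linarith [hc.1, hc.2]
          rw [if_pos hc, hJ, if_pos this]
        · rw [if_neg hc]; exact hJ0
      have h3 : 0 ≤ (b - a) / a := div_nonneg (by linarith) ha0.le
      have h4 : (0 : ℝ) ≤ if a < ε ∧ ε ≤ b then (1 : ℝ) else 0 := by split_ifs <;> norm_num
      calc _ ≤ (4 * C + 1) * rootConst C * (2 * τ) * (X ^ γ + J) := by
            gcongr; exact hmin a ha
        _ = _ := by ring
    rcases le_total t u with htu | htu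
    · exact key t u htu (by linarith) (by linarith) (Or.inl rfl)
    · simp only [← enorm_neg (rootKernel ψ lam ε u _ - rootKernel ψ lam ε t _), neg_sub]
      exact key u t htu hut (by linarith) (Or.inr rfl)
  have hmeas : Measurable fun x => ‖rootKernel ψ lam ε u (x - y) - rootKernel ψ lam ε u x‖ₑ := by
    simpa only [sub_zero] using h.measurable_enorm_rootKernel_sub (lam := lam) hε u u y 0
  calc _ ≤ ∫⁻ x, (‖rootKernel ψ lam ε u (x - y) - rootKernel ψ lam ε u x‖ₑ +
          ‖rootKernel ψ lam ε u x - rootKernel ψ lam ε t x‖ₑ) := lintegral_mono fun x => by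
        rw [← sub_add_sub_cancel _ (rootKernel ψ lam ε u x)]
        exact enorm_add_le _ _
    _ ≤ _ := by
        rw [lintegral_add_left hmeas]
        refine (add_le_add hspace htime).trans ?_
        have hXγ : 0 < X ^ γ := by positivity
        rw [← ENNReal.ofReal_add (by positivity) (by positivity)]
        refine ENNReal.ofReal_le_ofReal ?_
        have : 0 ≤ 8 * Real.pi * C * rootConst C * τ * J := by positivity
        linarith

end IsScaledSymbol

end LevyKernel

end

/-! ### The Hörmander estimate for scaled symbols -/

noncomputable section

namespace LevyKernel

variable {V : Type*} [NormedAddCommGroup V] [InnerProductSpace ℝ V]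
    [FiniteDimensional ℝ V] [MeasurableSpace V] [BorelSpace V]

lemma two_term_sq_le {x : ℝ≥0∞} {a b : ℝ} (ha : 0 ≤ a) (hb : 0 ≤ b)
    (h : x ≤ ENNReal.ofReal a + ENNReal.ofReal b) :
    x ^ 2 ≤ ENNReal.ofReal (2 * a ^ 2) + ENNReal.ofReal (2 * b ^ 2) := by
  rw [← ENNReal.ofReal_add ha hb] at h
  rw [← ENNReal.ofReal_add (by positivity) (by positivity)]
  calc x ^ 2 ≤ ENNReal.ofReal (a + b) ^ 2 := by gcongr
    _ = ENNReal.ofReal ((a + b) ^ 2) := (ENNReal.ofReal_pow (by positivity) 2).symm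
    _ ≤ _ := ENNReal.ofReal_le_ofReal (by nlinarith [sq_nonneg (a - b)])

/-- The square of the bound for the kernel difference at large times is integrable. -/
lemma lintegral_far_bound {γ D T : ℝ} (hγ : 0 < γ) (hD : 0 < D) (hDT : D ≤ T) :
    ∫⁻ t in Ici T, ENNReal.ofReal (t⁻¹ * ((D / t) ^ γ) ^ 2) ≤ ENNReal.ofReal (1 / (2 * γ)) := by
  have hT : 0 < T := hD.trans_le hDT
  have e : ∀ t ∈ Ioi T, ENNReal.ofReal (t⁻¹ * ((D / t) ^ γ) ^ 2) =
      ENNReal.ofReal (D ^ (2 * γ) * t ^ (-(2 * γ) - 1)) := by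
    intro t ht
    have ht0 : 0 < t := hT.trans ht
    congr 1
    rw [← Real.rpow_natCast (_ ^ γ), ← Real.rpow_mul (by positivity),
      show γ * ((2 : ℕ) : ℝ) = 2 * γ by push_cast; ring, Real.div_rpow hD.le ht0.le,
      sub_eq_add_neg, Real.rpow_add ht0, Real.rpow_neg_one, Real.rpow_neg ht0.le]
    ring
  rw [setLIntegral_congr (Ioi_ae_eq_Ici).symm, setLIntegral_congr_fun measurableSet_Ioi e]
  have hi : IntegrableOn (fun t : ℝ => D ^ (2 * γ) * t ^ (-(2 * γ) - 1)) (Ioi T) :=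
    (integrableOn_Ioi_rpow_of_lt (by linarith) hT).const_mul _
  rw [← ofReal_integral_eq_lintegral_ofReal hi, integral_const_mul,
    integral_Ioi_rpow_of_lt (by linarith) hT]
  · refine ENNReal.ofReal_le_ofReal ?_
    rw [sub_add_cancel, neg_div_neg_eq, Real.rpow_neg hT.le]
    have h1 : D ^ (2 * γ) ≤ T ^ (2 * γ) := Real.rpow_le_rpow hD.le hDT (by positivity)
    have h2 : 0 < T ^ (2 * γ) := by positivity
    rw [← mul_div_assoc]
    gcongr
    rwa [← div_eq_mul_inv, div_le_one h2]
  · filter_upwards [ae_restrict_mem measurableSet_Ioi] with t ht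
    have : 0 < t := hT.trans ht
    simp only [Pi.zero_apply]
    positivity

namespace IsScaledSymbol

variable {ψ : V → ℂ} {w : ℝ → ℝ} {p q β C : ℝ}

/-- The Hörmander type estimate for the damped kernel, uniform in the damping and the cut-off. -/
theorem exists_lintegral_rootKernel_le (h : IsScaledSymbol ψ w p q β C) :
    ∃ C₀ : ℝ, 0 < C₀ ∧ ∃ N : ℝ, 0 < N ∧ ∀ lam : ℝ, 0 ≤ lam → ∀ ε : ℝ, 0 < ε → ∀ η : ℝ, 0 < η →
      ∀ s : ℝ, |s| ≤ w η → ∀ y : V, ‖y‖ ≤ η →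
      ∫⁻ t : ℝ, (∫⁻ x in {x | (t, x) ∉ Ioo (-(w (C₀ * η))) (w (C₀ * η)) ×ˢ Metric.ball 0 (C₀ * η)},
        ‖rootKernel ψ lam ε (t - s) (x - y) - rootKernel ψ lam ε t x‖ₑ) ^ 2 ≤
        ENNReal.ofReal N := by
  have hC1 := h.one_le_C
  have hC : 0 < C := h.pos_C
  have hp := h.pos_p
  have hq := h.pos_q
  have hβ := h.pos_β
  -- The 2 keeps translated points away from the origin. The other entry, through the lower power
  -- bound, makes w(C₀η) ≥ 4Cδ, as the far estimate requires.
  set C₀ : ℝ := max 2 ((4 * C ^ 2) ^ (1 / p)) with hC₀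
  have hC₀2 : 2 ≤ C₀ := le_max_left _ _
  have hC₀0 : 0 < C₀ := by linarith
  have hC₀p : 4 * C ^ 2 ≤ C₀ ^ p := by
    calc 4 * C ^ 2 = ((4 * C ^ 2) ^ (1 / p)) ^ p := by
          rw [← Real.rpow_mul (by positivity), one_div_mul_cancel hp.ne', Real.rpow_one]
      _ ≤ _ := Real.rpow_le_rpow (by positivity) (le_max_right _ _) hp.le
  -- By the upper power bound w(C₀η) + δ ≤ Mδ, so t < w(C₀η) keeps both t and t - s at most Mδ.
  set M : ℝ := C * C₀ ^ q + 1 with hM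
  have hM0 : 0 < M := by positivity
  set B : ℝ := rootConst C * (C ^ (β / q) + (C * M) ^ (β / p)) with hB
  have hR := h.rootConst_pos
  have hB0 : 0 < B := by positivity
  set γ : ℝ := min (1 / q) 1 with hγ
  have hγ0 : 0 < γ := lt_min (by positivity) one_pos
  set A : ℝ := (8 * Real.pi * C + 2 * (4 * C + 1)) * rootConst C with hA
  have hA0 : 0 < A := by positivity
  set N₁ : ℝ := B ^ 2 * M ^ (2 * β / q) / (2 * β / q) with hN₁
  have hN₁0 : 0 < N₁ := by positivity
  refine ⟨C₀, hC₀0, 4 * N₁ + 2 * A ^ 2 * (1 / (2 * γ)) + 4 * A ^ 2, by positivity,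
    fun lam hlam ε hε η hη s hs y hy => ?_⟩
  have hδ := h.pos η hη
  set δ := w η with hδdef
  have hηC : η ≤ C₀ * η := by nlinarith
  set T := w (C₀ * η) with hT
  have hTδ : 4 * C * δ ≤ T := by
    have := h.lower η (C₀ * η) hη hηC
    rw [mul_div_cancel_right₀ _ hη.ne', ← hδdef, ← hT] at this
    have h2 : 4 * C ^ 2 * δ ≤ C * T := le_trans (by gcongr) this
    nlinarith
  have hTM : T + δ ≤ M * δ := by
    have := h.upper η (C₀ * η) hη hηC
    rw [mul_div_cancel_right₀ _ hη.ne', ← hδdef, ← hT] at this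
    rw [hM]; linarith
  have hδT : δ ≤ T := by nlinarith
  have hT0 : 0 < T := by linarith
  obtain ⟨hs1, hs2⟩ := abs_le.1 hs
  set S : ℝ → Set V := fun t => {x | (t, x) ∉ Ioo (-T) T ×ˢ Metric.ball 0 (C₀ * η)} with hS
  set τ := tailBound q β B M δ with hτ
  have hτ0 : ∀ u, 0 ≤ τ u := fun u => by
    rw [hτ, tailBound]
    refine indicator_nonneg (fun v hv => ?_) u
    have := hv.1
    positivity
  -- Three ranges of t. For t ≥ T the moduli of continuity are used on all of space. For t ≤ -T both
  -- times are nonpositive, since |s| ≤ δ ≤ T, and the kernels vanish. In between, the complement of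
  -- the cylinder forces ‖x‖ ≥ C₀η and tails are used.
  have hpt : ∀ t, (∫⁻ x in S t, ‖rootKernel ψ lam ε (t - s) (x - y) - rootKernel ψ lam ε t x‖ₑ) ^ 2
      ≤ (ENNReal.ofReal (2 * τ (t - s) ^ 2) + ENNReal.ofReal (2 * τ t ^ 2)) +
        ((Ici T).indicator (fun t => ENNReal.ofReal (2 * A ^ 2 *
            (t⁻¹ * ((4 * C * δ / t) ^ γ) ^ 2))) t +
          (Icc (ε - δ) (ε + δ)).indicator (fun _ => ENNReal.ofReal (2 * A ^ 2 / δ)) t) := by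
    intro t
    rcases le_or_gt T t with hTt | htT
    · refine le_trans ?_ le_add_self
      rw [indicator_of_mem (show t ∈ Ici T from hTt)]
      have ht0 : 0 < t := hT0.trans_le hTt
      have h1 := (setLIntegral_le_lintegral (S t) _).trans
        (h.lintegral_far_le hlam hε hη hy hs (hTδ.trans hTt))
      rw [mul_add, ENNReal.ofReal_add (by positivity) (by split_ifs <;> positivity)] at h1
      refine (two_term_sq_le (by positivity) (by split_ifs <;> positivity) h1).trans
        (add_le_add (le_of_eq ?_) ?_)
      · congr 1
        rw [mul_pow, mul_pow, ← Real.rpow_natCast (t ^ _), ← Real.rpow_mul ht0.le,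
          show (-(1 / 2) * ((2 : ℕ) : ℝ) : ℝ) = -1 by norm_num, Real.rpow_neg_one]
        ring
      · split_ifs with hc
        · have hmem : t ∈ Icc (ε - δ) (ε + δ) := by
            rw [abs_le] at hc
            exact ⟨by linarith [hc.1], by linarith [hc.2]⟩
          rw [indicator_of_mem hmem]
          refine ENNReal.ofReal_le_ofReal ?_
          rw [mul_one, mul_pow, ← Real.rpow_natCast (t ^ _), ← Real.rpow_mul ht0.le,
            show (-(1 / 2) * ((2 : ℕ) : ℝ) : ℝ) = -1 by norm_num, Real.rpow_neg_one, ← mul_assoc,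
            ← div_eq_mul_inv]
          -- t ≥ δ gives t⁻¹ ≤ δ⁻¹, which balances the length 2δ of the interval where the cut-off
          -- jump is felt.
          have := hδT.trans hTt
          gcongr
        · simp
    rcases le_or_gt t (-T) with htT' | htT'
    · have hz : ∀ x, ‖rootKernel ψ lam ε (t - s) (x - y) - rootKernel ψ lam ε t x‖ₑ = 0 := by
        intro x
        rw [rootKernel_of_nonpos hε (by linarith), rootKernel_of_nonpos hε (by linarith)]
        simp
      simp [hz]
    · refine le_trans ?_ le_self_add
      have hSt : S t ⊆ {x : V | C₀ * η ≤ ‖x‖} := by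
        intro x hx
        rw [mem_ofPred_eq] at hx ⊢
        by_contra hc
        push Not at hc
        exact hx ⟨⟨htT', htT⟩, by simpa using hc⟩
      exact two_term_sq_le (hτ0 _) (hτ0 _) ((lintegral_mono_set hSt).trans
        (h.lintegral_near_le hlam hε hη (by gcongr) hy (by linarith) (by linarith)))
  have hτm : Measurable fun t => ENNReal.ofReal (2 * τ t ^ 2) := by
    have : Measurable τ := by
      rw [hτ]
      unfold tailBound
      refine Measurable.indicator ?_ measurableSet_Ioc
      fun_prop
    fun_prop
  have htau : ∫⁻ t, ENNReal.ofReal (2 * τ t ^ 2) = ENNReal.ofReal (2 * N₁) := by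
    simp only [ENNReal.ofReal_mul (zero_le_two : (0 : ℝ) ≤ 2)]
    rw [lintegral_const_mul' _ _ ENNReal.ofReal_ne_top, lintegral_tailBound_sq hq hβ hM0 hδ]
  calc _ ≤ ∫⁻ t, ((ENNReal.ofReal (2 * τ (t - s) ^ 2) + ENNReal.ofReal (2 * τ t ^ 2)) +
        ((Ici T).indicator (fun t => ENNReal.ofReal (2 * A ^ 2 *
            (t⁻¹ * ((4 * C * δ / t) ^ γ) ^ 2))) t +
          (Icc (ε - δ) (ε + δ)).indicator (fun _ => ENNReal.ofReal (2 * A ^ 2 / δ)) t)) :=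
        lintegral_mono hpt
    _ = (ENNReal.ofReal (2 * N₁) + ENNReal.ofReal (2 * N₁)) +
        ((∫⁻ t in Ici T, ENNReal.ofReal (2 * A ^ 2 * (t⁻¹ * ((4 * C * δ / t) ^ γ) ^ 2))) +
          ENNReal.ofReal (2 * A ^ 2 / δ) * ENNReal.ofReal (2 * δ)) := by
        have hτs : Measurable fun t => ENNReal.ofReal (2 * τ (t - s) ^ 2) :=
          hτm.comp (measurable_id.sub_const s)
        have hsum : Measurable fun t =>
            ENNReal.ofReal (2 * τ (t - s) ^ 2) + ENNReal.ofReal (2 * τ t ^ 2) := hτs.add hτm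
        rw [lintegral_add_left hsum, lintegral_add_left hτs,
          lintegral_sub_right_eq_self (fun t => ENNReal.ofReal (2 * τ t ^ 2)) s, htau,
          lintegral_add_right _ (measurable_const.indicator measurableSet_Icc),
          lintegral_indicator measurableSet_Ici, lintegral_indicator_const measurableSet_Icc,
          Real.volume_Icc]
        congr 4; ring
    _ ≤ (ENNReal.ofReal (2 * N₁) + ENNReal.ofReal (2 * N₁)) +
        (ENNReal.ofReal (2 * A ^ 2 * (1 / (2 * γ))) + ENNReal.ofReal (4 * A ^ 2)) := by
        gcongr
        · simp only [ENNReal.ofReal_mul (by positivity : (0 : ℝ) ≤ 2 * A ^ 2)]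
          rw [lintegral_const_mul' _ _ ENNReal.ofReal_ne_top]
          exact mul_le_mul_right (lintegral_far_bound hγ0 (by positivity) hTδ) _
        · rw [← ENNReal.ofReal_mul (by positivity)]
          refine ENNReal.ofReal_le_ofReal (le_of_eq ?_)
          field_simp; ring
    _ = _ := by
        rw [← ENNReal.ofReal_add (by positivity) (by positivity),
          ← ENNReal.ofReal_add (by positivity) (by positivity),
          ← ENNReal.ofReal_add (by positivity) (by positivity)]
        congr 1; ring

end IsScaledSymbol

end LevyKernel

end

/-! ### The law of the Lévy process and its density -/

noncomputable section

namespace LevyKernel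

section Law

variable {V : Type*} [NormedAddCommGroup V] [InnerProductSpace ℝ V]
    [FiniteDimensional ℝ V] [MeasurableSpace V] [BorelSpace V]

lemma ext_of_charF {μ μ' : Measure V} [IsFiniteMeasure μ] [IsFiniteMeasure μ']
    (h : ∀ ξ, charF μ ξ = charF μ' ξ) : μ = μ' := by
  refine Measure.ext_of_charFun (funext fun u => ?_)
  have e : ∀ ρ : Measure V, charFun ρ u = charF ρ ((2 * Real.pi)⁻¹ • u) := by
    intro ρ
    rw [charFun_apply, charF]
    congr 1; ext x
    rw [phase_eq, real_inner_smul_left, ← mul_assoc, mul_inv_cancel₀ (by positivity), one_mul,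
      real_inner_comm]
  rw [e, e, h]

lemma charF_withDensity {g : V → ℝ} (hg : Measurable g) (ξ : V) :
    charF (volume.withDensity fun x => ENNReal.ofReal (g x)) ξ =
      ∫ x, (max (g x) 0 : ℝ) * phase ⟪ξ, x⟫ := by
  rw [charF, integral_withDensity_eq_integral_toReal_smul (by fun_prop)
    (ae_of_all _ fun _ => ENNReal.ofReal_lt_top)]
  simp only [ENNReal.toReal_ofReal', Complex.real_smul]

/-- A probability measure with integrable, continuous characteristic function whose inverse
Fourier transform is integrable is absolutely continuous. -/
lemma absolutelyContinuous_of_charF {L : Measure V} [IsFiniteMeasure L] {m : V → ℂ}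
    (hm : Integrable m) (hc : Continuous m) (hf : Integrable (𝓕⁻ m))
    (hneg : ∀ ξ, m (-ξ) = (starRingEnd ℂ) (m ξ)) (hL : ∀ ξ, charF L ξ = m (-ξ)) :
    L ≪ volume := by
  set f := 𝓕⁻ m with hfdef
  have hreal : ∀ x, ((f x).re : ℂ) = f x := by
    intro x
    rw [← Complex.conj_eq_iff_re, hfdef, fourierInv_eq_phase, ← integral_conj,
      ← integral_neg_eq_self]
    congr 1; ext ξ
    rw [map_mul, hneg, Complex.conj_conj, inner_neg_left, phase_neg, Complex.conj_conj]
  have hre : Integrable fun x => (f x).re := hf.re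
  have hrm : Measurable fun x => (f x).re :=
    Complex.measurable_re.comp (continuous_fourierInv hm).measurable
  have hphase : ∀ ξ, Integrable fun x => f x * phase ⟪ξ, x⟫ := by
    intro ξ
    refine (hf.bdd_mul (c := 1) (f := fun x => phase ⟪ξ, x⟫)
      (by fun_prop : Continuous fun x : V => phase ⟪ξ, x⟫).aestronglyMeasurable
      (ae_of_all _ fun x => by simp)).congr (ae_of_all _ fun x => mul_comm _ _)
  have hfour : ∀ ξ, ∫ x, f x * phase ⟪ξ, x⟫ = m (-ξ) := by
    intro ξ
    have h1 : 𝓕 f (-ξ) = m (-ξ) := by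
      rw [hfdef, hc.fourier_fourierInv_eq hm]
      have : 𝓕 m = fun x => f (-x) := by
        ext x; rw [hfdef, Real.fourierInv_eq_fourier_neg, neg_neg]
      rw [this]; exact hf.comp_neg
    rw [← h1, fourier_eq_phase]
    congr 1; ext x
    rw [inner_neg_right, neg_neg, real_inner_comm, mul_comm]
  have hpart : ∀ g : V → ℝ, Integrable g → ∀ ξ,
      Integrable fun x => ((max (g x) 0 : ℝ) : ℂ) * phase ⟪ξ, x⟫ := by
    intro g hg ξ
    refine ((hg.pos_part.ofReal (𝕜 := ℂ)).bdd_mul (c := 1) (f := fun x => phase ⟪ξ, x⟫)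
      (by fun_prop : Continuous fun x : V => phase ⟪ξ, x⟫).aestronglyMeasurable
      (ae_of_all _ fun x => by simp)).congr (ae_of_all _ fun x => mul_comm _ _)
  have hfin : ∀ g : V → ℝ, Integrable g →
      IsFiniteMeasure (volume.withDensity fun x => ENNReal.ofReal (g x)) := fun g hg =>
    isFiniteMeasure_withDensity_ofReal hg.2
  have := hfin _ hre
  have := hfin _ hre.neg
  -- The candidate density f is real by the symmetry of m, but its sign is not known in advance.
  -- Moving its negative part to the left gives an identity between finite positive measures,
  -- verified on characteristic functions. Domination of L by an absolutely continuous measure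
  -- follows.
  have key : L + volume.withDensity (fun x => ENNReal.ofReal ((-fun x => (f x).re) x)) =
      volume.withDensity fun x => ENNReal.ofReal (f x).re := by
    refine ext_of_charF fun ξ => ?_
    have hbL : ∀ ρ : Measure V, IsFiniteMeasure ρ → Integrable (fun y => phase ⟪ξ, y⟫) ρ :=
      fun ρ hρ => (integrable_const (1 : ℝ)).mono'
        (by fun_prop : Continuous fun x : V => phase ⟪ξ, x⟫).aestronglyMeasurable
        (ae_of_all _ fun x => by simp)
    have hadd : charF (L + volume.withDensity
        (fun x => ENNReal.ofReal ((-fun x => (f x).re) x))) ξ = charF L ξ +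
        charF (volume.withDensity (fun x => ENNReal.ofReal ((-fun x => (f x).re) x))) ξ :=
      integral_add_measure (hbL _ inferInstance) (hbL _ inferInstance)
    rw [hadd, hL, charF_withDensity hrm, charF_withDensity hrm.neg, ← hfour,
      ← integral_add (hphase ξ) (hpart _ hre.neg ξ)]
    congr 1; ext x
    rw [← add_mul]
    congr 1
    rw [← hreal x, ← Complex.ofReal_add, Complex.ofReal_re]
    congr 1
    simp only [Pi.neg_apply]
    rcases le_total 0 (f x).re with h0 | h0
    · rw [max_eq_left h0, max_eq_right (by linarith)]; ring
    · rw [max_eq_right h0, max_eq_left (by linarith)]; ring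
  have hle : L ≤ volume.withDensity fun x => ENNReal.ofReal (f x).re := by
    rw [← key]; exact Measure.le_add_right le_rfl
  exact hle.absolutelyContinuous.trans (withDensity_absolutelyContinuous _ _)

lemma IsScaledSymbol.integrable_fourierInv_expSymbol {ψ : V → ℂ} {w : ℝ → ℝ} {p q β C : ℝ}
    (h : IsScaledSymbol ψ w p q β C) {t : ℝ} (ht : 0 < t) :
    Integrable (𝓕⁻ (expSymbol ψ t)) := by
  refine ⟨(continuous_fourierInv (h.integrable_expSymbol ht)).aestronglyMeasurable, ?_⟩
  rw [HasFiniteIntegral, ← wnorm_one]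
  exact ((wnorm_one_le (h.isWeight ht) _).trans (h.wnorm_expSymbol_le ht)).trans_lt
    ENNReal.ofReal_lt_top

end Law

variable {d : ℕ} {ν : Measure (EuclideanSpace ℝ (Fin d))} {σ : ℝ} {Ω : Type*} [MeasurableSpace Ω]
  {P : Measure Ω} [IsProbabilityMeasure P] {Z : ℝ≥0 → Ω → EuclideanSpace ℝ (Fin d)}
  {p q β C : ℝ}

/-- The reflected measure has symbol ψ(-ξ). Combined with the opposite sign in 𝓕, this makes exp(tψ)
itself, without reflection, the Fourier transform of the density. -/
lemma IsLevyProcess.charF_map (hZ : IsLevyProcess P σ (reflect ν) Z) {t : ℝ} (ht : 0 < t)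
    (ξ : EuclideanSpace ℝ (Fin d)) :
    charF (P.map (Z t.toNNReal)) ξ = expSymbol (symbol σ ν) t (-ξ) := by
  rw [charF, integral_map (hZ.measurable _).aemeasurable
    (by fun_prop : Continuous fun x : EuclideanSpace ℝ (Fin d) => phase ⟪ξ, x⟫).aestronglyMeasurable]
  refine (hZ.charFun t.toNNReal ξ).trans ?_
  rw [symbol_reflect, Real.coe_toNNReal t ht.le, expSymbol, mul_comm]

lemma IsLevyProcess.absolutelyContinuous (hZ : IsLevyProcess P σ (reflect ν) Z)
    (h : IsScaledSymbol (symbol σ ν) (w ν) p q β C) {t : ℝ} (ht : 0 < t) :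
    P.map (Z t.toNNReal) ≪ volume := by
  have := Measure.isProbabilityMeasure_map (μ := P) (hZ.measurable t.toNNReal).aemeasurable
  refine absolutelyContinuous_of_charF (h.integrable_expSymbol ht) (h.continuous_expSymbol t)
    (h.integrable_fourierInv_expSymbol ht) (fun ξ => ?_) (hZ.charF_map ht)
  rw [expSymbol, expSymbol, h.neg, ← Complex.exp_conj, map_mul, Complex.conj_ofReal]

/-- The Fourier transform of the transition density. -/
lemma IsLevyProcess.fourier_density (hZ : IsLevyProcess P σ (reflect ν) Z)
    (h : IsScaledSymbol (symbol σ ν) (w ν) p q β C) {t : ℝ} (ht : 0 < t)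
    (ξ : EuclideanSpace ℝ (Fin d)) :
    𝓕 (fun x => ((density P Z t x : ℝ) : ℂ)) ξ = expSymbol (symbol σ ν) t ξ := by
  have := Measure.isProbabilityMeasure_map (μ := P) (hZ.measurable t.toNNReal).aemeasurable
  have hac := hZ.absolutelyContinuous h ht
  have h1 := hZ.charF_map ht (-ξ)
  rw [neg_neg] at h1
  rw [← h1, fourier_eq_phase, charF, ← integral_rnDeriv_smul hac]
  congr 1; ext x
  rw [density, Complex.real_smul, mul_comm, inner_neg_left, real_inner_comm]

/-- The Fourier multiplier of the kernel. -/
lemma IsLevyProcess.fracSymbol_mul_fourier (hZ : IsLevyProcess P σ (reflect ν) Z)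
    (h : IsScaledSymbol (symbol σ ν) (w ν) p q β C)
    (hint : ∀ ξ, Integrable (symbolIntegrand σ ξ) ν) {t : ℝ} (ht : 0 < t)
    (ξ : EuclideanSpace ℝ (Fin d)) :
    fracSymbol σ ν (1 / 2) ξ * 𝓕 (fun x => ((density P Z t x : ℝ) : ℂ)) ξ =
      -rootSymbol (symbol σ ν) t ξ := by
  rw [hZ.fourier_density h ht, fracSymbol, symbol_symmetrize_re hint, rootSymbol, dissipation,
    neg_mul]

/-- The minus sign is that of the multiplier -(-ψ)^(1/2). It disappears once norms of differences
are taken. -/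
lemma IsLevyProcess.kernel_eq (hZ : IsLevyProcess P σ (reflect ν) Z)
    (h : IsScaledSymbol (symbol σ ν) (w ν) p q β C)
    (hint : ∀ ξ, Integrable (symbolIntegrand σ ξ) ν) (lam : ℝ) {ε : ℝ} (hε : 0 < ε) (t : ℝ)
    (x : EuclideanSpace ℝ (Fin d)) :
    kernel σ ν (density P Z) lam ε t x = -rootKernel (symbol σ ν) lam ε t x := by
  unfold kernel rootKernel
  by_cases ht : ε ≤ t
  · have ht0 : 0 < t := hε.trans_le ht
    rw [if_pos ht, if_pos ht, ← mul_neg, fracOp]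
    congr 1
    simp only [hZ.fracSymbol_mul_fourier h hint ht0, fourierInv_eq_phase, mul_neg, integral_neg]
  · rw [if_neg ht, if_neg ht, neg_zero]

end LevyKernel

end

/-! ### The main theorem -/

theorem mainTheorem2 {d : ℕ} {σ : ℝ} (hσ : σ ∈ Set.Ioo (0 : ℝ) 2)
    (ν : Measure (EuclideanSpace ℝ (Fin d))) (hν : LevyKernel.LevyClass σ ν)
    (hcont : ContinuousOn (LevyKernel.w ν) (Set.Ioi 0))
    (hORV : LevyKernel.IsORV (LevyKernel.w ν))
    (hA : LevyKernel.AssumptionA σ ν) (hB : LevyKernel.AssumptionB ν) :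
    ∃ C₀ : ℝ, 0 < C₀ ∧ ∃ N : ℝ, 0 < N ∧
      ∀ (Ω : Type*) [MeasurableSpace Ω] (P : Measure Ω) [IsProbabilityMeasure P]
        (Z : ℝ≥0 → Ω → EuclideanSpace ℝ (Fin d)),
        LevyKernel.IsLevyProcess P σ (LevyKernel.reflect ν) Z →
        (∀ t : ℝ, 0 < t →
          P.map (Z t.toNNReal) ≪ volume ∧
          Integrable (fun ξ : EuclideanSpace ℝ (Fin d) =>
            LevyKernel.fracSymbol σ ν (1 / 2) ξ *
              𝓕 (fun x => ((LevyKernel.density P Z t x : ℝ) : ℂ)) ξ) volume) ∧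
        ∀ lam : ℝ, 0 ≤ lam → ∀ ε : ℝ, 0 < ε → ∀ η : ℝ, 0 < η →
        ∀ s : ℝ, |s| ≤ LevyKernel.w ν η →
        ∀ y : EuclideanSpace ℝ (Fin d), ‖y‖ ≤ η →
          ∫⁻ t : ℝ, (∫⁻ x in {x | (t, x) ∉ LevyKernel.cylinder ν (C₀ * η)},
            ‖LevyKernel.kernel σ ν (LevyKernel.density P Z) lam ε (t - s) (x - y)
              - LevyKernel.kernel σ ν (LevyKernel.density P Z) lam ε t x‖ₑ) ^ 2
            ≤ ENNReal.ofReal N := by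
  obtain ⟨hint, p, q, β, C, h⟩ := LevyKernel.exists_isScaledSymbol hν hcont hORV hA hB
  obtain ⟨C₀, hC₀, N, hN, hmain⟩ := h.exists_lintegral_rootKernel_le
  -- The constants come from the symbol alone, so they are fixed before the probability space and
  -- the process are introduced.
  refine ⟨C₀, hC₀, N, hN, fun Ω _ P _ Z hZ => ⟨fun t ht => ⟨hZ.absolutelyContinuous h ht, ?_⟩,
    fun lam hlam ε hε η hη s hs y hy => ?_⟩⟩
  · simp only [hZ.fracSymbol_mul_fourier h hint ht]
    exact (h.integrable_rootSymbol ht).neg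
  · have e : ∀ t x, ‖LevyKernel.kernel σ ν (LevyKernel.density P Z) lam ε (t - s) (x - y)
        - LevyKernel.kernel σ ν (LevyKernel.density P Z) lam ε t x‖ₑ =
        ‖LevyKernel.rootKernel (LevyKernel.symbol σ ν) lam ε (t - s) (x - y)
        - LevyKernel.rootKernel (LevyKernel.symbol σ ν) lam ε t x‖ₑ := by
      intro t x
      rw [hZ.kernel_eq h hint lam hε, hZ.kernel_eq h hint lam hε, neg_sub_neg, ← enorm_neg, neg_sub]
    simp only [e]
    exact hmain lam hlam ε hε η hη s hs y hy
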